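/- Let $d\ge 2$, let $\mu=(\mu_1,\dots,\mu_\ell)$ be an ordered partition of $d$ into positive parts, and put $b=\ell+d-2\ge 1$. **Cacti.** A cactus of type $(0,\mu,1^d)$ is a connected graph on an oriented surface of genus $0$ with one boundary, all of whose faces are simply connected, with the following properties. 1. There are $\ell$ white faces, labelled $1,\dots,\ell$, and $d$ black faces, labelled $1,\dots,d$. The white face labelled $i$ has degree $\mu_i$ and every black face has degree $1$, where a face of degree $k$ is a polygon with $(b+1)k$ edges. 2. Every edge is an internal edge (incident to a white and a black face), a white boundary edge (incident to a white face and the boundary) or a black boundary edge (incident to a black face and the boundary). Edges are oriented with white faces on their right and black faces on their left. 3. All vertices are incident to the boundary and have a colour in $\mathbb{Z}/(b+1)$, and each edge $u\to v$ satisfies $c(v)=c(u)+1$. 4. For each colour there are exactly $d-1$ vertices of this colour with at least one incoming white boundary edge. 5. There is a canonical corner labelling, i.e. a map $\delta$ from the boundary corners to the non-negative integers, with minimum $0$, that increases by $1$ along each boundary edge; it is coherent (it is constant on the corners of each vertex) and proper (vertices of label $0$ have colour $0$), and every internal edge $u\to v$ has positive weight $(\delta(u)+1-\delta(v))/(b+1)$.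 Let $C_0(\mu,1^d)$ be the set of cacti of type $(0,\mu,1^d)$ up to orientation-preserving isomorphism respecting the labels of the faces and the colours. The marked vertex of a cactus is its vertex of label $0$. **Single Hurwitz Dyck paths.** A Dyck path is primitive if it has exactly one down-step that begins at height $1$. A $b$-Dyck path is a Dyck path in which the length of every maximal run of up-steps is a multiple of $b$; a vertex of it is distinguished if it is followed by an up-step and the number of up-steps before it is a multiple of $b$. Let $D(\mu)$ be the set of primitive $b$-Dyck paths of length $2bd$ together with a bijective labelling of the distinguished vertices by $1,\dots,d$, and with pairs $(v_i,w_i)$, $i=1,\dots,\ell$, of vertices of equal height, $(v_i)_x\le (w_i)_x$ (the marked pairs), such that 1. $((0,0),(2bd,0))$ is one of the marked pairs, and all other marked pairs consist of endpoints of down-steps; 2. the set of heights of the marked pairs modulo $b+1$ has $\ell$ elements; 3. the set of heights of the distinguished vertices modulo $b+1$ has $d$ elements; 4. the set of nonzero heights of marked pairs modulo $b+1$ and the set of nonzero heights of distinguished vertices modulo $b+1$ are disjoint; 5. the marked pairs do not cross: if $(v_i)_x\le (v_k)_x\le (w_i)_x$, then $(w_k)_x\le (w_i)_x$; 6. the part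 of the path between $v_i$ and $w_i$, with the parts between $v_k$ and $w_k$ removed for all other marked pairs $(v_k,w_k)$ contained in it, has $b\mu_i$ up-steps and $b\mu_i$ down-steps. **The two constructions.** For a cactus $C$, let $D(C)$ be the lattice path obtained by walking counterclockwise along the boundary from the marked vertex, with an up-step for each black and a down-step for each white boundary edge. The distinguished vertex labelled $j$ is the one at which the walk enters the black face labelled $j$. The two visits of a vertex that is incident to two white faces form a marked pair, labelled by the white face that the walk enters at the first visit; the two ends of the path form a marked pair labelled by the white face at the marked vertex. For $P\in D(\mu)$, let $\mathcal{C}(P)$ be the coloured graph glued along $P$ from white polygons labelled $1,\dots,\ell$, of degrees $\mu_1,\dots,\mu_\ell$, and black polygons of degree $1$ labelled $1,\dots,d$: one starts at $(0,0)$ on the white polygon labelled by the marked pair $((0,0),(2bd,0))$; each down-step follows one edge of the current white polygon counterclockwise; at the distinguished vertex labelled $j$, the black polygon labelled $j$ is glued to the next edge of the current white polygon, and the following $b$ up-steps follow its other edges; at the first vertex of any other marked pair, labelled $i$, the white polygon labelled $i$ is glued at the current vertex and becomes the current one, until the second vertex of the pair is reached. A vertex of $\mathcal{C}(P)$ corresponding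 to a vertex of $P$ of height $h$ has colour $h$ modulo $b+1$. **Proposition.** For every $C\in C_0(\mu,1^d)$, the lattice path $D(C)$ is a single Hurwitz Dyck path of type $\mu$, i.e. lies in $D(\mu)$. For every $P\in D(\mu)$, the graph $\mathcal{C}(P)$ is a cactus of type $(0,\mu,1^d)$, and $D(\mathcal{C}(P))=P$. The map $D\colon C_0(\mu,1^d)\to D(\mu)$, $C\mapsto D(C)$, is a bijection, with inverse induced by $P\mapsto\mathcal{C}(P)$. -/

import Mathlib

/-! ### Dyck paths with marked pairs

A lattice path is a list of steps; its vertices are numbered by their `x`-coordinate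
`0, 1, …, length`, and the step number `k` joins the vertices `k` and `k + 1`. -/

/-- The `y`-coordinate of the vertex with `x`-coordinate `k`. -/
def pathHeight (s : List DyckStep) (k : ℕ) : ℤ :=
  ((s.take k).count DyckStep.U : ℤ) - (s.take k).count DyckStep.D

/-- The path has exactly one return step, i.e. one down-step that begins at height `1`. -/
def IsPrimitivePath (s : List DyckStep) : Prop :=
  ∃! k : ℕ, s[k]? = some DyckStep.D ∧ pathHeight s k = 1

/-- The `r` steps that follow the vertex `k` form a maximal (nonempty) run of up-steps. -/
def IsMaximalIncrease (s : List DyckStep) (k r : ℕ) : Prop :=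
  0 < r ∧ (∀ t, k ≤ t → t < k + r → s[t]? = some DyckStep.U) ∧
    (∀ t, t + 1 = k → s[t]? ≠ some DyckStep.U) ∧ s[k + r]? ≠ some DyckStep.U

/-- A `b`-Dyck path: a Dyck path whose maximal increases have length a multiple of `b`. -/
def IsBDyckPath (b : ℕ) (s : List DyckStep) : Prop :=
  (∃ p : DyckWord, p.toList = s) ∧ ∀ k r, IsMaximalIncrease s k r → b ∣ r

/-- The vertex `k` is distinguished: it is followed by an up-step, and the number of up-steps
before it is a multiple of `b`. -/
def IsDistinguishedVertex (b : ℕ) (s : List DyckStep) (k : ℕ) : Prop :=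
  b ∣ (s.take k).count DyckStep.U ∧ s[k]? = some DyckStep.U

/-- The vertex `k` is an endpoint of a down-step. -/
def IsDownStepVertex (s : List DyckStep) (k : ℕ) : Prop :=
  s[k]? = some DyckStep.D ∨ ∃ t, t + 1 = k ∧ s[t]? = some DyckStep.D

/-- A lattice path together with `ℓ` labelled pairs of vertices and `d` labelled vertices
(all vertices are given by their `x`-coordinates). -/
@[ext]
structure MarkedPath (ℓ d : ℕ) where
  /-- The steps of the path. -/
  steps : List DyckStep
  /-- The pair labelled `i`. -/
  pair : Fin ℓ → ℕ × ℕ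
  /-- The distinguished vertex labelled `j`. -/
  dist : Fin d → ℕ

namespace MarkedPath

variable {ℓ d : ℕ}

/-- The step number `k` lies in the interval `[v, w]` of the pair labelled `i`. -/
def InInterval (P : MarkedPath ℓ d) (i : Fin ℓ) (k : ℕ) : Prop :=
  (P.pair i).1 ≤ k ∧ k < (P.pair i).2

/-- The step number `k` lies in the essential interval of the pair labelled `i`: it lies in its
interval, but in no interval of another marked pair contained in it. -/
def InEssential (P : MarkedPath ℓ d) (i : Fin ℓ) (k : ℕ) : Prop :=
  P.InInterval i k ∧ ∀ i', i' ≠ i → (P.pair i).1 ≤ (P.pair i').1 →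
    (P.pair i').2 ≤ (P.pair i).2 → ¬ P.InInterval i' k

/-- Single Hurwitz Dyck paths of type `μ`, where `μ` is a partition of `d` with `ℓ` ordered parts;
here `b = ℓ + d - 2`. -/
structure IsSingleHurwitz (μ : Fin ℓ → ℕ) (P : MarkedPath ℓ d) : Prop where
  /-- The path is a `b`-Dyck path … -/
  bDyck : IsBDyckPath (ℓ + d - 2) P.steps
  /-- … of length `2bd` … -/
  length_eq : P.steps.length = 2 * (ℓ + d - 2) * d
  /-- … and primitive. -/
  primitive : IsPrimitivePath P.steps
  /-- The labels `j` enumerate the distinguished vertices. -/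
  dist_injective : Function.Injective P.dist
  dist_range : Set.range P.dist = {k | IsDistinguishedVertex (ℓ + d - 2) P.steps k}
  /-- The marked pairs are pairs of vertices of the path, of equal height. -/
  pair_le : ∀ i, (P.pair i).1 ≤ (P.pair i).2
  pair_le_length : ∀ i, (P.pair i).2 ≤ P.steps.length
  pair_height : ∀ i, pathHeight P.steps (P.pair i).1 = pathHeight P.steps (P.pair i).2
  /-- Apart from the pair formed by the two ends of the path, marked pairs consist of vertices of
  down-steps. -/
  pair_down : ∀ i, P.pair i ≠ (0, 2 * (ℓ + d - 2) * d) →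
    IsDownStepVertex P.steps (P.pair i).1 ∧ IsDownStepVertex P.steps (P.pair i).2
  /-- The two ends of the path form a marked pair. -/
  ends_marked : ∃ i, P.pair i = (0, 2 * (ℓ + d - 2) * d)
  /-- The heights of the marked pairs are distinct modulo `b + 1`. -/
  pair_residues : (Set.range fun i =>
    (pathHeight P.steps (P.pair i).1 : ZMod (ℓ + d - 2 + 1))).ncard = ℓ
  /-- The heights of the distinguished vertices are distinct modulo `b + 1`. -/
  dist_residues : (Set.range fun j =>
    (pathHeight P.steps (P.dist j) : ZMod (ℓ + d - 2 + 1))).ncard = d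
  /-- Nonzero heights of marked pairs and of distinguished vertices differ modulo `b + 1`. -/
  residues_disjoint : ∀ i j, pathHeight P.steps (P.pair i).1 ≠ 0 →
    pathHeight P.steps (P.dist j) ≠ 0 →
    (pathHeight P.steps (P.pair i).1 : ZMod (ℓ + d - 2 + 1)) ≠ pathHeight P.steps (P.dist j)
  /-- The intervals of two marked pairs do not cross. -/
  noncrossing : ∀ i i', (P.pair i).1 ≤ (P.pair i').1 → (P.pair i').1 ≤ (P.pair i).2 →
    (P.pair i').2 ≤ (P.pair i).2
  /-- The marked pair labelled `i` has degree `μ i`. -/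
  degree_up : ∀ i, {k | P.InEssential i k ∧ P.steps[k]? = some DyckStep.U}.ncard
    = (ℓ + d - 2) * μ i
  degree_down : ∀ i, {k | P.InEssential i k ∧ P.steps[k]? = some DyckStep.D}.ncard
    = (ℓ + d - 2) * μ i

end MarkedPath

/-- The set `D(μ)` of single Hurwitz Dyck paths of type `μ`. -/
def SingleHurwitzDyckPath {ℓ : ℕ} (d : ℕ) (μ : Fin ℓ → ℕ) : Type :=
  {P : MarkedPath ℓ d // P.IsSingleHurwitz μ}

/-! ### Graphs on surfaces with one boundary, and cacti -/

/-- Names of the regions of a surface with one boundary: the boundary (thought of as closed up by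
a disc), the white faces and the black faces. -/
inductive FaceName (m n : ℕ) : Type
  | boundary : FaceName m n
  | white (i : Fin m) : FaceName m n
  | black (j : Fin n) : FaceName m n

/-- The data of a coloured combinatorial map. A dart is an edge with a direction of travel.
`opp` reverses the direction; `face x` is the region to the right of `x`, and `next x` is the
dart that follows `x` when one travels along the boundary of that region, keeping it to the
right; `colour x` is the colour of the vertex at which `x` starts. -/
structure ColouredMap (m n b : ℕ) where
  Dart : Type
  opp : Dart → Dart
  next : Dart → Dart
  face : Dart → FaceName m n
  colour : Dart → ZMod (b + 1)

namespace ColouredMap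

variable {m n b : ℕ}

/-- The dart that follows `x` in counterclockwise order around the vertex at which `x` starts. -/
def rot (C : ColouredMap m n b) (x : C.Dart) : C.Dart := C.next (C.opp x)

/-- Vertices are the cycles of `rot`. -/
def Vertex (C : ColouredMap m n b) : Type := Quot fun x y : C.Dart => C.rot x = y

/-- Edges are the cycles of `opp`. -/
def Edge (C : ColouredMap m n b) : Type := Quot fun x y : C.Dart => C.opp x = y

/-- Regions are the cycles of `next`. -/
def Region (C : ColouredMap m n b) : Type := Quot fun x y : C.Dart => C.next x = y

/-- The vertex at which a dart starts. -/
def vertex (C : ColouredMap m n b) (x : C.Dart) : C.Vertex := Quot.mk _ x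

/-- The region to the right of a dart, as a cycle of `next`. -/
def region (C : ColouredMap m n b) (x : C.Dart) : C.Region := Quot.mk _ x

/-- `x` runs along the boundary, with the boundary to its right (so along the whole boundary
component in counterclockwise direction, with the surface to the left), on a black boundary edge;
this is the orientation of black boundary edges. -/
def IsBlackBoundary (C : ColouredMap m n b) (x : C.Dart) : Prop :=
  C.face x = FaceName.boundary ∧ ∃ j, C.face (C.opp x) = FaceName.black j

/-- `x` runs along the boundary, with the boundary to its right, on a white boundary edge; this is
opposite to the orientation of white boundary edges. -/
def IsWhiteBoundary (C : ColouredMap m n b) (x : C.Dart) : Prop :=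
  C.face x = FaceName.boundary ∧ ∃ i, C.face (C.opp x) = FaceName.white i

/-- `x` runs along an internal edge, with a white face to the right and a black face to the
left. -/
def IsInternal (C : ColouredMap m n b) (x : C.Dart) : Prop :=
  (∃ i, C.face x = FaceName.white i) ∧ ∃ j, C.face (C.opp x) = FaceName.black j

/-- `x` runs along the orientation of its edge: white faces are to the right of their edges and
black faces to the left. -/
def IsForward (C : ColouredMap m n b) (x : C.Dart) : Prop :=
  (∃ i, C.face x = FaceName.white i) ∨ C.IsBlackBoundary x

/-- `C` is a graph, with simply connected faces, on a connected oriented surface of genus `g` with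
one boundary, and its faces are labelled bijectively by the white and black labels. -/
structure IsSurfaceGraph (g : ℕ) (C : ColouredMap m n b) : Prop where
  finite : Finite C.Dart
  opp_opp : ∀ x, C.opp (C.opp x) = x
  opp_ne : ∀ x, C.opp x ≠ x
  next_bijective : Function.Bijective C.next
  connected : ∀ x y, Relation.EqvGen (fun u v => C.opp u = v ∨ C.next u = v) x y
  face_eq_iff : ∀ x y, C.face x = C.face y ↔ C.region x = C.region y
  face_surjective : Function.Surjective C.face
  euler : (Nat.card C.Vertex : ℤ) - Nat.card C.Edge + Nat.card C.Region = 2 - 2 * g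

/-- `C` satisfies the face colour condition, the condition on the types of edges, the vertex colour
condition and the Hurwitz condition of a cactus of type `(g, μ, ν)`, where `μ` and `ν` are
partitions of `d`. A face of degree `k` is a polygon with `(b + 1) * k` edges. -/
structure IsCactus (g d : ℕ) (μ : Fin m → ℕ) (ν : Fin n → ℕ) (C : ColouredMap m n b) : Prop where
  surface : C.IsSurfaceGraph g
  white_degree : ∀ i, Nat.card {x // C.face x = FaceName.white i} = (b + 1) * μ i
  black_degree : ∀ j, Nat.card {x // C.face x = FaceName.black j} = (b + 1) * ν j
  edge_types : ∀ x, ∃ y, (y = x ∨ y = C.opp x) ∧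
    (C.IsInternal y ∨ C.IsWhiteBoundary y ∨ C.IsBlackBoundary y)
  colour_vertex : ∀ x, C.colour (C.rot x) = C.colour x
  colour_succ : ∀ x, C.IsForward x → C.colour (C.opp x) = C.colour x + 1
  vertex_boundary : ∀ x, ∃ y, C.vertex y = C.vertex x ∧ C.face y = FaceName.boundary
  /-- There are `d - 1` active vertices of each colour; a vertex is active if it is the head of a
  white boundary edge. -/
  hurwitz : ∀ c : ZMod (b + 1),
    {v : C.Vertex | ∃ x, C.vertex x = v ∧ C.IsWhiteBoundary x ∧ C.colour x = c}.ncard = d - 1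

/-- `δ` is a canonical corner labelling. The boundary corners correspond to the darts `x` that
have the boundary to the right: such a dart stands for the boundary corner at its start. (The
values of `δ` at other darts play no role.) -/
structure IsCanonicalLabelling (C : ColouredMap m n b) (δ : C.Dart → ℕ) : Prop where
  exists_zero : ∃ x, C.face x = FaceName.boundary ∧ δ x = 0
  black_step : ∀ x, C.IsBlackBoundary x → δ (C.next x) = δ x + 1
  white_step : ∀ x, C.IsWhiteBoundary x → δ x = δ (C.next x) + 1

/-- All boundary corners of a vertex have the same label. -/
def IsCoherent (C : ColouredMap m n b) (δ : C.Dart → ℕ) : Prop :=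
  ∀ x y, C.face x = FaceName.boundary → C.face y = FaceName.boundary →
    C.vertex x = C.vertex y → δ x = δ y

/-- Vertices with label `0` have colour `0`. -/
def IsProper (C : ColouredMap m n b) (δ : C.Dart → ℕ) : Prop :=
  ∀ x, C.face x = FaceName.boundary → δ x = 0 → C.colour x = 0

/-- Every internal edge `u → v` is non-geodesic, i.e. its weight `(δ u + 1 - δ v) / (b + 1)` is
positive. -/
def IsPositive (C : ColouredMap m n b) (δ : C.Dart → ℕ) : Prop :=
  ∀ e, C.IsInternal e → ∀ x y, C.face x = FaceName.boundary → C.face y = FaceName.boundary →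
    C.vertex x = C.vertex e → C.vertex y = C.vertex (C.opp e) →
      0 < ((δ x : ℚ) + 1 - δ y) / (b + 1)

/-- `C` is a (proper) cactus of type `(g, μ, ν)`. -/
def IsProperCactus (g d : ℕ) (μ : Fin m → ℕ) (ν : Fin n → ℕ) (C : ColouredMap m n b) : Prop :=
  C.IsCactus g d μ ν ∧
    ∃ δ, C.IsCanonicalLabelling δ ∧ C.IsCoherent δ ∧ C.IsProper δ ∧ C.IsPositive δ

/-- Isomorphism of coloured maps: orientation-preserving, and respecting labels and colours. -/
def Iso (C C' : ColouredMap m n b) : Prop :=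
  ∃ e : C.Dart ≃ C'.Dart, ∀ x, e (C.opp x) = C'.opp (e x) ∧ e (C.next x) = C'.next (e x) ∧
    C'.face (e x) = C.face x ∧ C'.colour (e x) = C.colour x

theorem Iso.refl (C : ColouredMap m n b) : C.Iso C :=
  ⟨Equiv.refl _, fun _ => ⟨rfl, rfl, rfl, rfl⟩⟩

theorem Iso.symm {C C' : ColouredMap m n b} : C.Iso C' → C'.Iso C := by
  rintro ⟨e, he⟩
  refine ⟨e.symm, fun x => ?_⟩
  obtain ⟨h1, h2, h3, h4⟩ := he (e.symm x)
  rw [e.apply_symm_apply] at h1 h2 h3 h4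
  exact ⟨by rw [← h1, e.symm_apply_apply], by rw [← h2, e.symm_apply_apply], h3.symm, h4.symm⟩

theorem Iso.trans {C C' C'' : ColouredMap m n b} : C.Iso C' → C'.Iso C'' → C.Iso C'' := by
  rintro ⟨e, he⟩ ⟨f, hf⟩
  refine ⟨e.trans f, fun x => ?_⟩
  obtain ⟨h1, h2, h3, h4⟩ := he x
  obtain ⟨k1, k2, k3, k4⟩ := hf (e x)
  exact ⟨by simp [h1, k1], by simp [h2, k2], by simp [h3, k3], by simp [h4, k4]⟩

end ColouredMap

/-- Cacti of type `(0, μ, 1^d)`; here `b = ℓ + d - 2`. -/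
def GenusZeroCactus {ℓ : ℕ} (d : ℕ) (μ : Fin ℓ → ℕ) : Type 1 :=
  {C : ColouredMap ℓ d (ℓ + d - 2) // C.IsProperCactus 0 d μ fun _ : Fin d => 1}

/-- Isomorphism of cacti. -/
instance genusZeroCactusSetoid {ℓ : ℕ} (d : ℕ) (μ : Fin ℓ → ℕ) :
    Setoid (GenusZeroCactus d μ) where
  r C C' := C.1.Iso C'.1
  iseqv := ⟨fun C => ColouredMap.Iso.refl C.1, ColouredMap.Iso.symm, ColouredMap.Iso.trans⟩

/-- The set `C_0(μ, 1^d)` of isomorphism classes of cacti of type `(0, μ, 1^d)`. -/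
def CactusClass {ℓ : ℕ} (d : ℕ) (μ : Fin ℓ → ℕ) : Type 1 :=
  Quotient (genusZeroCactusSetoid d μ)

/-! ### The lattice path of a cactus -/

namespace ColouredMap

variable {m n b : ℕ}

/-- The number of boundary edges. -/
noncomputable def boundaryLength (C : ColouredMap m n b) : ℕ :=
  Nat.card {x // C.face x = FaceName.boundary}

/-- `x` starts at the marked vertex and has the boundary to the right: it stands for a boundary
corner with canonical label `0`. -/
def IsMarked (C : ColouredMap m n b) (x : C.Dart) : Prop :=
  C.face x = FaceName.boundary ∧ ∃ δ, C.IsCanonicalLabelling δ ∧ δ x = 0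

/-- The dart along which one leaves after `t` steps of the counterclockwise walk along the
boundary that begins with `x`. -/
def walk (C : ColouredMap m n b) (x : C.Dart) (t : ℕ) : C.Dart := C.next^[t] x

/-- The vertex is incident to two white faces. -/
def HasTwoWhiteFaces (C : ColouredMap m n b) (v : C.Vertex) : Prop :=
  ∃ y z i i', C.vertex y = v ∧ C.vertex z = v ∧ i ≠ i' ∧
    C.face y = FaceName.white i ∧ C.face z = FaceName.white i'

/-- The walk from `x` is at the same vertex, incident to two white faces, at the times
`p.1 < p.2`, and it leaves along the white face labelled `i` at the time `p.1`. -/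
def IsMarkedPairAt (C : ColouredMap m n b) (x : C.Dart) (i : Fin m) (p : ℕ × ℕ) : Prop :=
  p.1 < p.2 ∧ p.2 < C.boundaryLength ∧
    C.vertex (C.walk x p.1) = C.vertex (C.walk x p.2) ∧
    C.HasTwoWhiteFaces (C.vertex (C.walk x p.1)) ∧
    C.face (C.opp (C.walk x p.1)) = FaceName.white i

open Classical in
/-- The marked lattice path of the counterclockwise walk along the boundary that begins with `x`:
an up-step for each black and a down-step for each white boundary edge. The pair labelled `i` is
formed by the two visits of the vertex at which the walk enters the white face labelled `i` from
another white face, or by the two ends of the path if the walk begins at the white face labelled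
`i`. The distinguished vertex labelled `j` is the one at which the walk enters the black face
labelled `j`. -/
noncomputable def boundaryPath (C : ColouredMap m n b) (x : C.Dart) : MarkedPath m n where
  steps := (List.range C.boundaryLength).map fun t =>
    if C.IsBlackBoundary (C.walk x t) then DyckStep.U else DyckStep.D
  pair i := if h : ∃ p, C.IsMarkedPairAt x i p then h.choose else (0, C.boundaryLength)
  dist j := sInf {t | C.face (C.opp (C.walk x t)) = FaceName.black j}

open Classical in
/-- The lattice path `D(C)`: the walk begins at the marked vertex. (A cactus has a marked vertex;
otherwise the value is irrelevant.) -/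
noncomputable def latticePath (C : ColouredMap m n b) : MarkedPath m n :=
  if h : ∃ x, C.IsMarked x then C.boundaryPath h.choose else ⟨[], fun _ => (0, 0), fun _ => 0⟩

end ColouredMap

/-! ### The gluing construction -/

/-- The darts of the map glued from polygons along a path with `N` steps: for each step `t` a
boundary edge with its side `outer t` on the boundary and its side `inner t` on a polygon, and for
each distinguished vertex `j` an internal edge, with its side `onBlack j` on the black polygon
labelled `j` and its side `onWhite j` on a white polygon. -/
inductive GlueDart (N d : ℕ) : Type
  | outer (t : Fin N) : GlueDart N d
  | inner (t : Fin N) : GlueDart N d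
  | onBlack (j : Fin d) : GlueDart N d
  | onWhite (j : Fin d) : GlueDart N d

namespace MarkedPath

variable {ℓ d : ℕ}

/-- The first vertex of the block of `b` up-steps that contains the up-step number `k`. -/
def blockStart (P : MarkedPath ℓ d) (b k : ℕ) : ℕ :=
  k - (P.steps.take k).count DyckStep.U % b

/-- At time `k`, one edge of a white polygon is traversed (against its orientation): either `k` is
a down-step, which follows a boundary edge of the polygon, or `k` is a distinguished vertex, at
which a black polygon is glued to the edge. -/
def IsWhiteTime (P : MarkedPath ℓ d) (k : ℕ) : Prop :=
  P.steps[k]? = some DyckStep.D ∨ k ∈ Set.range P.dist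

/-- The times at which the edges of the white polygon met at time `k` are traversed. -/
def whiteTimes (P : MarkedPath ℓ d) (k : ℕ) : Set ℕ :=
  {t | P.IsWhiteTime t ∧ ∃ i, P.InEssential i t ∧ P.InEssential i k}

open Classical in
/-- The cyclic predecessor of `k` among the times of the white polygon met at time `k`. -/
noncomputable def prevWhiteTime (P : MarkedPath ℓ d) (k : ℕ) : ℕ :=
  if ∃ t ∈ P.whiteTimes k, t < k then sSup {t ∈ P.whiteTimes k | t < k} else sSup (P.whiteTimes k)

open Classical in
/-- The side of the edge of a white polygon that is traversed at time `k` (or `x`, if there is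
none). -/
noncomputable def whiteSide (P : MarkedPath ℓ d) (x : GlueDart P.steps.length d) (k : ℕ) :
    GlueDart P.steps.length d :=
  if h : ∃ j, P.dist j = k then GlueDart.onWhite h.choose
  else if h : k < P.steps.length then GlueDart.inner ⟨k, h⟩ else x

open Classical in
/-- The name of the white polygon met at time `k`: the label of the innermost marked pair. -/
noncomputable def whiteName (P : MarkedPath ℓ d) (k : ℕ) : FaceName ℓ d :=
  if h : ∃ i, P.InEssential i k then FaceName.white h.choose else FaceName.boundary

open Classical in
/-- The name of the black polygon that is glued at the distinguished vertex `k`. -/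
noncomputable def blackName (P : MarkedPath ℓ d) (k : ℕ) : FaceName ℓ d :=
  if h : ∃ j, P.dist j = k then FaceName.black h.choose else FaceName.boundary

/-- The other side of an edge. -/
def glueOpp (P : MarkedPath ℓ d) : GlueDart P.steps.length d → GlueDart P.steps.length d
  | GlueDart.outer t => GlueDart.inner t
  | GlueDart.inner t => GlueDart.outer t
  | GlueDart.onBlack j => GlueDart.onWhite j
  | GlueDart.onWhite j => GlueDart.onBlack j

open Classical in
/-- The next side, clockwise along each polygon, and counterclockwise along the boundary. In
counterclockwise direction, the black polygon labelled `j` consists of its internal edge and the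
`b` up-steps that follow its distinguished vertex, and the white polygon labelled `i` consists of
the edges traversed in the essential interval of the marked pair labelled `i`. -/
noncomputable def glueNext (P : MarkedPath ℓ d) (b : ℕ) :
    GlueDart P.steps.length d → GlueDart P.steps.length d
  | GlueDart.outer t => GlueDart.outer ⟨((t : ℕ) + 1) % P.steps.length, Nat.mod_lt _ t.pos⟩
  | GlueDart.inner t =>
    if P.steps[t] = DyckStep.U then
      if h : ∃ j, P.dist j = t then GlueDart.onBlack h.choose
      else GlueDart.inner ⟨(t : ℕ) - 1, lt_of_le_of_lt (Nat.sub_le _ _) t.isLt⟩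
    else P.whiteSide (GlueDart.inner t) (P.prevWhiteTime t)
  | GlueDart.onBlack j =>
    if h : P.dist j + b - 1 < P.steps.length then GlueDart.inner ⟨P.dist j + b - 1, h⟩
    else GlueDart.onBlack j
  | GlueDart.onWhite j => P.whiteSide (GlueDart.onWhite j) (P.prevWhiteTime (P.dist j))

/-- The polygon to which a side belongs. -/
noncomputable def glueFace (P : MarkedPath ℓ d) (b : ℕ) :
    GlueDart P.steps.length d → FaceName ℓ d
  | GlueDart.outer _ => FaceName.boundary
  | GlueDart.inner t =>
    if P.steps[t] = DyckStep.U then P.blackName (P.blockStart b t) else P.whiteName t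
  | GlueDart.onBlack j => FaceName.black j
  | GlueDart.onWhite j => P.whiteName (P.dist j)

/-- The colour of the vertex at which a side starts: its height modulo `b + 1`. -/
def glueColour (P : MarkedPath ℓ d) (b : ℕ) : GlueDart P.steps.length d → ZMod (b + 1)
  | GlueDart.outer t => pathHeight P.steps t
  | GlueDart.inner t => pathHeight P.steps ((t : ℕ) + 1)
  | GlueDart.onBlack j => pathHeight P.steps (P.dist j)
  | GlueDart.onWhite j => pathHeight P.steps (P.dist j) + b

/-- The map glued from `d` black polygons and `ℓ` white polygons along the path `P`. -/
noncomputable def gluing (P : MarkedPath ℓ d) (b : ℕ) : ColouredMap ℓ d b where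
  Dart := GlueDart P.steps.length d
  opp := P.glueOpp
  next := P.glueNext b
  face := P.glueFace b
  colour := P.glueColour b

end MarkedPath

/-! ### Orbits of a permutation of a finite type -/

/-! From a cactus to a path. Give an edge u → v the weight (δ(u) + 1 - δ(v)) / (b + 1). Around a
face the labels telescope, so the weights of the edges of a face of degree k add up to k. Boundary
edges have weight 0. Labels and colours agree modulo b + 1 (`boundary_colour`), so the positive
weights of internal edges are integers. Hence a black face of degree 1 has exactly one internal edge
and b boundary edges (`existsUnique_internal`), a white face of degree k has k internal edges
(`card_internal_white`), and the boundary consists of bd black and bd white edges.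

Euler's formula in genus 0 now gives 2bd + 1 - ℓ vertices. By the Hurwitz condition (b + 1)(d - 1)
of them are active, and each of the others is the start of one of the bd black boundary edges. Since
bd + (b + 1)(d - 1) = 2bd + 1 - ℓ, there is no waste: the start of a black boundary edge has a
single boundary corner (`eq_of_blackBoundary`). So the b boundary edges of a black face are
consecutive and form a block of up-steps. Colour by colour, d edges of white faces end in colour c
but only d - 1 vertices of colour c are active. This one unit of slack (`card_blackSide_colour_le`)
is used either by a distinguished vertex or by a vertex with two boundary corners, never by both.
There are b + 1 = d + (ℓ - 1) colours, so there are ℓ - 1 such double vertices, and the residue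
conditions on the path follow. The white face met by the walk changes only at double vertices
(`exists_partner`). The walk is therefore a tour of a tree of white faces, and the formal properties
of tours (`IsTour`) give noncrossing and identify essential intervals with the times spent at each
face.

From a path to a cactus. The white sides of the glued map are indexed by times, and its vertices are
the times modulo identification of the two ends of each marked pair (`vertex_eq_iff`). There are 2bd
- (ℓ - 1) of them, so the genus is 0. The heights of the ℓ - 1 pairs other than the root and of the
d distinguished vertices hit every residue modulo b + 1 exactly once, which yields the Hurwitz
condition. Heights form the canonical labelling, and the internal edge of a black polygon leads from
the top of its block to the bottom, so it has weight 1.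

The constructions are mutually inverse because the path alone determines which white side comes
next: the same relation `Follows` between times describes `next` in the glued map (`glueNext_side`)
and in the cactus (`next_whiteDart_of_follows`). The path depends only on the isomorphism class,
since label 0 occurs at one corner only (`isMarked_iff`). -/

theorem quot_mk_eq_iff_exists_iterate {α : Type*} [Finite α] {f : α → α}
    (hf : Function.Bijective f) {x y : α} :
    (Quot.mk (fun x y => f x = y) x = Quot.mk (fun x y => f x = y) y) ↔ ∃ n, f^[n] x = y := by
  constructor
  · intro h
    have hs : Equiv.Perm.SameCycle (Equiv.ofBijective f hf) x y := by
      replace h := Quot.eqvGen_exact h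
      induction h with
      | rel u v h => exact ⟨1, by simpa using h⟩
      | refl u => exact Equiv.Perm.SameCycle.refl _ _
      | symm u v _ ih => exact ih.symm
      | trans u v w _ _ ih1 ih2 => exact ih1.trans ih2
    obtain ⟨n, -, hn⟩ := hs.exists_pow_eq'
    exact ⟨n, by simpa [Equiv.Perm.coe_pow] using hn⟩
  · rintro ⟨n, rfl⟩
    induction n with
    | zero => rfl
    | succ n ih => rw [ih, Function.iterate_succ_apply']; exact Quot.sound rfl

/-- A set that is a single orbit of a permutation is traversed cyclically. -/
theorem isCycleOn_of_orbit {α : Type*} {f : α → α} (hf : Function.Bijective f)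
    {S : Set α} (hS : ∀ x ∈ S, ∀ y, y ∈ S ↔ ∃ n, f^[n] x = y) :
    Equiv.Perm.IsCycleOn (Equiv.ofBijective f hf) S := by
  have hmem : ∀ x ∈ S, f x ∈ S := fun x hx => (hS x hx _).2 ⟨1, rfl⟩
  refine ⟨⟨fun x hx => hmem x hx, hf.1.injOn, fun y hy => ?_⟩, fun x hx y hy => ?_⟩
  · obtain ⟨n, hn⟩ := (hS _ (hmem y hy) y).1 hy
    have hn' : f (f^[n] y) = y := by
      rw [← Function.iterate_succ_apply' f, Function.iterate_succ_apply]; exact hn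
    exact ⟨f^[n] y, (hS y hy _).2 ⟨n, rfl⟩, hn'⟩
  · obtain ⟨n, hn⟩ := (hS x hx y).1 hy
    exact ⟨n, by simpa [Equiv.Perm.coe_pow] using hn⟩

theorem orbit_iterate_eq_iff {α : Type*} [Finite α] {f : α → α} (hf : Function.Bijective f)
    {S : Set α} (hS : ∀ x ∈ S, ∀ y, y ∈ S ↔ ∃ n, f^[n] x = y) {x : α} (hx : x ∈ S) (m n : ℕ) :
    f^[m] x = f^[n] x ↔ m ≡ n [MOD Nat.card S] := by
  classical
  have := Fintype.ofFinite α
  have h := isCycleOn_of_orbit hf hS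
  have h' : Equiv.Perm.IsCycleOn (Equiv.ofBijective f hf) (S.toFinset : Set α) := by simpa using h
  have := h'.pow_apply_eq_pow_apply (a := x) (by simpa using hx) (m := m) (n := n)
  rw [Nat.card_eq_card_toFinset]
  simpa [Equiv.Perm.coe_pow] using this

theorem orbit_exists_iterate {α : Type*} [Finite α] {f : α → α} (hf : Function.Bijective f)
    {S : Set α} (hS : ∀ x ∈ S, ∀ y, y ∈ S ↔ ∃ n, f^[n] x = y) {x y : α} (hx : x ∈ S)
    (hy : y ∈ S) : ∃ n < Nat.card S, f^[n] x = y := by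
  classical
  have := Fintype.ofFinite α
  have h := isCycleOn_of_orbit hf hS
  have h' : Equiv.Perm.IsCycleOn (Equiv.ofBijective f hf) (S.toFinset : Set α) := by simpa using h
  obtain ⟨n, hn, e⟩ := h'.exists_pow_eq (a := x) (b := y) (by simpa using hx) (by simpa using hy)
  exact ⟨n, by rwa [Nat.card_eq_card_toFinset], by simpa [Equiv.Perm.coe_pow] using e⟩

theorem two_mul_card_quot_involution {α : Type*} [Finite α] {f : α → α} (h2 : ∀ x, f (f x) = x)
    (h1 : ∀ x, f x ≠ x) :
    2 * Nat.card (Quot fun x y : α => f x = y) = Nat.card α := by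
  classical
  have := Fintype.ofFinite α
  have hf : Function.Bijective f := Function.Involutive.bijective h2
  have hfin : Finite (Quot fun x y : α => f x = y) := Quot.finite _
  have := Fintype.ofFinite (Quot fun x y : α => f x = y)
  rw [Nat.card_eq_fintype_card, Nat.card_eq_fintype_card, ← Finset.card_univ (α := α),
    Finset.card_eq_sum_card_fiberwise (f := Quot.mk fun x y : α => f x = y) (t := Finset.univ)
      (by simp)]
  rw [Finset.sum_const_nat (m := 2), Finset.card_univ, mul_comm]
  rintro q -
  obtain ⟨x, rfl⟩ := Quot.exists_rep q
  have : (Finset.univ.filter fun a => Quot.mk (fun x y : α => f x = y) a = Quot.mk _ x)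
      = {x, f x} := by
    ext y
    simp only [Finset.mem_filter, Finset.mem_univ, true_and, Finset.mem_insert,
      Finset.mem_singleton]
    constructor
    · intro h
      obtain ⟨n, hn⟩ := (quot_mk_eq_iff_exists_iterate hf).1 h.symm
      have : ∀ n, f^[n] x = x ∨ f^[n] x = f x := by
        intro n
        induction n with
        | zero => exact Or.inl rfl
        | succ n ih =>
          rw [Function.iterate_succ_apply']
          rcases ih with ih | ih <;> rw [ih]
          · exact Or.inr rfl
          · exact Or.inl (h2 x)
      rw [← hn]; exact this n
    · rintro (rfl | rfl)
      · rfl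
      · exact (Quot.sound (r := fun x y : α => f x = y) rfl).symm
  rw [this, Finset.card_pair (h1 x).symm]

/-! ### Maps whose image is almost as large as the domain -/

/-- Erasing one member u of a collision does not change the image, so by the cardinality bound `f`
is injective on what remains; every other collision must therefore involve u. Applied to the white
boundary corners of one colour, this says that at most one vertex is visited twice. -/
theorem Finset.pair_eq_of_card_le_card_image_succ {α β : Type*} [DecidableEq α] [DecidableEq β]
    {s : Finset α} {f : α → β} (h : s.card ≤ (s.image f).card + 1) {a a' c c' : α} (ha : a ∈ s)
    (ha' : a' ∈ s) (hc : c ∈ s) (hc' : c' ∈ s) (haa : a ≠ a') (hcc : c ≠ c') (e : f a = f a')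
    (e' : f c = f c') : (c = a ∧ c' = a') ∨ (c = a' ∧ c' = a) := by
  have key : ∀ {u v : α}, u ∈ s → v ∈ s → u ≠ v → f u = f v → c = u ∨ c' = u := by
    intro u v hu hv huv huv'
    by_contra hcon
    push Not at hcon
    have him : (s.erase u).image f = s.image f := by
      apply subset_antisymm (Finset.image_subset_image (Finset.erase_subset _ _))
      intro y hy
      obtain ⟨z, hz, rfl⟩ := Finset.mem_image.1 hy
      by_cases hzu : z = u
      · subst hzu
        rw [huv']
        exact Finset.mem_image_of_mem _ (Finset.mem_erase.2 ⟨huv.symm, hv⟩)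
      · exact Finset.mem_image_of_mem _ (Finset.mem_erase.2 ⟨hzu, hz⟩)
    have hcard : ((s.erase u).image f).card = (s.erase u).card := by
      apply le_antisymm Finset.card_image_le
      rw [him, Finset.card_erase_of_mem hu]; omega
    have hinj := Finset.card_image_iff.1 hcard
    exact hcc (hinj (by simp [hcon.1, hc]) (by simp [hcon.2, hc']) e')
  rcases key ha ha' haa e with h1 | h1 <;> rcases key ha' ha haa.symm e.symm with h2 | h2
  · exact absurd (h1.symm.trans h2) haa
  · exact Or.inl ⟨h1, h2⟩
  · exact Or.inr ⟨h2, h1⟩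
  · exact absurd (h1.symm.trans h2) haa

namespace FaceName

theorem natCard (m n : ℕ) : Nat.card (FaceName m n) = m + n + 1 := by
  have e : Option (Fin m ⊕ Fin n) ≃ FaceName m n :=
    { toFun := fun o => o.elim .boundary (Sum.elim .white .black)
      invFun := fun F => match F with
        | .boundary => none
        | .white i => some (.inl i)
        | .black j => some (.inr j)
      left_inv := by rintro (_ | _ | _) <;> rfl
      right_inv := by rintro (_ | _ | _) <;> rfl }
  rw [← Nat.card_congr e, Nat.card_eq_fintype_card]
  simp

end FaceName

/-! ### Faces, edges and regions of a surface graph -/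

namespace ColouredMap

variable {m n b : ℕ} {C : ColouredMap m n b}

theorem vertex_rot (x : C.Dart) : C.vertex (C.rot x) = C.vertex x :=
  (Quot.sound (r := fun x y : C.Dart => C.rot x = y) rfl).symm

theorem card_region_of_face (hf : ∀ x y, C.face x = C.face y ↔ C.region x = C.region y)
    (hs : Function.Surjective C.face) : Nat.card C.Region = m + n + 1 := by
  rw [← FaceName.natCard m n]
  refine Nat.card_congr (Equiv.ofBijective
    (Quot.lift C.face fun x y h => (hf x y).2 (Quot.sound h)) ⟨?_, ?_⟩)
  · rintro ⟨x⟩ ⟨y⟩ h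
    exact (hf x y).1 h
  · intro F
    obtain ⟨x, hx⟩ := hs F
    exact ⟨Quot.mk _ x, hx⟩

namespace IsSurfaceGraph

variable {g : ℕ} (hS : C.IsSurfaceGraph g)
include hS

theorem opp_bijective : Function.Bijective C.opp :=
  Function.Involutive.bijective hS.opp_opp

theorem rot_opp (x : C.Dart) : C.rot (C.opp x) = C.next x := by
  rw [rot, hS.opp_opp]

theorem vertex_next (x : C.Dart) : C.vertex (C.next x) = C.vertex (C.opp x) := by
  rw [← hS.rot_opp, vertex_rot]

theorem face_next (x : C.Dart) : C.face (C.next x) = C.face x :=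
  (hS.face_eq_iff _ _).2
    (Quot.sound (r := fun x y : C.Dart => C.next x = y) rfl).symm

theorem face_iterate (x : C.Dart) (t : ℕ) : C.face (C.next^[t] x) = C.face x := by
  induction t with
  | zero => rfl
  | succ t ih => rw [Function.iterate_succ_apply', hS.face_next, ih]

/-- Face names correspond to cycles of `next`, so the sides of a face form a single orbit. All
arguments that walk around a face or along the boundary rest on this. -/
theorem face_orbit (F : FaceName m n) : ∀ x ∈ {x | C.face x = F}, ∀ y,
    y ∈ {x | C.face x = F} ↔ ∃ k, C.next^[k] x = y := by
  rintro x rfl y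
  have := hS.finite
  rw [← quot_mk_eq_iff_exists_iterate hS.next_bijective]
  exact eq_comm.trans (hS.face_eq_iff x y)

theorem iterate_eq_iff {x : C.Dart} {F : FaceName m n} (hx : C.face x = F) (k l : ℕ) :
    C.next^[k] x = C.next^[l] x ↔ k ≡ l [MOD Nat.card {y // C.face y = F}] :=
  haveI := hS.finite
  orbit_iterate_eq_iff hS.next_bijective (hS.face_orbit F) hx k l

theorem exists_iterate {x y : C.Dart} {F : FaceName m n} (hx : C.face x = F)
    (hy : C.face y = F) : ∃ k < Nat.card {y // C.face y = F}, C.next^[k] x = y :=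
  haveI := hS.finite
  orbit_exists_iterate hS.next_bijective (hS.face_orbit F) hx hy

theorem two_mul_card_edge : 2 * Nat.card C.Edge = Nat.card C.Dart :=
  haveI := hS.finite
  two_mul_card_quot_involution hS.opp_opp hS.opp_ne

theorem card_region : Nat.card C.Region = m + n + 1 :=
  card_region_of_face hS.face_eq_iff hS.face_surjective

end IsSurfaceGraph

end ColouredMap

theorem natCard_exists_eq {α β ι : Type*} [Finite α] [Fintype ι] {f : α → β} {g : ι → β}
    (hg : Function.Injective g) :
    Nat.card {x // ∃ i, f x = g i} = ∑ i, Nat.card {x // f x = g i} := by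
  have e : {x // ∃ i, f x = g i} ≃ Σ i, {x // f x = g i} :=
    { toFun := fun x => ⟨x.2.choose, x.1, x.2.choose_spec⟩
      invFun := fun x => ⟨x.2.1, x.1, x.2.2⟩
      left_inv := fun x => rfl
      right_inv := by
        rintro ⟨i, x, hx⟩
        have hex : ∃ i, f x = g i := ⟨i, hx⟩
        have : hex.choose = i := hg (hex.choose_spec.symm.trans hx)
        refine Sigma.ext this ?_
        dsimp only
        congr 1
        · rw [this]
        · exact proof_irrel_heq _ _ }
  rw [Nat.card_congr e, Nat.card_sigma]

/-! ### Colours, labels and weights in a cactus -/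

namespace ColouredMap

section Counting

variable {m n b d : ℕ} {C : ColouredMap m n b} {μ : Fin m → ℕ}

/-- If `next` shifts the colours of the sides of white faces by `1`, then each colour occurs
equally often among them. -/
theorem card_white_colour (hfin : Finite C.Dart) (hn : Function.Bijective C.next)
    (hfn : ∀ x, C.face (C.next x) = C.face x)
    (hc : ∀ x i, C.face x = FaceName.white i → C.colour (C.next x) = C.colour x + 1)
    (hdeg : ∀ i, Nat.card {x // C.face x = FaceName.white i} = (b + 1) * μ i)
    (hsum : ∑ i, μ i = d) (c : ZMod (b + 1)) :
    Nat.card {x // (∃ i, C.face x = FaceName.white i) ∧ C.colour x = c} = d := by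
  classical
  have := Fintype.ofFinite C.Dart
  have hstep : ∀ c : ZMod (b + 1),
      Nat.card {x // (∃ i, C.face x = FaceName.white i) ∧ C.colour x = c} =
      Nat.card {x // (∃ i, C.face x = FaceName.white i) ∧ C.colour x = c + 1} := by
    intro c
    refine Nat.card_congr (Equiv.subtypeEquiv (Equiv.ofBijective C.next hn) fun x => ?_)
    simp only [Equiv.ofBijective_apply, hfn]
    refine and_congr_right ?_
    rintro ⟨i, hi⟩
    rw [hc x i hi]
    exact add_left_inj (1 : ZMod (b + 1)) |>.symm
  have hconst : ∀ k : ℕ,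
      Nat.card {x // (∃ i, C.face x = FaceName.white i) ∧ C.colour x = (k : ZMod (b + 1))} =
      Nat.card {x // (∃ i, C.face x = FaceName.white i) ∧ C.colour x = 0} := by
    intro k
    induction k with
    | zero => simp
    | succ k ih => rw [← ih, hstep k]; simp
  have hconst' : ∀ c : ZMod (b + 1),
      Nat.card {x // (∃ i, C.face x = FaceName.white i) ∧ C.colour x = c} =
      Nat.card {x // (∃ i, C.face x = FaceName.white i) ∧ C.colour x = 0} := by
    intro c
    rw [← hconst c.val, ZMod.natCast_zmod_val]
  have htot : Nat.card {x // ∃ i, C.face x = FaceName.white i} = (b + 1) * d := by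
    rw [natCard_exists_eq fun i j h => FaceName.white.inj h]
    simp_rw [hdeg, ← Finset.mul_sum, hsum]
  have htot' : Nat.card {x // ∃ i, C.face x = FaceName.white i} =
      ∑ c : ZMod (b + 1),
        Nat.card {x // (∃ i, C.face x = FaceName.white i) ∧ C.colour x = c} := by
    simp only [Nat.card_eq_fintype_card, Fintype.card_subtype]
    rw [Finset.card_eq_sum_card_fiberwise (f := C.colour) (t := Finset.univ) (by simp)]
    simp only [Finset.filter_filter]
  rw [htot'] at htot
  simp_rw [hconst'] at htot
  rw [Finset.sum_const, Finset.card_univ, ZMod.card, smul_eq_mul] at htot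
  rw [hconst' c]
  exact Nat.eq_of_mul_eq_mul_left (Nat.succ_pos b) htot

end Counting

/-- A cactus of type `(0, μ, 1^d)` with a coherent canonical labelling. -/
structure IsLabelledCactus {ℓ d b : ℕ} (μ : Fin ℓ → ℕ) (C : ColouredMap ℓ d b)
    (δ : C.Dart → ℕ) : Prop where
  cactus : C.IsCactus 0 d μ fun _ : Fin d => 1
  canonical : C.IsCanonicalLabelling δ
  coherent : C.IsCoherent δ
  proper : C.IsProper δ
  positive : C.IsPositive δ
  b_add_two : b + 2 = ℓ + d
  two_le : 2 ≤ d
  pos : ∀ i, 0 < μ i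
  sum_eq : ∑ i, μ i = d

open Classical in
/-- The label of the vertex at which a dart starts. -/
noncomputable def vertexLabel {m n b : ℕ} (C : ColouredMap m n b) (δ : C.Dart → ℕ)
    (x : C.Dart) : ℤ :=
  if h : ∃ y, C.vertex y = C.vertex x ∧ C.face y = FaceName.boundary then δ h.choose else 0

namespace IsLabelledCactus

variable {ℓ d b : ℕ} {μ : Fin ℓ → ℕ} {C : ColouredMap ℓ d b} {δ : C.Dart → ℕ}
  (h : C.IsLabelledCactus μ δ)
include h

theorem b_pos : 0 < b := by
  have h1 := h.b_add_two
  have h2 := h.two_le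
  have h3 : ℓ ≠ 0 := by
    rintro rfl
    have := h.sum_eq
    simp at this
    omega
  omega

theorem opp_opp (x : C.Dart) : C.opp (C.opp x) = x := h.cactus.surface.opp_opp x

theorem face_next (x : C.Dart) : C.face (C.next x) = C.face x := h.cactus.surface.face_next x

theorem black_cases {x : C.Dart} {j : Fin d} (hx : C.face x = FaceName.black j) :
    C.face (C.opp x) = FaceName.boundary ∨ ∃ i, C.face (C.opp x) = FaceName.white i := by
  obtain ⟨y, rfl | rfl, hy⟩ := h.cactus.edge_types x
  · rcases hy with ⟨⟨i, hi⟩, -⟩ | ⟨hi, -⟩ | ⟨hi, -⟩ <;> rw [hx] at hi <;> cases hi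
  · rcases hy with ⟨hi, -⟩ | ⟨hi, -⟩ | ⟨hi, -⟩
    exacts [Or.inr hi, Or.inl hi, Or.inl hi]

theorem white_cases {x : C.Dart} {i : Fin ℓ} (hx : C.face x = FaceName.white i) :
    C.face (C.opp x) = FaceName.boundary ∨ ∃ j, C.face (C.opp x) = FaceName.black j := by
  obtain ⟨y, rfl | rfl, hy⟩ := h.cactus.edge_types x
  · rcases hy with ⟨-, hi⟩ | ⟨hi, -⟩ | ⟨hi, -⟩
    · exact Or.inr hi
    all_goals rw [hx] at hi; cases hi
  · rcases hy with ⟨-, hi⟩ | ⟨hi, -⟩ | ⟨hi, -⟩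
    · obtain ⟨j, hj⟩ := hi
      rw [h.opp_opp, hx] at hj; cases hj
    all_goals exact Or.inl hi

theorem boundary_cases {x : C.Dart} (hx : C.face x = FaceName.boundary) :
    C.IsBlackBoundary x ∨ C.IsWhiteBoundary x := by
  obtain ⟨y, rfl | rfl, hy⟩ := h.cactus.edge_types x
  · rcases hy with ⟨⟨i, hi⟩, -⟩ | hi | hi
    · rw [hx] at hi; cases hi
    exacts [Or.inr hi, Or.inl hi]
  · rcases hy with ⟨-, j, hi⟩ | ⟨-, j, hi⟩ | ⟨-, j, hi⟩ <;>
      rw [h.opp_opp, hx] at hi <;> cases hi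

omit h in
theorem not_white_of_black {x : C.Dart} (hx : C.IsBlackBoundary x) : ¬ C.IsWhiteBoundary x := by
  rintro ⟨-, i, hi⟩
  obtain ⟨-, j, hj⟩ := hx
  rw [hj] at hi; cases hi

theorem colour_congr {x y : C.Dart} (e : C.vertex x = C.vertex y) : C.colour x = C.colour y :=
  congrArg (Quot.lift C.colour fun x y (e : C.rot x = y) => by
    rw [← e, h.cactus.colour_vertex]) e

theorem colour_next {x : C.Dart} : C.colour (C.next x) = C.colour (C.opp x) :=
  h.colour_congr (h.cactus.surface.vertex_next x)

theorem label_eq {x y : C.Dart} (e : C.vertex x = C.vertex y)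
    (hy : C.face y = FaceName.boundary) : C.vertexLabel δ x = δ y := by
  have hex : ∃ y, C.vertex y = C.vertex x ∧ C.face y = FaceName.boundary := ⟨y, e.symm, hy⟩
  rw [vertexLabel, dif_pos hex]
  exact congrArg _ (h.coherent _ _ hex.choose_spec.2 hy (hex.choose_spec.1.trans e))

theorem label_congr {x y : C.Dart} (e : C.vertex x = C.vertex y) :
    C.vertexLabel δ x = C.vertexLabel δ y := by
  obtain ⟨z, ez, hz⟩ := h.cactus.vertex_boundary y
  rw [h.label_eq ez.symm hz, h.label_eq (e.trans ez.symm) hz]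

theorem label_next (x : C.Dart) : C.vertexLabel δ (C.next x) = C.vertexLabel δ (C.opp x) :=
  h.label_congr (h.cactus.surface.vertex_next x)

theorem label_blackBoundary {x : C.Dart} (hx : C.IsBlackBoundary x) :
    C.vertexLabel δ (C.opp x) = C.vertexLabel δ x + 1 := by
  rw [h.label_eq rfl hx.1, ← h.label_next, h.label_eq rfl ((h.face_next x).trans hx.1),
    h.canonical.black_step x hx]
  push_cast; rfl

theorem label_whiteBoundary {x : C.Dart} (hx : C.IsWhiteBoundary x) :
    C.vertexLabel δ x = C.vertexLabel δ (C.opp x) + 1 := by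
  rw [h.label_eq rfl hx.1, ← h.label_next, h.label_eq rfl ((h.face_next x).trans hx.1),
    h.canonical.white_step x hx]
  push_cast; rfl

theorem colour_opp_of_white {x : C.Dart} {i : Fin ℓ} (hx : C.face x = FaceName.white i) :
    C.colour (C.opp x) = C.colour x + 1 :=
  h.cactus.colour_succ x (Or.inl ⟨i, hx⟩)

/-- At a corner of label 0 both sides vanish by properness, and along each boundary edge label and
colour change by the same sign ±1. -/
theorem boundary_colour {x : C.Dart} (hx : C.face x = FaceName.boundary) :
    C.colour x = (δ x : ZMod (b + 1)) := by
  obtain ⟨x0, hx0, h0⟩ := h.canonical.exists_zero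
  obtain ⟨k, -, rfl⟩ := h.cactus.surface.exists_iterate hx0 hx
  clear hx
  induction k with
  | zero => simp [h.proper x0 hx0 h0, h0]
  | succ k ih =>
    rw [Function.iterate_succ_apply', h.colour_next]
    set y := C.next^[k] x0
    have hy : C.face y = FaceName.boundary := (h.cactus.surface.face_iterate _ _).trans hx0
    rcases h.boundary_cases hy with hb | hw
    · rw [h.canonical.black_step y hb, h.cactus.colour_succ y (Or.inr hb), ih]
      push_cast; rfl
    · obtain ⟨-, i, hi⟩ := id hw
      have := h.colour_opp_of_white hi
      rw [h.opp_opp, ih, h.canonical.white_step y hw] at this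
      push_cast at this
      exact (add_right_cancel this).symm

theorem label_colour (x : C.Dart) : (C.vertexLabel δ x : ZMod (b + 1)) = C.colour x := by
  obtain ⟨y, e, hy⟩ := h.cactus.vertex_boundary x
  rw [h.label_eq e.symm hy, ← h.colour_congr e, h.boundary_colour hy]
  simp

/-- The labels reduce to the colours, which increase by 1 along the edge; so the numerator of the
weight is divisible by b + 1. Being positive, it is at least b + 1. -/
theorem weight_internal {x : C.Dart} (hx : C.IsInternal x) :
    (b + 1 : ℤ) ≤ C.vertexLabel δ x + 1 - C.vertexLabel δ (C.opp x) := by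
  obtain ⟨y, ey, hy⟩ := h.cactus.vertex_boundary x
  obtain ⟨z, ez, hz⟩ := h.cactus.vertex_boundary (C.opp x)
  have hpos := h.positive x hx y z hy hz ey ez
  have hdvd : ((b + 1 : ℕ) : ℤ) ∣ C.vertexLabel δ x + 1 - C.vertexLabel δ (C.opp x) := by
    rw [← ZMod.intCast_zmod_eq_zero_iff_dvd]
    obtain ⟨⟨i, hi⟩, -⟩ := hx
    push_cast
    rw [h.label_colour, h.label_colour, h.colour_opp_of_white hi, sub_self]
  rw [h.label_eq ey.symm hy, h.label_eq ez.symm hz] at hdvd ⊢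
  have hp : (0 : ℚ) < (δ y : ℚ) + 1 - δ z := by
    by_contra hcon
    have : ((δ y : ℚ) + 1 - δ z) / (b + 1) ≤ 0 :=
      div_nonpos_of_nonpos_of_nonneg (not_lt.1 hcon) (by positivity)
    linarith
  have hp' : (0 : ℤ) < (δ y : ℤ) + 1 - δ z := by exact_mod_cast hp
  have := Int.le_of_dvd hp' hdvd
  push_cast at this
  exact this

/-- Each side ends where the next one starts, and `next` permutes the sides. Consequently the labels
cancel when weights are summed around a face, and only the number of sides remains. -/
theorem sum_label [Fintype C.Dart] [DecidableEq (FaceName ℓ d)] (F : FaceName ℓ d) :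
    ∑ x with C.face x = F, C.vertexLabel δ (C.opp x) =
      ∑ x with C.face x = F, C.vertexLabel δ x := by
  refine Finset.sum_equiv (Equiv.ofBijective C.next h.cactus.surface.next_bijective) ?_ ?_
  · intro x; simp [h.face_next]
  · intro x _; simp [h.label_next]

/-- A black face has exactly one internal edge, and its weight is `1`. -/
theorem existsUnique_internal (j : Fin d) :
    ∃ x, (C.face x = FaceName.black j ∧ C.IsInternal (C.opp x) ∧
      C.vertexLabel δ (C.opp x) = C.vertexLabel δ x + b) ∧
      ∀ y, C.face y = FaceName.black j → y ≠ x → C.face (C.opp y) = FaceName.boundary := by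
  classical
  have := h.cactus.surface.finite
  have := Fintype.ofFinite C.Dart
  set s : Finset C.Dart := {x | C.face x = FaceName.black j} with hs
  set w : C.Dart → ℤ := fun x => C.vertexLabel δ (C.opp x) + 1 - C.vertexLabel δ x with hw
  -- Sides of a black face run against the orientation of their edges, so `w x` is the numerator of
  -- the weight of the edge of `x`.
  have hsum : ∑ x ∈ s, w x = b + 1 := by
    have hcard : s.card = b + 1 := by
      have := h.cactus.black_degree j
      rw [Nat.card_eq_fintype_card, Fintype.card_subtype] at this
      simpa [hs] using this
    rw [hw, Finset.sum_sub_distrib, Finset.sum_add_distrib, h.sum_label, Finset.sum_const, hcard, ← hs]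
    simp
  have hbd : ∀ x ∈ s, C.face (C.opp x) = FaceName.boundary → w x = 0 := by
    intro x hx hb
    have := h.label_blackBoundary (x := C.opp x)
      ⟨hb, j, by rw [h.opp_opp]; simpa [hs] using hx⟩
    rw [h.opp_opp] at this
    simp [hw, this]
  have hint : ∀ x ∈ s, C.face (C.opp x) ≠ FaceName.boundary →
      C.IsInternal (C.opp x) ∧ (b + 1 : ℤ) ≤ w x := by
    intro x hx hb
    have hxj : C.face x = FaceName.black j := by simpa [hs] using hx
    have hi : C.IsInternal (C.opp x) :=
      ⟨(h.black_cases hxj).resolve_left hb, j, by rw [h.opp_opp, hxj]⟩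
    have := h.weight_internal hi
    rw [h.opp_opp] at this
    exact ⟨hi, this⟩
  have hnn : ∀ x ∈ s, 0 ≤ w x := by
    intro x hx
    by_cases hb : C.face (C.opp x) = FaceName.boundary
    · rw [hbd x hx hb]
    · have := (hint x hx hb).2; omega
  -- Some side is internal, since otherwise the sum would vanish; it contributes at least b + 1 and
  -- so exhausts the total.
  obtain ⟨x, hx, hxb⟩ : ∃ x ∈ s, C.face (C.opp x) ≠ FaceName.boundary := by
    by_contra hcon
    push Not at hcon
    rw [Finset.sum_eq_zero fun x hx => hbd x hx (hcon x hx)] at hsum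
    omega
  have hrest := Finset.add_sum_erase s w hx
  have hle := (hint x hx hxb).2
  refine ⟨x, ⟨by simpa [hs] using hx, (hint x hx hxb).1, ?_⟩, fun y hy hyx => ?_⟩
  · have := Finset.sum_nonneg (s := s.erase x) fun y hy => hnn y (Finset.mem_of_mem_erase hy)
    have : w x = b + 1 := by omega
    simp only [hw] at this; omega
  · by_contra hcon
    have hys : y ∈ s := by simpa [hs] using hy
    have := Finset.single_le_sum (s := s.erase x)
      (fun y hy => hnn y (Finset.mem_of_mem_erase hy)) (Finset.mem_erase.2 ⟨hyx, hys⟩)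
    have := (hint y hys hcon).2
    omega

/-- A white face of degree `k` has `k` internal edges. -/
theorem card_internal_white (i : Fin ℓ) :
    Nat.card {x // C.face x = FaceName.white i ∧ ∃ j, C.face (C.opp x) = FaceName.black j} =
      μ i := by
  classical
  have := h.cactus.surface.finite
  have := Fintype.ofFinite C.Dart
  set s : Finset C.Dart := {x | C.face x = FaceName.white i} with hs
  set w : C.Dart → ℤ := fun x => C.vertexLabel δ x + 1 - C.vertexLabel δ (C.opp x) with hw
  have hsum : ∑ x ∈ s, w x = ((b + 1 : ℕ) : ℤ) * μ i := by
    have hcard : s.card = (b + 1) * μ i := by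
      have := h.cactus.white_degree i
      rw [Nat.card_eq_fintype_card, Fintype.card_subtype] at this
      simpa [hs] using this
    rw [hw, Finset.sum_sub_distrib, Finset.sum_add_distrib, h.sum_label, Finset.sum_const, hcard, ← hs]
    simp
  -- An internal edge of the white face is the unique internal edge of its black face, and that one
  -- has weight exactly 1. So the sum counts internal edges, each with the factor b + 1.
  have hval : ∀ x ∈ s, w x =
      if ∃ j, C.face (C.opp x) = FaceName.black j then ((b + 1 : ℕ) : ℤ) else 0 := by
    intro x hx
    have hxi : C.face x = FaceName.white i := by simpa [hs] using hx
    split_ifs with hj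
    · obtain ⟨j, hj⟩ := hj
      obtain ⟨y, ⟨-, -, hy⟩, hun⟩ := h.existsUnique_internal j
      have : C.opp x = y := by
        by_contra hcon
        have := hun _ hj hcon
        rw [h.opp_opp, hxi] at this; cases this
      rw [← this, h.opp_opp] at hy
      simp only [hw]; push_cast; omega
    · have hb := (h.white_cases hxi).resolve_right hj
      have := h.label_whiteBoundary (x := C.opp x) ⟨hb, i, by rw [h.opp_opp, hxi]⟩
      rw [h.opp_opp] at this
      simp [hw, this]
  rw [Finset.sum_congr rfl hval, ← Finset.sum_filter, Finset.sum_const, hs, Finset.filter_filter,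
    nsmul_eq_mul, mul_comm] at hsum
  rw [Nat.card_eq_fintype_card, Fintype.card_subtype]
  have h0 : ((b + 1 : ℕ) : ℤ) ≠ 0 := by positivity
  exact_mod_cast mul_left_cancel₀ h0 hsum

end IsLabelledCactus

end ColouredMap

/-! ### Counting edges, vertices and corners of a cactus -/

namespace ColouredMap

namespace IsLabelledCactus

variable {ℓ d b : ℕ} {μ : Fin ℓ → ℕ} {C : ColouredMap ℓ d b} {δ : C.Dart → ℕ}

/-- The side of the internal edge of the black face `j` that lies on this face. -/
noncomputable def blackSide (h : C.IsLabelledCactus μ δ) (j : Fin d) : C.Dart :=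
  (h.existsUnique_internal j).choose

variable (h : C.IsLabelledCactus μ δ)
include h

theorem face_blackSide (j : Fin d) : C.face (h.blackSide j) = FaceName.black j :=
  (h.existsUnique_internal j).choose_spec.1.1

theorem internal_opp_blackSide (j : Fin d) : C.IsInternal (C.opp (h.blackSide j)) :=
  (h.existsUnique_internal j).choose_spec.1.2.1

theorem face_opp_of_ne_blackSide {j : Fin d} {y : C.Dart} (hy : C.face y = FaceName.black j)
    (hne : y ≠ h.blackSide j) : C.face (C.opp y) = FaceName.boundary :=
  (h.existsUnique_internal j).choose_spec.2 y hy hne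

theorem eq_blackSide {j : Fin d} {y : C.Dart} (hy : C.face y = FaceName.black j)
    (hne : C.face (C.opp y) ≠ FaceName.boundary) : y = h.blackSide j := by
  by_contra hcon
  exact hne (h.face_opp_of_ne_blackSide hy hcon)

theorem blackSide_injective : Function.Injective h.blackSide := fun i j e => by
  have := h.face_blackSide i
  rw [e, h.face_blackSide] at this
  exact (FaceName.black.inj this).symm

/-- The d white sides that leave colour c - 1 are the edges of white faces that end in colour c.
Such an edge is either a white boundary edge or the internal edge of a black face, and its opposite
side starts at its head. -/
theorem card_whiteBoundary_colour (c : ZMod (b + 1)) :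
    Nat.card {x // C.IsWhiteBoundary x ∧ C.colour x = c} +
      Nat.card {j // C.colour (h.blackSide j) = c} = d := by
  have := h.cactus.surface.finite
  have hopp := h.opp_opp
  refine Eq.trans ?_ (card_white_colour h.cactus.surface.finite h.cactus.surface.next_bijective h.face_next
    (fun x i hx => by rw [h.colour_next, h.colour_opp_of_white hx]) h.cactus.white_degree
    h.sum_eq (c - 1))
  rw [← Nat.card_sum]
  refine Nat.card_congr (Equiv.ofBijective (Sum.elim
    (fun x => ⟨C.opp x.1, x.2.1.2, ?_⟩)
    (fun j => ⟨C.opp (h.blackSide j.1), (h.internal_opp_blackSide j.1).1, ?_⟩)) ⟨?_, ?_⟩)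
  · obtain ⟨x, ⟨-, i, hi⟩, rfl⟩ := x
    have := h.colour_opp_of_white hi
    rw [hopp] at this
    simp only [this]; ring
  · obtain ⟨j, rfl⟩ := j
    obtain ⟨i, hi⟩ := (h.internal_opp_blackSide j).1
    have := h.colour_opp_of_white hi
    rw [hopp] at this
    simp only [this]; ring
  · rintro (⟨x, hx, hx'⟩ | ⟨j, hj⟩) (⟨y, hy, hy'⟩ | ⟨k, hk⟩) e <;>
      simp only [Sum.elim_inl, Sum.elim_inr, Subtype.mk.injEq] at e <;>
      have e := h.cactus.surface.opp_bijective.1 e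
    · subst e; rfl
    · have := hx.1; rw [e, h.face_blackSide] at this; cases this
    · have := hy.1; rw [← e, h.face_blackSide] at this; cases this
    · have e := h.blackSide_injective e; subst e; rfl
  · rintro ⟨y, ⟨i, hi⟩, hy⟩
    have hc : C.colour (C.opp y) = c := by rw [h.colour_opp_of_white hi, hy]; ring
    rcases h.white_cases hi with hb | ⟨j, hj⟩
    · exact ⟨Sum.inl ⟨C.opp y, ⟨hb, i, by rw [hopp, hi]⟩, hc⟩, by simp [hopp]⟩
    · have e : C.opp y = h.blackSide j := h.eq_blackSide hj (by rw [hopp, hi]; simp)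
      exact ⟨Sum.inr ⟨j, by rw [← e, hc]⟩, by simp [← e, hopp]⟩

theorem card_blackBoundary : Nat.card {x // C.IsBlackBoundary x} = b * d := by
  have := h.cactus.surface.finite
  have hopp := h.opp_opp
  have h1 : Nat.card {x // ∃ j, C.face x = FaceName.black j} = d * (b + 1) := by
    rw [natCard_exists_eq fun i j e => FaceName.black.inj e]
    simp [h.cactus.black_degree]
  have h2 : Nat.card {x // ∃ j, C.face x = FaceName.black j} =
      Nat.card {x // C.IsBlackBoundary x} + d := by
    have h3 : Nat.card (Fin d) = d := by simp
    refine Eq.trans ?_ (congrArg (Nat.card {x // C.IsBlackBoundary x} + ·) h3)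
    rw [← Nat.card_sum]
    symm
    refine Nat.card_congr (Equiv.ofBijective (Sum.elim
      (fun x => ⟨C.opp x.1, x.2.2⟩) (fun j => ⟨h.blackSide j, j, h.face_blackSide j⟩)) ⟨?_, ?_⟩)
    · rintro (⟨x, hx⟩ | j) (⟨y, hy⟩ | k) e <;>
        simp only [Sum.elim_inl, Sum.elim_inr, Subtype.mk.injEq] at e
      · have e := h.cactus.surface.opp_bijective.1 e
        subst e; rfl
      · obtain ⟨i, hi⟩ := (h.internal_opp_blackSide k).1
        have := hx.1; rw [← hopp x, e, hi] at this; cases this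
      · obtain ⟨i, hi⟩ := (h.internal_opp_blackSide j).1
        have := hy.1; rw [← hopp y, ← e, hi] at this; cases this
      · rw [h.blackSide_injective e]
    · rintro ⟨y, j, hj⟩
      by_cases hb : C.face (C.opp y) = FaceName.boundary
      · exact ⟨Sum.inl ⟨C.opp y, hb, j, by rw [hopp, hj]⟩, by simp [hopp]⟩
      · have e := h.eq_blackSide hj hb
        exact ⟨Sum.inr j, by simp [← e]⟩
  rw [h1] at h2
  linarith

theorem card_whiteBoundary : Nat.card {x // C.IsWhiteBoundary x} = b * d := by
  classical
  have := h.cactus.surface.finite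
  have := Fintype.ofFinite C.Dart
  have h1 := Finset.sum_congr (rfl : (Finset.univ : Finset (ZMod (b + 1))) = Finset.univ)
    fun c _ => h.card_whiteBoundary_colour c
  rw [Finset.sum_add_distrib, Finset.sum_const, Finset.card_univ, ZMod.card] at h1
  have h2 : Nat.card {x // C.IsWhiteBoundary x} =
      ∑ c : ZMod (b + 1), Nat.card {x // C.IsWhiteBoundary x ∧ C.colour x = c} := by
    simp only [Nat.card_eq_fintype_card, Fintype.card_subtype]
    rw [Finset.card_eq_sum_card_fiberwise (f := C.colour) (t := Finset.univ) (by simp)]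
    simp only [Finset.filter_filter]
  have h3 : d = ∑ c : ZMod (b + 1), Nat.card {j // C.colour (h.blackSide j) = c} := by
    simp only [Nat.card_eq_fintype_card, Fintype.card_subtype]
    rw [← Finset.card_eq_sum_card_fiberwise (f := fun j => C.colour (h.blackSide j))
      (t := Finset.univ) (by simp), Finset.card_univ, Fintype.card_fin]
  rw [← h2, ← h3, smul_eq_mul] at h1
  linarith

theorem boundaryLength_eq : C.boundaryLength = 2 * b * d := by
  classical
  have := h.cactus.surface.finite
  have := Fintype.ofFinite C.Dart
  have h1 := h.card_blackBoundary
  have h2 := h.card_whiteBoundary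
  rw [boundaryLength]
  simp only [Nat.card_eq_fintype_card, Fintype.card_subtype] at h1 h2 ⊢
  have : (Finset.univ.filter fun x => C.face x = FaceName.boundary) =
      (Finset.univ.filter C.IsBlackBoundary) ∪ (Finset.univ.filter C.IsWhiteBoundary) := by
    ext x
    simp only [Finset.mem_filter, Finset.mem_univ, true_and, Finset.mem_union]
    exact ⟨h.boundary_cases, fun hx => hx.elim (·.1) (·.1)⟩
  rw [this, Finset.card_union_of_disjoint, h1, h2]
  · ring
  · rw [Finset.disjoint_filter]
    exact fun x _ hx => not_white_of_black hx

theorem card_dart : Nat.card C.Dart = 4 * b * d + 2 * d := by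
  classical
  have := h.cactus.surface.finite
  have h1 : Nat.card {x // ∃ j, C.face x = FaceName.black j} = d * (b + 1) := by
    rw [natCard_exists_eq fun i j e => FaceName.black.inj e]
    simp [h.cactus.black_degree]
  have h2 : Nat.card {x // ∃ j, C.face x = FaceName.white j} = (b + 1) * d := by
    rw [natCard_exists_eq fun i j e => FaceName.white.inj e]
    simp [h.cactus.white_degree, ← Finset.mul_sum, h.sum_eq]
  have h3 := h.boundaryLength_eq
  have := Fintype.ofFinite C.Dart
  rw [boundaryLength] at h3
  simp only [Nat.card_eq_fintype_card, Fintype.card_subtype] at h1 h2 h3 ⊢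
  have : (Finset.univ : Finset C.Dart) =
      (Finset.univ.filter fun x => C.face x = FaceName.boundary) ∪
      ((Finset.univ.filter fun x => ∃ j, C.face x = FaceName.black j) ∪
      (Finset.univ.filter fun x => ∃ j, C.face x = FaceName.white j)) := by
    ext x
    simp only [Finset.mem_filter, Finset.mem_univ, true_and, Finset.mem_union, true_iff]
    cases C.face x <;> simp
  rw [← Finset.card_univ, this, Finset.card_union_of_disjoint, Finset.card_union_of_disjoint, h1,
    h2, h3]
  · ring
  · rw [Finset.disjoint_filter]
    rintro x - ⟨j, hj⟩ ⟨i, hi⟩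
    rw [hj] at hi; cases hi
  · rw [Finset.disjoint_left]
    intro x hx hx'
    simp only [Finset.mem_filter, Finset.mem_univ, true_and, Finset.mem_union] at hx hx'
    rw [hx] at hx'
    simp at hx'

/-- Euler's formula for the sphere, with 2bd + d edges and ℓ + d + 1 regions. -/
theorem card_vertex : Nat.card C.Vertex + ℓ = 2 * b * d + 1 := by
  have h1 := h.cactus.surface.euler
  have h2 := h.cactus.surface.two_mul_card_edge
  rw [h.card_dart] at h2
  rw [h.cactus.surface.card_region] at h1
  have h3 : Nat.card C.Edge = 2 * b * d + d := by linarith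
  rw [h3] at h1
  push_cast at h1
  zify
  linarith

/-- The vertex at which a black boundary edge starts has only one boundary corner. -/
theorem eq_of_blackBoundary {x y : C.Dart} (hx : C.IsBlackBoundary x)
    (hy : C.face y = FaceName.boundary) (e : C.vertex x = C.vertex y) : x = y := by
  classical
  have := h.cactus.surface.finite
  have := Fintype.ofFinite C.Dart
  have : Finite C.Vertex := Quot.finite _
  have := Fintype.ofFinite C.Vertex
  have hU := h.card_blackBoundary
  have hV := h.card_vertex
  rw [Nat.card_eq_fintype_card, Fintype.card_subtype] at hU
  rw [Nat.card_eq_fintype_card, ← Finset.card_univ] at hV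
  set U : Finset C.Dart := Finset.univ.filter C.IsBlackBoundary with hUdef
  set A : Finset C.Vertex :=
    Finset.univ.filter fun v => ∃ x, C.vertex x = v ∧ C.IsWhiteBoundary x with hA
  -- Sum of the Hurwitz condition over all colours; a vertex has only one colour, so the sets are
  -- disjoint.
  have hAcard : A.card = (b + 1) * (d - 1) := by
    have hA' : A = Finset.univ.biUnion fun c : ZMod (b + 1) => Finset.univ.filter fun v =>
        ∃ x, C.vertex x = v ∧ C.IsWhiteBoundary x ∧ C.colour x = c := by
      ext v
      simp only [hA, Finset.mem_filter, Finset.mem_univ, true_and, Finset.mem_biUnion]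
      exact ⟨fun ⟨x, h1, h2⟩ => ⟨_, x, h1, h2, rfl⟩, fun ⟨c, x, h1, h2, _⟩ => ⟨x, h1, h2⟩⟩
    rw [hA', Finset.card_biUnion]
    · rw [Finset.sum_const_nat (m := d - 1), Finset.card_univ, ZMod.card]
      intro c _
      rw [← h.cactus.hurwitz c, Set.ncard_eq_toFinset_card']
      congr 1
      ext v; simp
    · intro c _ c' _ hcc
      rw [Function.onFun, Finset.disjoint_filter]
      rintro v - ⟨x, hx, -, rfl⟩ ⟨y, hy, -, rfl⟩
      exact hcc (h.colour_congr (hx.trans hy.symm))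
  set U' := U.filter fun x => C.vertex x ∉ A with hU'
  -- Every vertex has a boundary corner; if no white boundary edge ends there, a black one starts
  -- there.
  have hcov : (Finset.univ : Finset C.Vertex) ⊆ U'.image C.vertex ∪ A := by
    intro v _
    obtain ⟨x, rfl⟩ := Quot.exists_rep v
    obtain ⟨y, e, hy⟩ := h.cactus.vertex_boundary x
    change C.vertex x ∈ _
    rw [← e, Finset.mem_union]
    by_cases hyA : C.vertex y ∈ A
    · exact Or.inr hyA
    · left
      refine Finset.mem_image_of_mem _ ?_
      simp only [hU', hUdef, Finset.mem_filter, Finset.mem_univ, true_and]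
      refine ⟨(h.boundary_cases hy).resolve_right fun hw => hyA ?_, hyA⟩
      simp only [hA, Finset.mem_filter, Finset.mem_univ, true_and]
      exact ⟨y, rfl, hw⟩
  have h1 := (Finset.card_le_card hcov).trans (Finset.card_union_le _ _)
  have h2 : (U'.image C.vertex).card ≤ U'.card := Finset.card_image_le
  have h3 : U'.card ≤ U.card := Finset.card_filter_le _ _
  -- The covering bound is tight: 2bd + 1 - ℓ = bd + (b + 1)(d - 1) because b + 2 = ℓ + d. So the bd
  -- black boundary edges start at distinct vertices, none of which is active.
  have h4 : U.card ≤ (U'.image C.vertex).card := by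
    have hb := h.b_add_two
    have hd := h.two_le
    obtain ⟨d, rfl⟩ : ∃ k, d = k + 1 := ⟨d - 1, by omega⟩
    rw [hAcard, Nat.add_sub_cancel] at h1
    rw [hU]
    nlinarith
  have hUU : U' = U := Finset.eq_of_subset_of_card_le (Finset.filter_subset _ _) (h4.trans h2)
  have hinj : Set.InjOn C.vertex U := by
    rw [← Finset.card_image_iff]
    rw [hUU] at h4
    exact le_antisymm Finset.card_image_le h4
  have hxU : x ∈ U := by simpa [hUdef] using hx
  refine hinj hxU ?_ e
  have hxA : x ∈ U' := hUU ▸ hxU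
  simp only [hUdef, Finset.coe_filter, Finset.mem_univ, true_and, Set.mem_ofPred_eq]
  refine (h.boundary_cases hy).resolve_right fun hw => ?_
  refine (Finset.mem_filter.1 hxA).2 ?_
  simp only [hA, Finset.mem_filter, Finset.mem_univ, true_and]
  exact ⟨y, e.symm, hw⟩

/-- Active vertices of colour c are the images of the white boundary corners of that colour, so
there are at most as many of them as of these corners. The totals d and d - 1 leave a slack of
exactly 1, to be used by a black side or by a coincidence of two corners. -/
theorem card_blackSide_colour_le (c : ZMod (b + 1)) :
    Nat.card {j // C.colour (h.blackSide j) = c} ≤ 1 ∧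
    Nat.card {x // C.IsWhiteBoundary x ∧ C.colour x = c} +
      Nat.card {j // C.colour (h.blackSide j) = c} =
    {v : C.Vertex | ∃ x, C.vertex x = v ∧ C.IsWhiteBoundary x ∧ C.colour x = c}.ncard + 1 := by
  have := h.cactus.surface.finite
  have h1 := h.card_whiteBoundary_colour c
  have h2 := h.cactus.hurwitz c
  have hd := h.two_le
  have h3 : {v : C.Vertex | ∃ x, C.vertex x = v ∧ C.IsWhiteBoundary x ∧ C.colour x = c}.ncard ≤
      Nat.card {x // C.IsWhiteBoundary x ∧ C.colour x = c} := by
    have : {v : C.Vertex | ∃ x, C.vertex x = v ∧ C.IsWhiteBoundary x ∧ C.colour x = c} =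
        C.vertex '' {x | C.IsWhiteBoundary x ∧ C.colour x = c} := by
      ext v
      exact ⟨fun ⟨x, h1, h2⟩ => ⟨x, h2, h1⟩, fun ⟨x, h1, h2⟩ => ⟨x, h2, h1⟩⟩
    rw [this]
    exact Set.ncard_image_le (Set.toFinite _)
  omega

theorem colour_blackSide_injective : Function.Injective fun j => C.colour (h.blackSide j) := by
  intro i j e
  have := (h.card_blackSide_colour_le (C.colour (h.blackSide j))).1
  rw [Finite.card_le_one_iff_subsingleton] at this
  exact congrArg Subtype.val (this.elim ⟨i, e⟩ ⟨j, rfl⟩)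

/-- In each colour, there is at most one vertex with two boundary corners. -/
theorem pair_eq_of_vertex_eq {x x' y y' : C.Dart} (hx : C.IsWhiteBoundary x)
    (hx' : C.IsWhiteBoundary x') (hy : C.IsWhiteBoundary y) (hy' : C.IsWhiteBoundary y')
    (hxx : x ≠ x') (hyy : y ≠ y') (ex : C.vertex x = C.vertex x') (ey : C.vertex y = C.vertex y')
    (hc : C.colour y = C.colour x) : (y = x ∧ y' = x') ∨ (y = x' ∧ y' = x) := by
  classical
  have := h.cactus.surface.finite
  have := Fintype.ofFinite C.Dart
  have h1 := (h.card_blackSide_colour_le (C.colour x)).2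
  refine Finset.pair_eq_of_card_le_card_image_succ (f := C.vertex)
    (s := Finset.univ.filter fun z => C.IsWhiteBoundary z ∧ C.colour z = C.colour x) ?_
    (by simp [hx]) (by simp [hx', h.colour_congr ex]) (by simp [hy, hc])
    (by simp [hy', ← h.colour_congr ey, hc]) hxx hyy ex ey
  rw [Nat.card_eq_fintype_card, Fintype.card_subtype] at h1
  have h2 : {v : C.Vertex | ∃ z, C.vertex z = v ∧ C.IsWhiteBoundary z ∧ C.colour z = C.colour x} =
      ((Finset.univ.filter fun z => C.IsWhiteBoundary z ∧ C.colour z = C.colour x).image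
        C.vertex : Finset C.Vertex) := by
    ext v
    simp only [Set.mem_ofPred_eq, Finset.coe_image, Finset.coe_filter, Finset.mem_univ, true_and,
      Set.mem_image]
    exact ⟨fun ⟨x, h1, h2⟩ => ⟨x, h2, h1⟩, fun ⟨x, h1, h2⟩ => ⟨x, h2, h1⟩⟩
  rw [h2, Set.ncard_coe_finset] at h1
  omega

/-- A black side of this colour would use up the slack, and the white boundary corners of the colour
would then lie at distinct vertices. -/
theorem colour_blackSide_ne {x x' : C.Dart} (hx : C.IsWhiteBoundary x)
    (hx' : C.IsWhiteBoundary x') (hxx : x ≠ x') (ex : C.vertex x = C.vertex x') (j : Fin d) :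
    C.colour (h.blackSide j) ≠ C.colour x := by
  classical
  intro hj
  have := h.cactus.surface.finite
  have := Fintype.ofFinite C.Dart
  have h1 := (h.card_blackSide_colour_le (C.colour x)).2
  have h0 : 0 < Nat.card {j // C.colour (h.blackSide j) = C.colour x} :=
    Nat.card_pos_iff.2 ⟨⟨⟨j, hj⟩⟩, inferInstance⟩
  rw [Nat.card_eq_fintype_card, Fintype.card_subtype] at h1
  have h2 : {v : C.Vertex | ∃ z, C.vertex z = v ∧ C.IsWhiteBoundary z ∧ C.colour z = C.colour x} =
      ((Finset.univ.filter fun z => C.IsWhiteBoundary z ∧ C.colour z = C.colour x).image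
        C.vertex : Finset C.Vertex) := by
    ext v
    simp only [Set.mem_ofPred_eq, Finset.coe_image, Finset.coe_filter, Finset.mem_univ, true_and,
      Set.mem_image]
    exact ⟨fun ⟨x, h1, h2⟩ => ⟨x, h2, h1⟩, fun ⟨x, h1, h2⟩ => ⟨x, h2, h1⟩⟩
  rw [h2, Set.ncard_coe_finset] at h1
  have h3 : (Finset.univ.filter fun z => C.IsWhiteBoundary z ∧ C.colour z = C.colour x).card ≤
      ((Finset.univ.filter fun z => C.IsWhiteBoundary z ∧ C.colour z = C.colour x).image
        C.vertex).card := by omega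
  have hinj := Finset.card_image_iff.1 (le_antisymm Finset.card_image_le h3)
  exact hxx (hinj (by simp [hx]) (by simp [hx', h.colour_congr ex]) ex)

end IsLabelledCactus

end ColouredMap

/-! ### Up-steps of lattice paths in blocks of equal length -/

theorem DyckStep.eq_D_iff {a : DyckStep} : a = DyckStep.D ↔ a ≠ DyckStep.U := by
  cases a <;> simp

theorem getElem?_eq_D_iff {s : List DyckStep} {k : ℕ} :
    s[k]? = some DyckStep.D ↔ k < s.length ∧ s[k]? ≠ some DyckStep.U := by
  by_cases hk : k < s.length
  · simp [hk, DyckStep.eq_D_iff]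
  · simp [hk]

theorem count_take_succ_of_up {s : List DyckStep} {k : ℕ} (hk : s[k]? = some DyckStep.U) :
    (s.take (k + 1)).count DyckStep.U = (s.take k).count DyckStep.U + 1 := by
  simp [List.take_add_one, hk]

theorem count_take_succ_of_not_up {s : List DyckStep} {k : ℕ} (hk : s[k]? ≠ some DyckStep.U) :
    (s.take (k + 1)).count DyckStep.U = (s.take k).count DyckStep.U := by
  rw [List.take_add_one, List.count_append]
  cases h : s[k]? with
  | none => simp
  | some a =>
    cases a with
    | U => exact absurd h hk
    | D => simp

theorem count_take_add {s : List DyckStep} {k r : ℕ}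
    (hk : ∀ t, k ≤ t → t < k + r → s[t]? = some DyckStep.U) :
    (s.take (k + r)).count DyckStep.U = (s.take k).count DyckStep.U + r := by
  induction r with
  | zero => rfl
  | succ r ih =>
    rw [← add_assoc, count_take_succ_of_up (hk _ (by omega) (by omega)),
      ih fun t h1 h2 => hk t h1 (by omega)]
    rfl

theorem pathHeight_zero (s : List DyckStep) : pathHeight s 0 = 0 := by
  simp [pathHeight]

theorem pathHeight_succ_of_up {s : List DyckStep} {k : ℕ} (hk : s[k]? = some DyckStep.U) :
    pathHeight s (k + 1) = pathHeight s k + 1 := by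
  simp [pathHeight, List.take_add_one, hk]
  ring

theorem pathHeight_succ_of_down {s : List DyckStep} {k : ℕ} (hk : s[k]? = some DyckStep.D) :
    pathHeight s (k + 1) = pathHeight s k - 1 := by
  simp [pathHeight, List.take_add_one, hk]
  ring

theorem pathHeight_add {s : List DyckStep} {k r : ℕ}
    (hk : ∀ t, k ≤ t → t < k + r → s[t]? = some DyckStep.U) :
    pathHeight s (k + r) = pathHeight s k + r := by
  induction r with
  | zero => simp
  | succ r ih =>
    rw [← add_assoc, pathHeight_succ_of_up (hk _ (by omega) (by omega)),
      ih fun t h1 h2 => hk t h1 (by omega)]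
    push_cast; ring

/-- The up-steps of `s` form disjoint blocks of length `b`, which begin at the times `f j`. -/
structure HasBlocks {d : ℕ} (b : ℕ) (s : List DyckStep) (f : Fin d → ℕ) : Prop where
  up_iff : ∀ t, s[t]? = some DyckStep.U ↔ ∃ j, f j ≤ t ∧ t < f j + b
  disjoint : ∀ i j t, f i ≤ t → t < f i + b → f j ≤ t → t < f j + b → i = j

theorem exists_maximalIncrease {s : List DyckStep} {t : ℕ} (ht : s[t]? = some DyckStep.U) :
    ∃ k r, IsMaximalIncrease s k r ∧ k ≤ t ∧ t < k + r := by
  classical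
  have h1 : ∃ k, ∀ u, k ≤ u → u ≤ t → s[u]? = some DyckStep.U :=
    ⟨t, fun u h1 h2 => by rwa [le_antisymm h2 h1]⟩
  have h2 : ∃ e, t < e ∧ s[e]? ≠ some DyckStep.U := by
    refine ⟨max (t + 1) s.length, by omega, ?_⟩
    rw [List.getElem?_eq_none (le_max_right _ _)]
    simp
  have hk := Nat.find_spec h1
  have hkmin := fun m (hm : m < Nat.find h1) => Nat.find_min h1 hm
  have he := Nat.find_spec h2
  have hemin := fun m (hm : m < Nat.find h2) => Nat.find_min h2 hm
  have hkt : Nat.find h1 ≤ t := Nat.find_min' h1 fun u h1 h2 => by rwa [le_antisymm h2 h1]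
  set k := Nat.find h1
  set e := Nat.find h2
  refine ⟨k, e - k, ⟨by omega, fun u hu1 hu2 => ?_, fun u hu hup => ?_, ?_⟩, hkt, by omega⟩
  · by_cases hut : u ≤ t
    · exact hk u hu1 hut
    · by_contra hcon
      exact hemin u (by omega) ⟨by omega, hcon⟩
  · refine hkmin u (by omega) fun v hv1 hv2 => ?_
    rcases hv1.eq_or_lt with rfl | hv1
    · exact hup
    · exact hk v (by omega) hv2
  · rw [Nat.add_sub_cancel' (by omega)]
    exact he.2

section OfIncrease

variable {b : ℕ} {s : List DyckStep} (hs : ∀ k r, IsMaximalIncrease s k r → b ∣ r)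
include hs

/-- Going back from `t`, one either drops a step that is not an up-step or removes a whole maximal
run, whose length is divisible by `b`. -/
theorem dvd_count_of_not_up (t : ℕ) (ht : s[t]? ≠ some DyckStep.U) :
    b ∣ (s.take t).count DyckStep.U := by
  induction t using Nat.strong_induction_on with
  | _ t ih =>
    cases t with
    | zero => simp
    | succ t =>
      by_cases hup : s[t]? = some DyckStep.U
      · obtain ⟨k, r, hkr, hk, hr⟩ := exists_maximalIncrease hup
        have hkr' : k + r = t + 1 := by
          by_contra hne
          exact ht (hkr.2.1 (t + 1) (by omega) (by omega))
        rw [← hkr', count_take_add hkr.2.1]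
        refine dvd_add ?_ (hs k r hkr)
        cases k with
        | zero => simp
        | succ k =>
          have := hkr.2.2.1 k rfl
          rw [count_take_succ_of_not_up this]
          exact ih k (by omega) this
      · rw [count_take_succ_of_not_up hup]
        exact ih t (by omega) hup

theorem dvd_count_of_maximalIncrease {k r : ℕ} (hkr : IsMaximalIncrease s k r) :
    b ∣ (s.take k).count DyckStep.U := by
  cases k with
  | zero => simp
  | succ k =>
    have := hkr.2.2.1 k rfl
    rw [count_take_succ_of_not_up this]
    exact dvd_count_of_not_up hs k this

/-- The number of up-steps before a maximal run is a multiple of `b`, and so is the length of the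
run. The distinguished vertices inside it are therefore every `b`-th vertex from its start, and they
cut the run into blocks. -/
theorem hasBlocks_of_dvd_maximalIncrease {d : ℕ} {f : Fin d → ℕ} (hb : 0 < b)
    (hf : Function.Injective f) (hr : Set.range f = {k | IsDistinguishedVertex b s k}) :
    HasBlocks b s f := by
  have hd : ∀ k, (∃ j, f j = k) ↔ IsDistinguishedVertex b s k := fun k =>
    (Set.ext_iff.1 hr k)
  have hup : ∀ j t, f j ≤ t → t < f j + b → s[t]? = some DyckStep.U := by
    intro j t h1 h2
    obtain ⟨hj1, hj2⟩ := (hd (f j)).1 ⟨j, rfl⟩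
    obtain ⟨k, r, hkr, hk, hr⟩ := exists_maximalIncrease hj2
    have e := count_take_add (s := s) (k := k) (r := f j - k)
      fun t h1 h2 => hkr.2.1 t h1 (by omega)
    rw [Nat.add_sub_cancel' hk] at e
    have h3 : b ∣ f j - k := (Nat.dvd_add_right (dvd_count_of_maximalIncrease hs hkr)).1 (e ▸ hj1)
    have h4 : b ∣ r - (f j - k) := Nat.dvd_sub (hs k r hkr) h3
    have := Nat.le_of_dvd (by omega) h4
    exact hkr.2.1 t (by omega) (by omega)
  refine ⟨fun t => ⟨fun ht => ?_, fun ⟨j, h1, h2⟩ => hup j t h1 h2⟩, fun i j t h1 h2 h3 h4 => ?_⟩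
  · obtain ⟨k, r, hkr, hk, hr⟩ := exists_maximalIncrease ht
    have h1 := Nat.div_add_mod (t - k) b
    have h2 := Nat.mod_lt (t - k) hb
    have e := count_take_add (s := s) (k := k) (r := b * ((t - k) / b))
      fun t h1 h2 => hkr.2.1 t h1 (by omega)
    obtain ⟨j, hj⟩ := (hd (k + b * ((t - k) / b))).2
      ⟨e ▸ dvd_add (dvd_count_of_maximalIncrease hs hkr) (dvd_mul_right _ _),
        hkr.2.1 _ (by omega) (by omega)⟩
    exact ⟨j, by omega, by omega⟩
  · have key : ∀ i j t, f i ≤ t → t < f i + b → f j ≤ t → t < f j + b → f i ≤ f j → i = j := by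
      intro i j t h1 h2 h3 h4 h5
      have e := count_take_add (s := s) (k := f i) (r := f j - f i)
        fun t h1 h2 => hup i t h1 (by omega)
      rw [Nat.add_sub_cancel' h5] at e
      have h6 : b ∣ f j - f i :=
        (Nat.dvd_add_right ((hd (f i)).1 ⟨i, rfl⟩).1).1 (e ▸ ((hd (f j)).1 ⟨j, rfl⟩).1)
      have := Nat.eq_zero_of_dvd_of_lt h6 (by omega)
      exact hf (by omega)
    rcases le_total (f i) (f j) with hij | hij
    · exact key i j t h1 h2 h3 h4 hij
    · exact (key j i t h3 h4 h1 h2 hij).symm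

end OfIncrease

namespace HasBlocks

variable {d b : ℕ} {s : List DyckStep} {f : Fin d → ℕ} (hs : HasBlocks b s f)
include hs

theorem up {j : Fin d} {t : ℕ} (h1 : f j ≤ t) (h2 : t < f j + b) : s[t]? = some DyckStep.U :=
  (hs.up_iff t).2 ⟨j, h1, h2⟩

theorem lt_length {j : Fin d} {t : ℕ} (h1 : f j ≤ t) (h2 : t < f j + b) : t < s.length :=
  (List.getElem?_eq_some_iff.1 (hs.up h1 h2)).1

theorem injective (hb : 0 < b) : Function.Injective f := fun i j e =>
  hs.disjoint i j (f i) le_rfl (by omega) (by omega) (by omega)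

/-- The two statements need one another: divisibility at the end of a block comes from the count
inside it, and the count inside a block starts from divisibility at its beginning. They identify the
beginnings of blocks with the distinguished vertices and compute `blockStart`. -/
theorem count_mod (hb : 0 < b) (t : ℕ) :
    ((∀ j, f j < t → f j + b ≤ t) → b ∣ (s.take t).count DyckStep.U) ∧
      ∀ j, f j ≤ t → t < f j + b → (s.take t).count DyckStep.U % b = t - f j := by
  induction t with
  | zero => simp
  | succ t ih =>
    have hdvd : (∀ j, f j < t + 1 → f j + b ≤ t + 1) →
        b ∣ (s.take (t + 1)).count DyckStep.U := by
      intro hint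
      by_cases hup : s[t]? = some DyckStep.U
      · obtain ⟨j, h1, h2⟩ := (hs.up_iff t).1 hup
        have h3 := hint j (by omega)
        have h4 := ih.2 j h1 h2
        rw [count_take_succ_of_up hup, Nat.dvd_iff_mod_eq_zero, Nat.add_mod, h4]
        have : t - f j = b - 1 := by omega
        rw [this]
        -- For b = 1 the remainder of 1 modulo b is 0, so this case is separate.
        rcases Nat.lt_or_ge 1 b with hb1 | hb1
        · rw [Nat.mod_eq_of_lt hb1, Nat.sub_add_cancel hb, Nat.mod_self]
        · obtain rfl : b = 1 := by omega
          rfl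
      · rw [count_take_succ_of_not_up hup]
        refine ih.1 fun j hj => ?_
        by_contra hcon
        exact hup (hs.up (j := j) (by omega) (by omega))
    refine ⟨hdvd, fun j h1 h2 => ?_⟩
    rcases h1.eq_or_lt with h1 | h1
    · rw [h1, Nat.sub_self]
      refine Nat.mod_eq_zero_of_dvd (hdvd fun i hi => ?_)
      by_contra hcon
      have := hs.disjoint i j (t + 1) (by omega) (by omega) (by omega) (by omega)
      subst this
      omega
    · have hup := hs.up (j := j) (t := t) (by omega) (by omega)
      rw [count_take_succ_of_up hup, Nat.add_mod, ih.2 j (by omega) (by omega)]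
      rcases Nat.lt_or_ge 1 b with hb1 | hb1
      · rw [Nat.mod_eq_of_lt hb1, Nat.mod_eq_of_lt (by omega)]
        omega
      · omega

theorem isDistinguishedVertex_iff (hb : 0 < b) (k : ℕ) :
    IsDistinguishedVertex b s k ↔ ∃ j, f j = k := by
  constructor
  · rintro ⟨h1, h2⟩
    obtain ⟨j, h3, h4⟩ := (hs.up_iff k).1 h2
    have := (hs.count_mod hb k).2 j h3 h4
    rw [Nat.mod_eq_zero_of_dvd h1] at this
    exact ⟨j, by omega⟩
  · rintro ⟨j, rfl⟩
    have := (hs.count_mod hb (f j)).2 j le_rfl (by omega)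
    exact ⟨Nat.dvd_of_mod_eq_zero (by omega), hs.up le_rfl (by omega)⟩

theorem blockStart_eq (hb : 0 < b) {j : Fin d} {t : ℕ} (h1 : f j ≤ t) (h2 : t < f j + b) :
    t - (s.take t).count DyckStep.U % b = f j := by
  rw [(hs.count_mod hb t).2 j h1 h2]
  omega

theorem dvd_of_maximalIncrease (hb : 0 < b) {k r : ℕ} (hkr : IsMaximalIncrease s k r) :
    b ∣ r := by
  have h1 : b ∣ (s.take k).count DyckStep.U := by
    refine (hs.count_mod hb k).1 fun j hj => ?_
    by_contra hcon
    exact hkr.2.2.1 (k - 1) (by omega) (hs.up (j := j) (by omega) (by omega))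
  have h2 : b ∣ (s.take (k + r)).count DyckStep.U := by
    refine (hs.count_mod hb (k + r)).1 fun j hj => ?_
    by_contra hcon
    exact hkr.2.2.2 (hs.up (j := j) (by omega) (by omega))
  rw [count_take_add hkr.2.1] at h2
  exact (Nat.dvd_add_right h1).1 h2

end HasBlocks

/-! ### The walk along the boundary of a cactus -/

namespace ColouredMap

/-- A cactus of type `(0, μ, 1^d)` with a coherent canonical labelling and a boundary corner of
label `0`. -/
structure IsRootedCactus {ℓ d b : ℕ} (μ : Fin ℓ → ℕ) (C : ColouredMap ℓ d b)
    (δ : C.Dart → ℕ) (x : C.Dart) : Prop extends C.IsLabelledCactus μ δ where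
  root_face : C.face x = FaceName.boundary
  root_label : δ x = 0

namespace IsRootedCactus

variable {ℓ d b : ℕ} {μ : Fin ℓ → ℕ} {C : ColouredMap ℓ d b} {δ : C.Dart → ℕ} {x : C.Dart}
  (h : C.IsRootedCactus μ δ x)

omit h in
theorem walk_succ (x : C.Dart) (t : ℕ) : C.walk x (t + 1) = C.next (C.walk x t) :=
  Function.iterate_succ_apply' _ _ _

include h

theorem length_pos : 0 < 2 * b * d := by
  have := h.b_pos
  have := h.two_le
  positivity

theorem face_walk (t : ℕ) : C.face (C.walk x t) = FaceName.boundary :=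
  (h.cactus.surface.face_iterate x t).trans h.root_face

theorem walk_eq_iff (s t : ℕ) : C.walk x s = C.walk x t ↔ s ≡ t [MOD 2 * b * d] := by
  have := h.cactus.surface.iterate_eq_iff h.root_face s t
  rwa [← h.boundaryLength_eq]

theorem walk_injOn {s t : ℕ} (hs : s < 2 * b * d) (ht : t < 2 * b * d)
    (e : C.walk x s = C.walk x t) : s = t :=
  Nat.ModEq.eq_of_lt_of_lt ((h.walk_eq_iff s t).1 e) hs ht

theorem walk_length : C.walk x (2 * b * d) = x :=
  (h.walk_eq_iff _ 0).2 (by simp [Nat.ModEq])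

theorem exists_walk {y : C.Dart} (hy : C.face y = FaceName.boundary) :
    ∃ t < 2 * b * d, C.walk x t = y := by
  have := h.cactus.surface.exists_iterate h.root_face hy
  rwa [← h.boundaryLength_eq]

theorem label_walk_succ_of_black {t : ℕ} (ht : C.IsBlackBoundary (C.walk x t)) :
    δ (C.walk x (t + 1)) = δ (C.walk x t) + 1 := by
  rw [walk_succ]
  exact h.canonical.black_step _ ht

theorem label_walk_of_white {t : ℕ} (ht : C.IsWhiteBoundary (C.walk x t)) :
    δ (C.walk x t) = δ (C.walk x (t + 1)) + 1 := by
  rw [walk_succ]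
  exact h.canonical.white_step _ ht

theorem iterate_blackSide_ne {j : Fin d} {k : ℕ} (h1 : 0 < k) (h2 : k ≤ b) :
    C.next^[k] (h.blackSide j) ≠ h.blackSide j := by
  intro e
  have := (h.cactus.surface.iterate_eq_iff (h.face_blackSide j) k 0).1 e
  rw [h.cactus.black_degree, mul_one] at this
  have := Nat.ModEq.eq_of_lt_of_lt this (by omega) (by omega)
  omega

theorem iterate_blackSide (j : Fin d) : C.next^[b + 1] (h.blackSide j) = h.blackSide j := by
  refine (h.cactus.surface.iterate_eq_iff (h.face_blackSide j) (b + 1) 0).2 ?_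
  rw [h.cactus.black_degree, mul_one]
  simp [Nat.ModEq]

theorem blackBoundary_iterate {j : Fin d} {k : ℕ} (h1 : 0 < k) (h2 : k ≤ b) :
    C.IsBlackBoundary (C.opp (C.next^[k] (h.blackSide j))) := by
  have hf := (h.cactus.surface.face_iterate (h.blackSide j) k).trans (h.face_blackSide j)
  exact ⟨h.face_opp_of_ne_blackSide hf (h.iterate_blackSide_ne h1 h2), j, by rw [h.opp_opp, hf]⟩

/-- Both sides of the equation have the boundary to the right and start at the same vertex. A black
boundary edge starts there, so the vertex has one boundary corner only. Hence the boundary edges of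
a black face are consecutive, in the order opposite to `next`. -/
theorem next_opp_iterate {j : Fin d} {k : ℕ} (h1 : 0 < k) (h2 : k < b) :
    C.next (C.opp (C.next^[k + 1] (h.blackSide j))) = C.opp (C.next^[k] (h.blackSide j)) := by
  symm
  refine h.eq_of_blackBoundary (h.blackBoundary_iterate h1 h2.le) ?_ ?_
  · rw [h.face_next]
    exact (h.blackBoundary_iterate (by omega) (by omega)).1
  · rw [h.cactus.surface.vertex_next, h.opp_opp, Function.iterate_succ_apply',
      h.cactus.surface.vertex_next]

theorem exists_blockTime (j : Fin d) :
    ∃ t < 2 * b * d, C.walk x t = C.opp (C.next^[b] (h.blackSide j)) :=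
  h.exists_walk (h.blackBoundary_iterate h.b_pos le_rfl).1

omit h in
/-- The time at which the walk along the boundary enters the black face `j`. -/
noncomputable def blockTime (h : C.IsRootedCactus μ δ x) (j : Fin d) : ℕ :=
  (h.exists_blockTime j).choose

theorem blockTime_lt (j : Fin d) : h.blockTime j < 2 * b * d :=
  (h.exists_blockTime j).choose_spec.1

theorem walk_blockTime_add {j : Fin d} {k : ℕ} (hk : k < b) :
    C.walk x (h.blockTime j + k) = C.opp (C.next^[b - k] (h.blackSide j)) := by
  induction k with
  | zero => exact (h.exists_blockTime j).choose_spec.2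
  | succ k ih =>
    rw [← add_assoc, walk_succ, ih (by omega)]
    have e : b - k = (b - (k + 1)) + 1 := by omega
    rw [e]
    exact h.next_opp_iterate (by omega) (by omega)

theorem blackBoundary_walk_blockTime {j : Fin d} {k : ℕ} (hk : k < b) :
    C.IsBlackBoundary (C.walk x (h.blockTime j + k)) := by
  rw [h.walk_blockTime_add hk]
  exact h.blackBoundary_iterate (by omega) (by omega)

/-- A block does not run across the root: an up-step cannot end at label 0. -/
theorem blockTime_add_le (j : Fin d) : h.blockTime j + b ≤ 2 * b * d := by
  by_contra hcon
  have h1 := h.blockTime_lt j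
  obtain ⟨k, hk⟩ : ∃ k, h.blockTime j + (k + 1) = 2 * b * d :=
    ⟨2 * b * d - h.blockTime j - 1, by omega⟩
  have h2 := h.label_walk_succ_of_black
    (h.blackBoundary_walk_blockTime (j := j) (k := k) (by omega))
  rw [add_assoc, hk, h.walk_length, h.root_label] at h2
  omega

theorem face_opp_walk_eq_black_iff {j : Fin d} {t : ℕ} (ht : t < 2 * b * d) :
    C.face (C.opp (C.walk x t)) = FaceName.black j ↔
      h.blockTime j ≤ t ∧ t < h.blockTime j + b := by
  constructor
  · intro hj
    obtain ⟨k, hk, e⟩ := h.cactus.surface.exists_iterate (h.face_blackSide j) hj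
    rw [h.cactus.black_degree, mul_one] at hk
    -- The index 0 belongs to the internal edge, whose other side is white and not on the boundary.
    have hk0 : 0 < k := by
      rw [Nat.pos_iff_ne_zero]
      rintro rfl
      obtain ⟨i, hi⟩ := (h.internal_opp_blackSide j).1
      have e' : h.blackSide j = C.opp (C.walk x t) := e
      rw [e', h.opp_opp, h.face_walk] at hi
      cases hi
    have e2 := h.walk_blockTime_add (j := j) (k := b - k) (by omega)
    rw [Nat.sub_sub_self (by omega), e, h.opp_opp] at e2
    have := h.blockTime_add_le j
    have := h.walk_injOn (by omega) ht e2
    omega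
  · rintro ⟨h1, h2⟩
    obtain ⟨k, rfl⟩ := Nat.exists_eq_add_of_le h1
    rw [h.walk_blockTime_add (by omega), h.opp_opp, h.cactus.surface.face_iterate,
      h.face_blackSide]

theorem blackBoundary_walk_iff {t : ℕ} (ht : t < 2 * b * d) :
    C.IsBlackBoundary (C.walk x t) ↔ ∃ j, h.blockTime j ≤ t ∧ t < h.blockTime j + b := by
  simp only [IsBlackBoundary, h.face_walk, true_and, h.face_opp_walk_eq_black_iff ht]

theorem blockTime_disjoint {i j : Fin d} {t : ℕ} (h1 : h.blockTime i ≤ t)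
    (h2 : t < h.blockTime i + b) (h3 : h.blockTime j ≤ t) (h4 : t < h.blockTime j + b) : i = j := by
  have := h.blockTime_add_le i
  have ht : t < 2 * b * d := by omega
  have e1 := (h.face_opp_walk_eq_black_iff ht).2 ⟨h1, h2⟩
  have e2 := (h.face_opp_walk_eq_black_iff ht).2 ⟨h3, h4⟩
  exact FaceName.black.inj (e1.symm.trans e2)

theorem opp_walk_blockTime_last (j : Fin d) :
    C.next (h.blackSide j) = C.opp (C.walk x (h.blockTime j + b - 1)) := by
  have hb := h.b_pos
  have := h.walk_blockTime_add (j := j) (k := b - 1) (by omega)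
  rw [Nat.add_sub_assoc hb, this, h.opp_opp, Nat.sub_sub_self hb]
  rfl

theorem next_opp_walk_blockTime (j : Fin d) :
    C.next (C.opp (C.walk x (h.blockTime j))) = h.blackSide j := by
  have := h.walk_blockTime_add (j := j) (k := 0) h.b_pos
  rw [add_zero, Nat.sub_zero] at this
  rw [this, h.opp_opp, ← Function.iterate_succ_apply' C.next]
  exact h.iterate_blackSide j

theorem next_opp_walk_blockTime_add {j : Fin d} {k : ℕ} (hk : k + 1 < b) :
    C.next (C.opp (C.walk x (h.blockTime j + (k + 1)))) =
      C.opp (C.walk x (h.blockTime j + k)) := by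
  rw [h.walk_blockTime_add hk, h.walk_blockTime_add (by omega), h.opp_opp, h.opp_opp,
    ← Function.iterate_succ_apply' C.next]
  congr 1
  omega

theorem blackBoundary_root : C.IsBlackBoundary x := by
  refine (h.boundary_cases h.root_face).resolve_right fun hw => ?_
  have := h.canonical.white_step x hw
  rw [h.root_label] at this
  omega

theorem exists_blockTime_eq_zero : ∃ j, h.blockTime j = 0 := by
  obtain ⟨j, h1, -⟩ := (h.blackBoundary_walk_iff h.length_pos).1 h.blackBoundary_root
  exact ⟨j, by omega⟩

/-! #### The steps of the boundary path -/

theorem steps_length : (C.boundaryPath x).steps.length = 2 * b * d := by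
  simp [boundaryPath, h.boundaryLength_eq]

theorem steps_eq_U_iff {t : ℕ} : (C.boundaryPath x).steps[t]? = some DyckStep.U ↔
    t < 2 * b * d ∧ C.IsBlackBoundary (C.walk x t) := by
  have := h.steps_length
  rw [List.getElem?_eq_some_iff]
  constructor
  · rintro ⟨h1, h2⟩
    refine ⟨by omega, ?_⟩
    by_contra hcon
    simp [boundaryPath, hcon] at h2
  · rintro ⟨h1, h2⟩
    refine ⟨by omega, ?_⟩
    simp [boundaryPath, h2]

theorem steps_eq_D_iff {t : ℕ} : (C.boundaryPath x).steps[t]? = some DyckStep.D ↔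
    t < 2 * b * d ∧ C.IsWhiteBoundary (C.walk x t) := by
  rw [getElem?_eq_D_iff, Ne, h.steps_eq_U_iff, h.steps_length]
  constructor
  · rintro ⟨h1, h2⟩
    exact ⟨h1, (h.boundary_cases (h.face_walk t)).resolve_left fun hb => h2 ⟨h1, hb⟩⟩
  · rintro ⟨h1, h2⟩
    exact ⟨h1, fun h3 => IsLabelledCactus.not_white_of_black h3.2 h2⟩

theorem hasBlocks : HasBlocks b (C.boundaryPath x).steps h.blockTime where
  up_iff t := by
    rw [h.steps_eq_U_iff]
    constructor
    · rintro ⟨h1, h2⟩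
      exact (h.blackBoundary_walk_iff h1).1 h2
    · rintro ⟨j, h1, h2⟩
      have := h.blockTime_add_le j
      have ht : t < 2 * b * d := by omega
      exact ⟨ht, (h.blackBoundary_walk_iff ht).2 ⟨j, h1, h2⟩⟩
  disjoint _ _ _ := h.blockTime_disjoint

theorem height_eq {t : ℕ} (ht : t ≤ 2 * b * d) :
    pathHeight (C.boundaryPath x).steps t = δ (C.walk x t) := by
  induction t with
  | zero =>
    have : C.walk x 0 = x := rfl
    simp [pathHeight_zero, this, h.root_label]
  | succ t ih =>
    rcases h.boundary_cases (h.face_walk t) with hb | hw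
    · rw [pathHeight_succ_of_up (h.steps_eq_U_iff.2 ⟨by omega, hb⟩), ih (by omega),
        h.label_walk_succ_of_black hb]
      push_cast; rfl
    · rw [pathHeight_succ_of_down (h.steps_eq_D_iff.2 ⟨by omega, hw⟩), ih (by omega),
        h.label_walk_of_white hw]
      push_cast; ring

theorem height_colour {t : ℕ} (ht : t ≤ 2 * b * d) :
    (pathHeight (C.boundaryPath x).steps t : ZMod (b + 1)) = C.colour (C.walk x t) := by
  rw [h.height_eq ht, h.boundary_colour (h.face_walk t)]
  simp

theorem boundaryPath_dist (j : Fin d) : (C.boundaryPath x).dist j = h.blockTime j := by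
  have hb := h.b_pos
  change sInf {t | C.face (C.opp (C.walk x t)) = FaceName.black j} = _
  have h1 : h.blockTime j ∈ {t | C.face (C.opp (C.walk x t)) = FaceName.black j} :=
    (h.face_opp_walk_eq_black_iff (h.blockTime_lt j)).2 ⟨le_rfl, by omega⟩
  refine le_antisymm (Nat.sInf_le h1) ?_
  have h2 := Nat.sInf_mem ⟨_, h1⟩
  have h3 := Nat.sInf_le h1
  have := h.blockTime_lt j
  exact ((h.face_opp_walk_eq_black_iff (by omega)).1 h2).1

theorem vertex_blackSide (j : Fin d) :
    C.vertex (h.blackSide j) = C.vertex (C.walk x (h.blockTime j)) := by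
  rw [← h.next_opp_walk_blockTime, h.cactus.surface.vertex_next, h.opp_opp]

theorem vertex_opp_blackSide (j : Fin d) :
    C.vertex (C.opp (h.blackSide j)) = C.vertex (C.walk x (h.blockTime j + b)) := by
  have hb := h.b_pos
  rw [← h.cactus.surface.vertex_next, h.opp_walk_blockTime_last,
    ← h.cactus.surface.vertex_next, ← walk_succ]
  congr 2
  omega

theorem vertex_opp_walk (t : ℕ) : C.vertex (C.opp (C.walk x t)) = C.vertex (C.walk x (t + 1)) := by
  rw [walk_succ, h.cactus.surface.vertex_next]

/-- The distinguished vertices have distinct colours. -/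
theorem colour_blockTime_injective :
    Function.Injective fun j => C.colour (C.walk x (h.blockTime j)) := by
  intro i j e
  refine h.colour_blackSide_injective ?_
  simpa only [h.colour_congr (h.vertex_blackSide _)] using e

/-- Only one boundary corner has label `0`. -/
theorem eq_zero_of_label_eq_zero {t : ℕ} (ht : t < 2 * b * d) (h0 : δ (C.walk x t) = 0) :
    t = 0 := by
  -- A white boundary edge would lead from label 0 to a negative label.
  have hup : C.IsBlackBoundary (C.walk x t) := by
    refine (h.boundary_cases (h.face_walk t)).resolve_right fun hw => ?_
    have := h.label_walk_of_white hw
    omega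
  obtain ⟨j, h1, h2⟩ := (h.blackBoundary_walk_iff ht).1 hup
  -- Inside a block the preceding label would be negative, so the corner is the beginning of its
  -- block.
  have hj : h.blockTime j = t := by
    by_contra hcon
    have h3 := h.label_walk_succ_of_black (t := t - 1)
      ((h.blackBoundary_walk_iff (by omega)).2 ⟨j, by omega, by omega⟩)
    rw [Nat.sub_add_cancel (by omega)] at h3
    omega
  obtain ⟨i, hi⟩ := h.exists_blockTime_eq_zero
  -- By properness the blocks at `t` and at the root both begin in colour 0, and distinct blocks
  -- begin in distinct colours.
  have : i = j := by
    refine h.colour_blockTime_injective ?_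
    simp only [hi, hj]
    rw [h.boundary_colour (h.face_walk _), h.boundary_colour (h.face_walk _), h0]
    change ((δ x : ℕ) : ZMod (b + 1)) = _
    rw [h.root_label]
  rw [← hj, ← this, hi]

/-- The marked corner is unique. -/
theorem isMarked_iff {y : C.Dart} : C.IsMarked y ↔ y = x := by
  constructor
  · rintro ⟨hy, δ', hδ', h0⟩
    obtain ⟨t, ht, rfl⟩ := h.exists_walk hy
    -- Two canonical labellings differ by a constant; since both are nonnegative, a zero of `δ'` is
    -- a zero of `δ`.
    have key : ∀ t, (δ' (C.walk x t) : ℤ) - δ (C.walk x t) = δ' x := by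
      intro t
      induction t with
      | zero =>
        have : C.walk x 0 = x := rfl
        simp [this, h.root_label]
      | succ t ih =>
        rw [walk_succ]
        rcases h.boundary_cases (h.face_walk t) with hb | hw
        · rw [hδ'.black_step _ hb, h.canonical.black_step _ hb]
          push_cast; linarith
        · have h1 := hδ'.white_step _ hw
          have h2 := h.canonical.white_step _ hw
          omega
    have hk := key t
    rw [h0] at hk
    rw [h.eq_zero_of_label_eq_zero ht (by omega)]
    rfl
  · rintro rfl
    exact ⟨h.root_face, δ, h.canonical, h.root_label⟩

theorem latticePath_eq : C.latticePath = C.boundaryPath x := by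
  have hex : ∃ y, C.IsMarked y := ⟨x, h.isMarked_iff.2 rfl⟩
  rw [latticePath, dif_pos hex, h.isMarked_iff.1 hex.choose_spec]

end IsRootedCactus

end ColouredMap

/-! ### Tours

A tour describes a closed walk through a rooted tree by its node `cur t` at each time `t < N`;
`v i` is the time at which the node `i` is entered from its parent and `w i` is the time of the
return to the parent. -/

structure IsTour {ℓ : ℕ} (N : ℕ) (root : Fin ℓ) (cur : ℕ → Fin ℓ) (v w : Fin ℓ → ℕ) : Prop where
  pos : 0 < N
  v_root : v root = 0
  w_root : w root = N
  cur_zero : cur 0 = root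
  v_pos : ∀ i, i ≠ root → 0 < v i
  v_lt_w' : ∀ i, i ≠ root → v i < w i
  w_lt : ∀ i, i ≠ root → w i < N
  cur_v' : ∀ i, i ≠ root → cur (v i) = i
  cur_w_pred : ∀ i, i ≠ root → cur (w i - 1) = i
  cur_w : ∀ i, i ≠ root → cur (w i) = cur (v i - 1)
  first : ∀ i t, t < v i → cur t ≠ i
  v_ne_w : ∀ i k, i ≠ root → k ≠ root → v i ≠ w k
  eq_of_cur_ne : ∀ t, 0 < t → t < N → cur t ≠ cur (t - 1) → ∃ i, i ≠ root ∧ (t = v i ∨ t = w i)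

namespace IsTour

variable {ℓ N : ℕ} {root : Fin ℓ} {cur : ℕ → Fin ℓ} {v w : Fin ℓ → ℕ}
  (h : IsTour N root cur v w)
include h

theorem cur_v (i : Fin ℓ) : cur (v i) = i := by
  by_cases hi : i = root
  · rw [hi, h.v_root, h.cur_zero]
  · exact h.cur_v' i hi

theorem v_lt_w (i : Fin ℓ) : v i < w i := by
  by_cases hi : i = root
  · rw [hi, h.v_root, h.w_root]
    exact h.pos
  · exact h.v_lt_w' i hi

theorem w_le (i : Fin ℓ) : w i ≤ N := by
  by_cases hi : i = root
  · rw [hi, h.w_root]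
  · exact (h.w_lt i hi).le

theorem v_injective : Function.Injective v := fun i k e => by
  rw [← h.cur_v i, e, h.cur_v]

theorem v_cur_le (t : ℕ) : v (cur t) ≤ t := by
  by_contra hcon
  exact h.first (cur t) t (not_le.1 hcon) rfl

/-- During the visit of the subtree of `k`, the tour meets only nodes of this subtree. -/
theorem v_le_v_cur {k : Fin ℓ} (hk : k ≠ root) {t : ℕ} (h1 : v k ≤ t) (h2 : t < w k) :
    v k ≤ v (cur t) := by
  induction t using Nat.strong_induction_on with
  | _ t ih =>
    rcases h1.eq_or_lt with e | h1
    · rw [← e, h.cur_v]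
    · obtain ⟨t, rfl⟩ : ∃ s, t = s + 1 := ⟨t - 1, by omega⟩
      have hwk := h.w_lt k hk
      by_cases hc : cur (t + 1) = cur t
      · rw [hc]
        exact ih t (by omega) (by omega) (by omega)
      · obtain ⟨i, hi, e | e⟩ := h.eq_of_cur_ne (t + 1) (by omega) (by omega) hc
        · rw [e, h.cur_v]; omega
        -- On a return from `i`, the node `i` was entered no earlier than `k` by induction, and i ≠
        -- k because the return from `k` lies outside the range. So the parent of `i` was current at
        -- the time v i - 1, which is still within the visit of `k`.
        · have hti : cur t = i := by
            rw [← h.cur_w_pred i hi, ← e]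
            rfl
          have hvi := ih t (by omega) (by omega) (by omega)
          rw [hti] at hvi
          have hik : v i ≠ v k := fun e' => by
            have := h.v_injective e'
            subst this
            omega
          have h3 := h.v_lt_w i
          rw [e, h.cur_w i hi]
          exact ih (v i - 1) (by omega) (by omega) (by omega)

/-- If the return from `i` fell inside the visit of `k`, then `i`, current just before it, would
have been entered no earlier than `k`, which forces i = k. -/
theorem w_le_w {i k : Fin ℓ} (h1 : v i ≤ v k) (h2 : v k ≤ w i) : w k ≤ w i := by
  by_cases hi : i = root
  · rw [hi, h.w_root]
    exact h.w_le k
  by_cases hk : k = root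
  · have := h.v_pos i hi
    rw [hk, h.v_root] at h1
    omega
  by_contra hcon
  have h3 : v k < w i := lt_of_le_of_ne h2 (h.v_ne_w k i hk hi)
  have h4 := h.v_le_v_cur hk (t := w i - 1) (by omega) (by omega)
  rw [h.cur_w_pred i hi] at h4
  have : i = k := h.v_injective (le_antisymm h1 h4)
  subst this
  omega

/-- If the node stays the same until its own return time, the tour would already have met it before
it was first entered. If the tour has just come back from a child, the visit of the child is nested
in that of the node, and equal return times would make the node current already one step earlier. -/
theorem lt_w_cur {t : ℕ} (ht : t < N) : t < w (cur t) := by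
  induction t using Nat.strong_induction_on with
  | _ t ih =>
    by_cases hr : cur t = root
    · rw [hr, h.w_root]; exact ht
    by_contra hcon
    have h0 : v (cur t) ≤ t := h.v_cur_le t
    have h1 := h.v_lt_w (cur t)
    obtain ⟨t, rfl⟩ : ∃ s, t = s + 1 := ⟨t - 1, by omega⟩
    by_cases hc : cur (t + 1) = cur t
    · have := ih t (by omega) (by omega)
      rw [← hc] at this
      have hw : w (cur (t + 1)) = t + 1 := by omega
      have h2 := h.cur_w (cur (t + 1)) hr
      rw [hw] at h2
      exact h.first (cur (t + 1)) _ (by have := h.v_pos _ hr; omega) h2.symm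
    · obtain ⟨i, hi, e | e⟩ := h.eq_of_cur_ne (t + 1) (by omega) (by omega) hc
      · have h2 : cur (t + 1) = i := by rw [e, h.cur_v]
        rw [h2, ← e] at h1
        rw [h2] at hcon
        omega
      · have h3 := h.cur_w i hi
        have h4 := h.v_lt_w i
        have h5 := h.v_pos i hi
        rw [← e] at h3
        set k := cur (t + 1) with hk
        have h6 := ih (v i - 1) (by omega) (by omega)
        rw [← h3] at h6
        have h7 : v k ≤ v i - 1 := by rw [h3]; exact h.v_cur_le _
        have h8 := h.w_le_w (i := k) (k := i) (by omega) (by omega)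
        have h9 : w k = t + 1 := by omega
        have h10 : cur t = k := by rw [← h.cur_w_pred k hr, h9]; rfl
        exact hc h10.symm

/-- The innermost visit at time `t` is the one of the node `cur t`. -/
theorem cur_eq_iff {i : Fin ℓ} {t : ℕ} (ht : t < N) : cur t = i ↔
    (v i ≤ t ∧ t < w i) ∧
      ∀ k, k ≠ i → v i ≤ v k → w k ≤ w i → ¬ (v k ≤ t ∧ t < w k) := by
  constructor
  · rintro rfl
    refine ⟨⟨h.v_cur_le t, h.lt_w_cur ht⟩, ?_⟩
    rintro k hk h1 - ⟨h2, h3⟩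
    by_cases hkr : k = root
    · rw [hkr, h.v_root] at h1
      refine hk (h.v_injective ?_)
      rw [hkr, h.v_root]; omega
    · exact hk (h.v_injective (le_antisymm (h.v_le_v_cur hkr h2 h3) h1))
  · rintro ⟨⟨h1, h2⟩, h3⟩
    by_contra hne
    have h4 : v i ≤ v (cur t) := by
      by_cases hi : i = root
      · rw [hi, h.v_root]; omega
      · exact h.v_le_v_cur hi h1 h2
    have h5 := h.v_cur_le t
    exact h3 (cur t) hne h4 (h.w_le_w h4 (by omega)) ⟨h5, h.lt_w_cur ht⟩

end IsTour

/-! ### The white faces met by the walk -/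

namespace ColouredMap

namespace IsRootedCactus

variable {ℓ d b : ℕ} {μ : Fin ℓ → ℕ} {C : ColouredMap ℓ d b} {δ : C.Dart → ℕ} {x : C.Dart}

open Classical in
/-- The side of a white face that belongs to the time `t`: the inner side of a white boundary edge,
or the white side of the internal edge of a black face. -/
noncomputable def whiteDart (h : C.IsRootedCactus μ δ x) (t : ℕ) : C.Dart :=
  if hj : ∃ j, C.face (C.opp (C.walk x t)) = FaceName.black j then C.opp (h.blackSide hj.choose)
  else C.opp (C.walk x t)

variable (h : C.IsRootedCactus μ δ x)
include h

theorem whiteDart_of_black {t : ℕ} {j : Fin d}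
    (hj : C.face (C.opp (C.walk x t)) = FaceName.black j) :
    h.whiteDart t = C.opp (h.blackSide j) := by
  have hex : ∃ j, C.face (C.opp (C.walk x t)) = FaceName.black j := ⟨j, hj⟩
  rw [whiteDart, dif_pos hex, FaceName.black.inj (hex.choose_spec.symm.trans hj)]

theorem whiteDart_block {t : ℕ} {j : Fin d} (h1 : h.blockTime j ≤ t)
    (h2 : t < h.blockTime j + b) : h.whiteDart t = C.opp (h.blackSide j) := by
  have := h.blockTime_add_le j
  exact h.whiteDart_of_black ((h.face_opp_walk_eq_black_iff (by omega)).2 ⟨h1, h2⟩)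

theorem whiteDart_blockTime (j : Fin d) : h.whiteDart (h.blockTime j) = C.opp (h.blackSide j) :=
  h.whiteDart_block le_rfl (by have := h.b_pos; omega)

theorem whiteDart_of_white {t : ℕ} (ht : C.IsWhiteBoundary (C.walk x t)) :
    h.whiteDart t = C.opp (C.walk x t) := by
  rw [whiteDart, dif_neg]
  exact fun hj => IsLabelledCactus.not_white_of_black ⟨h.face_walk t, hj⟩ ht

theorem exists_face_whiteDart (t : ℕ) : ∃ i, C.face (h.whiteDart t) = FaceName.white i := by
  rcases h.boundary_cases (h.face_walk t) with ⟨-, j, hj⟩ | hw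
  · rw [h.whiteDart_of_black hj]
    exact (h.internal_opp_blackSide j).1
  · rw [h.whiteDart_of_white hw]
    exact hw.2

omit h in
/-- The label of the white face that is met at the time `t`. -/
noncomputable def cur (h : C.IsRootedCactus μ δ x) (t : ℕ) : Fin ℓ :=
  (h.exists_face_whiteDart t).choose

theorem face_whiteDart (t : ℕ) : C.face (h.whiteDart t) = FaceName.white (h.cur t) :=
  (h.exists_face_whiteDart t).choose_spec

theorem cur_eq_iff_face {t : ℕ} {i : Fin ℓ} :
    h.cur t = i ↔ C.face (h.whiteDart t) = FaceName.white i := by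
  rw [h.face_whiteDart]
  exact ⟨fun e => e ▸ rfl, FaceName.white.inj⟩

omit h in
/-- At the time `t`, the walk meets an edge of a white face. -/
def WhiteTime (h : C.IsRootedCactus μ δ x) (t : ℕ) : Prop :=
  t < 2 * b * d ∧ (C.IsWhiteBoundary (C.walk x t) ∨ ∃ j, h.blockTime j = t)

omit h in
open Classical in
/-- The time at which the walk leaves the edge of a white face that it meets at the time `t`. -/
noncomputable def endTime (h : C.IsRootedCactus μ δ x) (t : ℕ) : ℕ :=
  if ∃ j, h.blockTime j = t then t + b else t + 1

theorem endTime_blockTime (j : Fin d) : h.endTime (h.blockTime j) = h.blockTime j + b :=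
  if_pos ⟨j, rfl⟩

theorem blackBoundary_blockTime (j : Fin d) : C.IsBlackBoundary (C.walk x (h.blockTime j)) :=
  h.blackBoundary_walk_blockTime (k := 0) h.b_pos

theorem endTime_of_white {t : ℕ} (ht : C.IsWhiteBoundary (C.walk x t)) :
    h.endTime t = t + 1 := by
  refine if_neg ?_
  rintro ⟨j, rfl⟩
  exact IsLabelledCactus.not_white_of_black (h.blackBoundary_blockTime j) ht

theorem lt_endTime (t : ℕ) : t < h.endTime t := by
  have := h.b_pos
  unfold endTime
  split_ifs <;> omega

theorem endTime_le {t : ℕ} (ht : h.WhiteTime t) : h.endTime t ≤ 2 * b * d := by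
  obtain ⟨ht, hw | ⟨j, rfl⟩⟩ := ht
  · rw [h.endTime_of_white hw]; omega
  · rw [h.endTime_blockTime]; exact h.blockTime_add_le j

theorem vertex_whiteDart {t : ℕ} (ht : h.WhiteTime t) :
    C.vertex (h.whiteDart t) = C.vertex (C.walk x (h.endTime t)) := by
  obtain ⟨ht, hw | ⟨j, rfl⟩⟩ := ht
  · rw [h.endTime_of_white hw, h.whiteDart_of_white hw, h.vertex_opp_walk]
  · rw [h.endTime_blockTime, h.whiteDart_blockTime, h.vertex_opp_blackSide]

theorem vertex_opp_whiteDart {t : ℕ} (ht : h.WhiteTime t) :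
    C.vertex (C.opp (h.whiteDart t)) = C.vertex (C.walk x t) := by
  obtain ⟨ht, hw | ⟨j, rfl⟩⟩ := ht
  · rw [h.whiteDart_of_white hw, h.opp_opp]
  · rw [h.whiteDart_blockTime, h.opp_opp, h.vertex_blackSide]

theorem exists_whiteTime {y : C.Dart} {i : Fin ℓ} (hy : C.face y = FaceName.white i) :
    ∃ t, h.WhiteTime t ∧ h.whiteDart t = y := by
  rcases h.white_cases hy with hb | ⟨j, hj⟩
  · obtain ⟨t, ht, e⟩ := h.exists_walk hb
    have hw : C.IsWhiteBoundary (C.walk x t) := ⟨h.face_walk t, i, by rw [e, h.opp_opp, hy]⟩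
    exact ⟨t, ⟨ht, Or.inl hw⟩, by rw [h.whiteDart_of_white hw, e, h.opp_opp]⟩
  · have e : C.opp y = h.blackSide j := h.eq_blackSide hj (by rw [h.opp_opp, hy]; simp)
    exact ⟨h.blockTime j, ⟨h.blockTime_lt j, Or.inr ⟨j, rfl⟩⟩, by
      rw [h.whiteDart_blockTime, ← e, h.opp_opp]⟩

theorem whiteDart_injOn {s t : ℕ} (hs : h.WhiteTime s) (ht : h.WhiteTime t)
    (e : h.whiteDart s = h.whiteDart t) : s = t := by
  have hinj := h.cactus.surface.opp_bijective.1
  obtain ⟨hs, hsw | ⟨j, rfl⟩⟩ := hs <;> obtain ⟨ht, htw | ⟨k, rfl⟩⟩ := ht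
  · rw [h.whiteDart_of_white hsw, h.whiteDart_of_white htw] at e
    exact h.walk_injOn hs ht (hinj e)
  · rw [h.whiteDart_of_white hsw, h.whiteDart_blockTime] at e
    have := h.face_walk (x := x) s
    rw [hinj e, h.face_blackSide] at this
    cases this
  · rw [h.whiteDart_of_white htw, h.whiteDart_blockTime] at e
    have := h.face_walk (x := x) t
    rw [← hinj e, h.face_blackSide] at this
    cases this
  · rw [h.whiteDart_blockTime, h.whiteDart_blockTime] at e
    rw [h.blackSide_injective (hinj e)]

theorem endTime_injOn {s t : ℕ} (hs : h.WhiteTime s) (ht : h.WhiteTime t)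
    (e : h.endTime s = h.endTime t) : s = t := by
  have hb := h.b_pos
  obtain ⟨hs, hsw | ⟨j, rfl⟩⟩ := hs <;> obtain ⟨ht, htw | ⟨k, rfl⟩⟩ := ht
  · rw [h.endTime_of_white hsw, h.endTime_of_white htw] at e
    omega
  · rw [h.endTime_of_white hsw, h.endTime_blockTime] at e
    refine absurd hsw (IsLabelledCactus.not_white_of_black ?_)
    exact (h.blackBoundary_walk_iff hs).2 ⟨k, by omega, by omega⟩
  · rw [h.endTime_of_white htw, h.endTime_blockTime] at e
    refine absurd htw (IsLabelledCactus.not_white_of_black ?_)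
    exact (h.blackBoundary_walk_iff ht).2 ⟨j, by omega, by omega⟩
  · rw [h.endTime_blockTime, h.endTime_blockTime] at e
    omega

/-- The next side of the same white face. -/
theorem exists_next_whiteDart {t : ℕ} (ht : h.WhiteTime t) :
    ∃ k, h.WhiteTime k ∧ C.next (h.whiteDart t) = h.whiteDart k ∧ h.cur k = h.cur t ∧
      C.vertex (C.walk x t) = C.vertex (C.walk x (h.endTime k)) := by
  have hf := (h.face_next (h.whiteDart t)).trans (h.face_whiteDart t)
  obtain ⟨k, hk, e⟩ := h.exists_whiteTime hf
  refine ⟨k, hk, e.symm, by rw [h.cur_eq_iff_face, e, hf], ?_⟩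
  rw [← h.vertex_whiteDart hk, e, h.cactus.surface.vertex_next, h.vertex_opp_whiteDart ht]

theorem cur_block {t : ℕ} {j : Fin d} (h1 : h.blockTime j ≤ t) (h2 : t < h.blockTime j + b) :
    h.cur t = h.cur (h.blockTime j) := by
  rw [h.cur_eq_iff_face, h.whiteDart_block h1 h2, ← h.whiteDart_blockTime, h.face_whiteDart]

/-- Inside a block of up-steps, the white face does not change; other times begin where an edge of
a white face ends. -/
theorem interior_or_endTime {t : ℕ} (h0 : 0 < t) (ht : t < 2 * b * d) :
    h.cur t = h.cur (t - 1) ∨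
      h.WhiteTime t ∧ ∃ k, h.WhiteTime k ∧ h.endTime k = t ∧ h.cur k = h.cur (t - 1) := by
  by_cases hint : ∃ j, h.blockTime j < t ∧ t < h.blockTime j + b
  · obtain ⟨j, h1, h2⟩ := hint
    left
    rw [h.cur_block h1.le h2, h.cur_block (j := j) (t := t - 1) (by omega) (by omega)]
  · right
    push Not at hint
    constructor
    · refine ⟨ht, (h.boundary_cases (h.face_walk t)).symm.imp_right fun hb => ?_⟩
      obtain ⟨j, h1, h2⟩ := (h.blackBoundary_walk_iff ht).1 hb
      refine ⟨j, ?_⟩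
      by_contra hne
      have := hint j (by omega)
      omega
    · rcases h.boundary_cases (h.face_walk (t - 1)) with hb | hw
      · obtain ⟨j, h1, h2⟩ := (h.blackBoundary_walk_iff (by omega)).1 hb
        refine ⟨h.blockTime j, ⟨h.blockTime_lt j, Or.inr ⟨j, rfl⟩⟩, ?_, (h.cur_block h1 h2).symm⟩
        rw [h.endTime_blockTime]
        have := hint j (by omega)
        omega
      · refine ⟨t - 1, ⟨by omega, Or.inl hw⟩, ?_, rfl⟩
        rw [h.endTime_of_white hw]; omega

theorem blackBoundary_zero : C.IsBlackBoundary (C.walk x 0) := h.blackBoundary_root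

/-- The end time may be the total length, which gives the same dart as time 0; a positive `t`
excludes this. -/
theorem walk_endTime_eq {k t : ℕ} (hk : h.WhiteTime k) (h0 : 0 < t) (ht : t < 2 * b * d)
    (e : C.walk x t = C.walk x (h.endTime k)) : h.endTime k = t := by
  rcases (h.endTime_le hk).eq_or_lt with h1 | h1
  · rw [h1, h.walk_length] at e
    have := h.walk_injOn (s := t) (t := 0) ht h.length_pos e
    omega
  · exact (h.walk_injOn ht h1 e).symm

/-- Two times at the same vertex are times of white boundary edges. -/
theorem white_of_vertex_eq {s t : ℕ} (hs : s < 2 * b * d) (ht : t < 2 * b * d) (hst : s ≠ t)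
    (e : C.vertex (C.walk x s) = C.vertex (C.walk x t)) :
    C.IsWhiteBoundary (C.walk x s) ∧ C.IsWhiteBoundary (C.walk x t) := by
  constructor
  · refine (h.boundary_cases (h.face_walk s)).resolve_left fun hb => hst ?_
    exact h.walk_injOn hs ht (h.eq_of_blackBoundary hb (h.face_walk t) e)
  · refine (h.boundary_cases (h.face_walk t)).resolve_left fun hb => hst ?_
    exact (h.walk_injOn ht hs (h.eq_of_blackBoundary hb (h.face_walk s) e.symm)).symm

theorem times_eq_of_vertex_eq {s t s' t' : ℕ} (hs : s < 2 * b * d) (ht : t < 2 * b * d)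
    (hs' : s' < 2 * b * d) (ht' : t' < 2 * b * d) (hst : s ≠ t) (hst' : s' ≠ t')
    (e : C.vertex (C.walk x s) = C.vertex (C.walk x t))
    (e' : C.vertex (C.walk x s') = C.vertex (C.walk x t'))
    (hc : C.colour (C.walk x s') = C.colour (C.walk x s)) :
    (s' = s ∧ t' = t) ∨ (s' = t ∧ t' = s) := by
  obtain ⟨h1, h2⟩ := h.white_of_vertex_eq hs ht hst e
  obtain ⟨h3, h4⟩ := h.white_of_vertex_eq hs' ht' hst' e'
  exact (h.pair_eq_of_vertex_eq h1 h2 h3 h4 (fun e => hst (h.walk_injOn hs ht e))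
    (fun e => hst' (h.walk_injOn hs' ht' e)) e e' hc).imp
    (fun e => ⟨h.walk_injOn hs' hs e.1, h.walk_injOn ht' ht e.2⟩)
    (fun e => ⟨h.walk_injOn hs' ht e.1, h.walk_injOn ht' hs e.2⟩)

/-- If the white face changes at the time `t`, then the walk is at a vertex with a second boundary
corner, at which the white face changes back. -/
theorem exists_partner {t : ℕ} (h0 : 0 < t) (ht : t < 2 * b * d)
    (hc : h.cur t ≠ h.cur (t - 1)) :
    ∃ t', 0 < t' ∧ t' < 2 * b * d ∧ t ≠ t' ∧ C.vertex (C.walk x t) = C.vertex (C.walk x t') ∧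
      h.cur t' = h.cur (t - 1) ∧ h.cur (t' - 1) = h.cur t := by
  obtain ⟨htw, k0, hk0, ek0, ck0⟩ := (h.interior_or_endTime h0 ht).resolve_left hc
  -- The next side of the face entered at time `t` also touches this vertex, and the walk leaves
  -- that side at the time `endTime k`. This is not `t`, since the side left at time `t` belongs to
  -- the previous face.
  obtain ⟨k, hk, ek, ck, vk⟩ := h.exists_next_whiteDart htw
  have hkt : h.endTime k ≠ t := by
    intro e
    have := h.endTime_injOn hk hk0 (e.trans ek0.symm)
    subst this
    exact hc (ck.symm.trans ck0)
  have hne : C.walk x t ≠ C.walk x (h.endTime k) := fun e => hkt (h.walk_endTime_eq hk h0 ht e)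
  -- Otherwise the vertex is the root vertex, which begins a black boundary edge and has one corner
  -- only.
  have hlt : h.endTime k < 2 * b * d := by
    refine lt_of_le_of_ne (h.endTime_le hk) fun e => hne ?_
    rw [e, h.walk_length] at vk ⊢
    exact (h.eq_of_blackBoundary h.blackBoundary_root (h.face_walk t) vk.symm).symm
  have hpos : 0 < h.endTime k := (Nat.zero_le _).trans_lt (h.lt_endTime k)
  obtain ⟨hw, hw'⟩ := h.white_of_vertex_eq ht hlt hkt.symm vk
  set t' := h.endTime k with ht'
  have ck' : h.cur (t' - 1) = h.cur t := by
    rcases h.interior_or_endTime hpos hlt with hin | ⟨-, k1, hk1, ek1, ck1⟩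
    · by_cases hkw : C.IsWhiteBoundary (C.walk x k)
      · rw [ht', h.endTime_of_white hkw]
        exact ck
      · obtain ⟨-, hkw' | ⟨j, hj⟩⟩ := hk
        · exact absurd hkw' hkw
        · have hb := h.b_pos
          rw [← hj, h.endTime_blockTime] at ht'
          rw [h.cur_block (j := j) (by omega) (by omega), hj, ck]
    · rw [← ck1, h.endTime_injOn hk1 hk ek1, ck]
  refine ⟨t', hpos, hlt, hkt.symm, vk, ?_, ck'⟩
  -- The same construction at `t'` returns to a corner of this vertex other than `t'`. There are
  -- only two, so it is `t`, and the side left there belongs to the face met before time `t`.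
  obtain ⟨k', hk', ek', ckk', vk'⟩ := h.exists_next_whiteDart (t := t') ⟨hlt, Or.inl hw'⟩
  have hk't : h.endTime k' ≠ t' := by
    intro e
    have := h.endTime_injOn hk' hk e
    subst this
    have := h.cactus.surface.next_bijective.1 (ek.trans ek'.symm)
    exact hkt.symm (h.whiteDart_injOn htw ⟨hlt, Or.inl hw'⟩ this)
  have hlt' : h.endTime k' < 2 * b * d := by
    refine lt_of_le_of_ne (h.endTime_le hk') fun e => ?_
    rw [e, h.walk_length] at vk'
    have := h.eq_of_blackBoundary h.blackBoundary_root (h.face_walk t') vk'.symm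
    have := h.walk_injOn (s := 0) h.length_pos hlt this
    omega
  rcases h.times_eq_of_vertex_eq ht hlt hlt hlt' hkt.symm (Ne.symm hk't) vk vk'
    (h.colour_congr vk.symm) with ⟨e, -⟩ | ⟨-, e⟩
  · exact absurd e hkt
  · rw [← ckk', h.endTime_injOn hk' hk0 (e.trans ek0.symm), ck0]

theorem exists_cur_eq (i : Fin ℓ) : ∃ t < 2 * b * d, h.cur t = i := by
  obtain ⟨y, hy⟩ := h.cactus.surface.face_surjective (FaceName.white i)
  obtain ⟨t, ht, e⟩ := h.exists_whiteTime hy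
  exact ⟨t, ht.1, by rw [h.cur_eq_iff_face, e, hy]⟩

/-- Take the first time at which the face is met, and its partner. The face is current just before
the partner, which therefore comes later. -/
theorem exists_visits (i : Fin ℓ) (hi : i ≠ h.cur 0) :
    ∃ p : ℕ × ℕ, 0 < p.1 ∧ p.1 < p.2 ∧ p.2 < 2 * b * d ∧
      C.vertex (C.walk x p.1) = C.vertex (C.walk x p.2) ∧ h.cur p.1 = i ∧
      h.cur (p.2 - 1) = i ∧ h.cur p.2 = h.cur (p.1 - 1) ∧ ∀ t < p.1, h.cur t ≠ i := by
  classical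
  have hex : ∃ t, t < 2 * b * d ∧ h.cur t = i := h.exists_cur_eq i
  obtain ⟨h1, h2⟩ := Nat.find_spec hex
  have h3 : ∀ t < Nat.find hex, h.cur t ≠ i := fun t ht e =>
    Nat.find_min hex ht ⟨ht.trans h1, e⟩
  set v := Nat.find hex
  have hv : 0 < v := by
    rw [Nat.pos_iff_ne_zero]
    intro e
    rw [e] at h2
    exact hi h2.symm
  obtain ⟨w, hw0, hw, hne, e, c1, c2⟩ := h.exists_partner hv h1
    fun e => h3 (v - 1) (by omega) (e.symm.trans h2)
  rw [h2] at c2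
  have h4 : ¬ w - 1 < v := fun hlt => h3 _ hlt c2
  exact ⟨(v, w), hv, by omega, hw, e, h2, c2, c1, h3⟩

omit h in
open Classical in
/-- The pair of times at which the walk enters the white face `i` from another white face and
returns to it; for the white face at the root, the two ends of the walk. -/
noncomputable def visits (h : C.IsRootedCactus μ δ x) (i : Fin ℓ) : ℕ × ℕ :=
  if hi : i ≠ h.cur 0 then (h.exists_visits i hi).choose else (0, 2 * b * d)

theorem visits_spec (i : Fin ℓ) (hi : i ≠ h.cur 0) :
    0 < (h.visits i).1 ∧ (h.visits i).1 < (h.visits i).2 ∧ (h.visits i).2 < 2 * b * d ∧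
      C.vertex (C.walk x (h.visits i).1) = C.vertex (C.walk x (h.visits i).2) ∧
      h.cur (h.visits i).1 = i ∧ h.cur ((h.visits i).2 - 1) = i ∧
      h.cur (h.visits i).2 = h.cur ((h.visits i).1 - 1) ∧
      ∀ t < (h.visits i).1, h.cur t ≠ i := by
  rw [visits, dif_pos hi]
  exact (h.exists_visits i hi).choose_spec

theorem visits_root : h.visits (h.cur 0) = (0, 2 * b * d) := by
  rw [visits, dif_neg (by simp)]

theorem visits_eq_of_colour {i k : Fin ℓ} (hi : i ≠ h.cur 0) (hk : k ≠ h.cur 0)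
    (hc : C.colour (C.walk x (h.visits i).1) = C.colour (C.walk x (h.visits k).1)) : i = k := by
  obtain ⟨a1, a2, a3, a4, a5, a6, a7, a8⟩ := h.visits_spec i hi
  obtain ⟨b1, b2, b3, b4, b5, b6, b7, b8⟩ := h.visits_spec k hk
  rcases h.times_eq_of_vertex_eq (b2.trans b3) b3 (a2.trans a3) a3 b2.ne a2.ne b4 a4 hc with
    ⟨e, -⟩ | ⟨e1, e2⟩
  · rw [← a5, e, b5]
  · omega

theorem colour_visits_ne (i : Fin ℓ) (hi : i ≠ h.cur 0) (j : Fin d) :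
    C.colour (C.walk x (h.visits i).1) ≠ C.colour (C.walk x (h.blockTime j)) := by
  obtain ⟨a1, a2, a3, a4, -⟩ := h.visits_spec i hi
  obtain ⟨w1, w2⟩ := h.white_of_vertex_eq (a2.trans a3) a3 a2.ne a4
  have := h.colour_blackSide_ne w1 w2 (fun e => a2.ne (h.walk_injOn (a2.trans a3) a3 e)) a4 j
  rw [h.colour_congr (h.vertex_blackSide j)] at this
  exact this.symm

/-- Every vertex with two boundary corners is the vertex of a pair of visits. -/
theorem exists_visits_eq {s t : ℕ} (hst : s < t) (ht : t < 2 * b * d)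
    (e : C.vertex (C.walk x s) = C.vertex (C.walk x t)) :
    ∃ i, i ≠ h.cur 0 ∧ h.visits i = (s, t) := by
  classical
  -- The ℓ - 1 pairs of visits and the d distinguished vertices have distinct colours, and (ℓ - 1) +
  -- d = b + 1, so every colour occurs. The colour of a double vertex is not that of a distinguished
  -- vertex; it is the colour of some pair, and a colour has only one double vertex.
  let g : {i // i ≠ h.cur 0} ⊕ Fin d → ZMod (b + 1) :=
    Sum.elim (fun i => C.colour (C.walk x (h.visits i.1).1))
      fun j => C.colour (C.walk x (h.blockTime j))
  have hg : Function.Injective g := by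
    rintro (⟨i, hi⟩ | i) (⟨k, hk⟩ | k) e
    · have := h.visits_eq_of_colour hi hk e
      subst this; rfl
    · exact absurd e (h.colour_visits_ne i hi k)
    · exact absurd e.symm (h.colour_visits_ne k hk i)
    · rw [h.colour_blockTime_injective e]
  have hcard : Fintype.card ({i // i ≠ h.cur 0} ⊕ Fin d) = Fintype.card (ZMod (b + 1)) := by
    have := h.b_add_two
    have := h.b_pos
    have := (h.cur 0).pos
    rw [Fintype.card_sum, ZMod.card, Fintype.card_fin, Fintype.card_subtype_compl,
      Fintype.card_fin, Fintype.card_unique]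
    omega
  have hbij := (Fintype.bijective_iff_injective_and_card g).2 ⟨hg, hcard⟩
  obtain ⟨w1, w2⟩ := h.white_of_vertex_eq (hst.trans ht) ht hst.ne e
  obtain ⟨⟨i, hi⟩ | j, hc⟩ := hbij.2 (C.colour (C.walk x s))
  · refine ⟨i, hi, ?_⟩
    obtain ⟨a1, a2, a3, a4, -⟩ := h.visits_spec i hi
    rcases h.times_eq_of_vertex_eq (hst.trans ht) ht (a2.trans a3) a3 hst.ne a2.ne e a4 hc with
      ⟨e1, e2⟩ | ⟨e1, e2⟩
    · exact Prod.ext e1 e2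
    · omega
  · have := h.colour_blackSide_ne w1 w2 (fun e => hst.ne (h.walk_injOn (hst.trans ht) ht e)) e j
    rw [h.colour_congr (h.vertex_blackSide j)] at this
    exact absurd hc this

/-- The face changes only at double vertices, and each double vertex is the vertex of a pair of
visits. Noncrossing of the marked pairs and the description of their essential intervals are drawn
from this. -/
theorem isTour : IsTour (2 * b * d) (h.cur 0) h.cur (fun i => (h.visits i).1)
    (fun i => (h.visits i).2) where
  pos := h.length_pos
  v_root := by rw [h.visits_root]
  w_root := by rw [h.visits_root]
  cur_zero := rfl
  v_pos i hi := (h.visits_spec i hi).1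
  v_lt_w' i hi := (h.visits_spec i hi).2.1
  w_lt i hi := (h.visits_spec i hi).2.2.1
  cur_v' i hi := (h.visits_spec i hi).2.2.2.2.1
  cur_w_pred i hi := (h.visits_spec i hi).2.2.2.2.2.1
  cur_w i hi := (h.visits_spec i hi).2.2.2.2.2.2.1
  first i t ht := by
    by_cases hi : i = h.cur 0
    · rw [hi, h.visits_root] at ht
      omega
    · exact (h.visits_spec i hi).2.2.2.2.2.2.2 t ht
  v_ne_w i k hi hk e := by
    obtain ⟨a1, a2, a3, a4, -⟩ := h.visits_spec i hi
    obtain ⟨b1, b2, b3, b4, -⟩ := h.visits_spec k hk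
    rcases h.times_eq_of_vertex_eq (a2.trans a3) a3 (b2.trans b3) b3 a2.ne b2.ne a4 b4
      (by rw [h.colour_congr b4, ← e]) with ⟨e1, e2⟩ | ⟨e1, e2⟩ <;> omega
  eq_of_cur_ne t h0 ht hc := by
    obtain ⟨t', h0', ht', hne, e, -⟩ := h.exists_partner h0 ht hc
    rcases lt_or_gt_of_ne hne with hlt | hlt
    · obtain ⟨i, hi, ei⟩ := h.exists_visits_eq hlt ht' e
      exact ⟨i, hi, Or.inl (by rw [ei])⟩
    · obtain ⟨i, hi, ei⟩ := h.exists_visits_eq hlt ht e.symm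
      exact ⟨i, hi, Or.inr (by rw [ei])⟩

end IsRootedCactus

end ColouredMap

theorem HasBlocks.ncard_up {d b : ℕ} {s : List DyckStep} {f : Fin d → ℕ} (hs : HasBlocks b s f)
    {S : ℕ → Prop} (hS : ∀ j t, f j ≤ t → t < f j + b → (S t ↔ S (f j))) :
    {k | S k ∧ s[k]? = some DyckStep.U}.ncard = b * Nat.card {j // S (f j)} := by
  have e : Nat.card ({j // S (f j)} × Fin b) = b * Nat.card {j // S (f j)} := by
    rw [Nat.card_prod, Nat.card_fin, mul_comm]
  rw [← e, ← Nat.card_coe_set_eq]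
  symm
  refine Nat.card_congr (Equiv.ofBijective (fun p => ⟨f p.1.1 + p.2, ?_, ?_⟩) ⟨?_, ?_⟩)
  · exact (hS _ _ (by omega) (by omega)).2 p.1.2
  · exact hs.up (j := p.1.1) (by omega) (by omega)
  · rintro ⟨⟨i, hi⟩, m⟩ ⟨⟨j, hj⟩, k⟩ e
    simp only [Subtype.mk.injEq] at e
    have := hs.disjoint i j (f i + m) (by omega) (by omega) (by omega) (by omega)
    subst this
    have : m = k := by ext; omega
    subst this
    rfl
  · rintro ⟨k, hk1, hk2⟩
    obtain ⟨j, h1, h2⟩ := (hs.up_iff k).1 hk2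
    refine ⟨⟨⟨j, (hS j k h1 h2).1 hk1⟩, ⟨k - f j, by omega⟩⟩, ?_⟩
    simp only [Subtype.mk.injEq]
    omega

/-! ### The lattice path of a cactus is a single Hurwitz path -/

namespace ColouredMap

namespace IsRootedCactus

section

variable {ℓ d b : ℕ} {μ : Fin ℓ → ℕ} {C : ColouredMap ℓ d b} {δ : C.Dart → ℕ} {x : C.Dart}
  (h : C.IsRootedCactus μ δ x)
include h

theorem cur_endTime_pred {k : ℕ} (hk : h.WhiteTime k) : h.cur (h.endTime k - 1) = h.cur k := by
  have hb := h.b_pos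
  obtain ⟨-, hw | ⟨j, rfl⟩⟩ := hk
  · rw [h.endTime_of_white hw]; rfl
  · rw [h.endTime_blockTime, h.cur_block (j := j) (by omega) (by omega)]

theorem cur_visits_ne {i : Fin ℓ} (hi : i ≠ h.cur 0) : h.cur (h.visits i).2 ≠ i := by
  obtain ⟨a1, a2, a3, a4, a5, a6, a7, a8⟩ := h.visits_spec i hi
  rw [a7]
  exact a8 _ (by omega)

/-- The next side of a white face ends at the vertex where the given side is met, so its end time is
one of the at most two visits of this vertex. The hypothesis, which mentions times only, selects the
right one; this allows the cactus to be recovered from its path. -/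
theorem next_whiteDart {k t : ℕ} (hk : h.WhiteTime k) (ht : h.WhiteTime t)
    (hkt : (t = 0 ∧ h.endTime k = 2 * b * d) ∨
      (∃ i, i ≠ h.cur 0 ∧ ((t = (h.visits i).1 ∧ h.endTime k = (h.visits i).2) ∨
        (t = (h.visits i).2 ∧ h.endTime k = (h.visits i).1))) ∨
      (0 < t ∧ h.endTime k = t ∧
        ∀ i, i ≠ h.cur 0 → t ≠ (h.visits i).1 ∧ t ≠ (h.visits i).2)) :
    C.next (h.whiteDart t) = h.whiteDart k := by
  obtain ⟨k', hk', e, ck, vk⟩ := h.exists_next_whiteDart ht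
  rw [e]
  congr 1
  have hle := h.endTime_le hk'
  have hpos := h.lt_endTime k'
  have hroot : h.endTime k' = 2 * b * d → t = 0 := by
    intro e
    rw [e, h.walk_length] at vk
    exact h.walk_injOn ht.1 h.length_pos
      (h.eq_of_blackBoundary h.blackBoundary_root (h.face_walk t) vk.symm).symm
  have hpair : h.endTime k' < 2 * b * d → h.endTime k' ≠ t → ∃ i, i ≠ h.cur 0 ∧
      ((t = (h.visits i).1 ∧ h.endTime k' = (h.visits i).2) ∨
        (t = (h.visits i).2 ∧ h.endTime k' = (h.visits i).1)) := by
    intro hlt hne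
    rcases lt_or_gt_of_ne hne with h1 | h1
    · obtain ⟨i, hi, e⟩ := h.exists_visits_eq h1 ht.1 vk.symm
      exact ⟨i, hi, Or.inr (by rw [e]; simp)⟩
    · obtain ⟨i, hi, e⟩ := h.exists_visits_eq h1 hlt vk
      exact ⟨i, hi, Or.inl (by rw [e]; simp)⟩
  refine h.endTime_injOn hk' hk ?_
  rcases hkt with ⟨rfl, e2⟩ | ⟨i, hi, hkt⟩ | ⟨h0, e2, hno⟩
  · rw [e2]
    by_contra hne
    have hlt := lt_of_le_of_ne hle hne
    have := h.walk_injOn h.length_pos hlt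
      (h.eq_of_blackBoundary h.blackBoundary_zero (h.face_walk _) vk)
    omega
  · obtain ⟨a1, a2, a3, a4, a5, a6, a7, a8⟩ := h.visits_spec i hi
    have hcw := h.cur_visits_ne hi
    have ht0 : 0 < t := by omega
    have hlt : h.endTime k' < 2 * b * d := lt_of_le_of_ne hle fun e => by
      have := hroot e; omega
    -- If the next side ended at `t`, the same face would be met just before and at `t`; but the
    -- face changes at both visits of a pair.
    have hne : h.endTime k' ≠ t := by
      intro e3
      have h1 := h.cur_endTime_pred hk'
      rw [e3, ck] at h1
      rcases hkt with ⟨e4, -⟩ | ⟨e4, -⟩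
      · rw [e4, ← a7, a5] at h1
        exact hcw h1
      · rw [e4, a6] at h1
        exact hcw h1.symm
    obtain ⟨i', hi', hp⟩ := hpair hlt hne
    obtain ⟨b1, b2, b3, b4, -⟩ := h.visits_spec i' hi'
    have hc : C.colour (C.walk x (h.visits i').1) = C.colour (C.walk x (h.visits i).1) := by
      rcases hp with ⟨e4, -⟩ | ⟨e4, -⟩ <;> rcases hkt with ⟨e5, -⟩ | ⟨e5, -⟩
      · rw [← e4, e5]
      · rw [← e4, e5, h.colour_congr a4]
      · rw [h.colour_congr b4, ← e4, e5]
      · rw [h.colour_congr b4, ← e4, e5, h.colour_congr a4]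
    have := h.visits_eq_of_colour hi' hi hc
    subst this
    omega
  · have hlt : h.endTime k' < 2 * b * d := lt_of_le_of_ne hle fun e => by
      have := hroot e; omega
    rw [e2]
    by_contra hne
    obtain ⟨i, hi, hp⟩ := hpair hlt hne
    have := hno i hi
    omega

/-- A marked pair lies at a double vertex, so it is a pair of visits, and the face entered at the
first visit gives its label. Hence the choice made in `boundaryPath` is unique. -/
theorem isMarkedPairAt_iff {i : Fin ℓ} {p : ℕ × ℕ} :
    C.IsMarkedPairAt x i p ↔ i ≠ h.cur 0 ∧ h.visits i = p := by
  constructor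
  · rintro ⟨h1, h2, h3, -, h5⟩
    rw [h.boundaryLength_eq] at h2
    obtain ⟨k, hk, e⟩ := h.exists_visits_eq h1 h2 h3
    have hw := (h.white_of_vertex_eq (h1.trans h2) h2 h1.ne h3).1
    have h6 : h.cur p.1 = i := by rw [h.cur_eq_iff_face, h.whiteDart_of_white hw, h5]
    have h7 := (h.visits_spec k hk).2.2.2.2.1
    rw [e, h6] at h7
    exact ⟨h7 ▸ hk, h7 ▸ e⟩
  · rintro ⟨hi, rfl⟩
    obtain ⟨a1, a2, a3, a4, a5, a6, a7, a8⟩ := h.visits_spec i hi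
    obtain ⟨w1, w2⟩ := h.white_of_vertex_eq (a2.trans a3) a3 a2.ne a4
    refine ⟨a2, by rwa [h.boundaryLength_eq], a4, ?_, ?_⟩
    · refine ⟨C.next (h.whiteDart (h.visits i).1), C.next (h.whiteDart (h.visits i).2),
        h.cur (h.visits i).1, h.cur (h.visits i).2, ?_, ?_, ?_, ?_, ?_⟩
      · rw [h.cactus.surface.vertex_next, h.vertex_opp_whiteDart ⟨a2.trans a3, Or.inl w1⟩]
      · rw [h.cactus.surface.vertex_next, h.vertex_opp_whiteDart ⟨a3, Or.inl w2⟩, a4]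
      · rw [a5]
        exact (h.cur_visits_ne hi).symm
      · rw [h.face_next, h.face_whiteDart]
      · rw [h.face_next, h.face_whiteDart]
    · rw [← h.whiteDart_of_white w1, h.face_whiteDart, a5]

theorem boundaryPath_pair (i : Fin ℓ) : (C.boundaryPath x).pair i = h.visits i := by
  classical
  by_cases hi : i = h.cur 0
  · have hno : ¬ ∃ p, C.IsMarkedPairAt x i p := fun ⟨p, hp⟩ => (h.isMarkedPairAt_iff.1 hp).1 hi
    simp only [boundaryPath, dif_neg hno, h.boundaryLength_eq]
    rw [hi, h.visits_root]
  · have hex : ∃ p, C.IsMarkedPairAt x i p := ⟨_, h.isMarkedPairAt_iff.2 ⟨hi, rfl⟩⟩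
    simp only [boundaryPath, dif_pos hex]
    exact (h.isMarkedPairAt_iff.1 hex.choose_spec).2.symm

/-- The innermost pair around a time is that of the white face met then, by the corresponding fact
for tours. -/
theorem inEssential_iff {i : Fin ℓ} {t : ℕ} (ht : t < 2 * b * d) :
    (C.boundaryPath x).InEssential i t ↔ h.cur t = i := by
  rw [h.isTour.cur_eq_iff ht]
  simp only [MarkedPath.InEssential, MarkedPath.InInterval, h.boundaryPath_pair]

theorem inEssential_lt {i : Fin ℓ} {t : ℕ} (ht : (C.boundaryPath x).InEssential i t) :
    t < 2 * b * d := by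
  have h1 := ht.1.2
  rw [h.boundaryPath_pair] at h1
  exact h1.trans_le (h.isTour.w_le i)

theorem card_blockTime_cur (i : Fin ℓ) :
    Nat.card {j // h.cur (h.blockTime j) = i} = μ i := by
  rw [← h.card_internal_white i]
  refine Nat.card_congr (Equiv.ofBijective
    (fun j => ⟨C.opp (h.blackSide j.1), ?_, j.1, by rw [h.opp_opp, h.face_blackSide]⟩) ⟨?_, ?_⟩)
  · rw [← h.whiteDart_blockTime, h.face_whiteDart, j.2]
  · rintro ⟨j, hj⟩ ⟨k, hk⟩ e
    simp only [Subtype.mk.injEq] at e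
    have := h.blackSide_injective (h.cactus.surface.opp_bijective.1 e)
    subst this; rfl
  · rintro ⟨y, hy, j, hj⟩
    have e : C.opp y = h.blackSide j := h.eq_blackSide hj (by rw [h.opp_opp, hy]; simp)
    have e' : C.opp (h.blackSide j) = y := by rw [← e, h.opp_opp]
    refine ⟨⟨j, ?_⟩, by simp only [e']⟩
    rw [h.cur_eq_iff_face, h.whiteDart_blockTime, e', hy]

/-- Of the (b + 1)k sides of a white face of degree k, k are internal; the other bk sides are
traversed by the down-steps. -/
theorem ncard_down (i : Fin ℓ) :
    {k | (C.boundaryPath x).InEssential i k ∧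
      (C.boundaryPath x).steps[k]? = some DyckStep.D}.ncard = b * μ i := by
  have hfin := h.cactus.surface.finite
  have h1 : Nat.card {y // C.face y = FaceName.white i ∧ C.face (C.opp y) = FaceName.boundary} +
      Nat.card {y // C.face y = FaceName.white i ∧ ∃ j, C.face (C.opp y) = FaceName.black j} =
      Nat.card {y // C.face y = FaceName.white i} := by
    change Set.ncard {y | C.face y = FaceName.white i ∧ C.face (C.opp y) = FaceName.boundary} +
      Set.ncard {y | C.face y = FaceName.white i ∧ ∃ j, C.face (C.opp y) = FaceName.black j} =
      Set.ncard {y | C.face y = FaceName.white i}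
    rw [← Set.ncard_union_eq _ (Set.toFinite _) (Set.toFinite _)]
    · congr 1
      ext y
      constructor
      · rintro (hy | hy)
        exacts [hy.1, hy.1]
      · intro hy
        rcases h.white_cases hy with hb | hb
        exacts [Or.inl ⟨hy, hb⟩, Or.inr ⟨hy, hb⟩]
    · rw [Set.disjoint_left]
      rintro y ⟨-, hy⟩ ⟨-, j, hj⟩
      rw [hy] at hj; cases hj
  rw [h.card_internal_white, h.cactus.white_degree] at h1
  have h2 : Nat.card {y // C.face y = FaceName.white i ∧ C.face (C.opp y) = FaceName.boundary} =
      b * μ i := by linarith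
  rw [← h2, ← Nat.card_coe_set_eq]
  refine Nat.card_congr (Equiv.ofBijective (fun k => ⟨C.opp (C.walk x k.1), ?_, ?_⟩) ⟨?_, ?_⟩)
  · have hw := (h.steps_eq_D_iff.1 k.2.2)
    rw [← h.whiteDart_of_white hw.2, h.face_whiteDart, (h.inEssential_iff hw.1).1 k.2.1]
  · rw [h.opp_opp, h.face_walk]
  · rintro ⟨k, hk1, hk2⟩ ⟨l, hl1, hl2⟩ e
    simp only [Subtype.mk.injEq] at e ⊢
    exact h.walk_injOn (h.inEssential_lt hk1) (h.inEssential_lt hl1)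
      (h.cactus.surface.opp_bijective.1 e)
  · rintro ⟨y, hy, hb⟩
    obtain ⟨t, ht, e⟩ := h.exists_walk hb
    have e' : C.opp (C.walk x t) = y := by rw [e, h.opp_opp]
    have hw : C.IsWhiteBoundary (C.walk x t) := ⟨h.face_walk t, i, by rw [e', hy]⟩
    refine ⟨⟨t, (h.inEssential_iff ht).2 ?_, h.steps_eq_D_iff.2 ⟨ht, hw⟩⟩, by simp only [e']⟩
    rw [h.cur_eq_iff_face, h.whiteDart_of_white hw, e', hy]

theorem ncard_up (i : Fin ℓ) :
    {k | (C.boundaryPath x).InEssential i k ∧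
      (C.boundaryPath x).steps[k]? = some DyckStep.U}.ncard = b * μ i := by
  rw [h.hasBlocks.ncard_up, ← h.card_blockTime_cur i]
  · congr 1
    refine Nat.card_congr (Equiv.subtypeEquivRight fun j => ?_)
    exact h.inEssential_iff (h.blockTime_lt j)
  · intro j t h1 h2
    have := h.blockTime_add_le j
    rw [h.inEssential_iff (by omega), h.inEssential_iff (h.blockTime_lt j), h.cur_block h1 h2]

/-- A return step ends at label 0, which occurs only at the root; so it is the last step. -/
theorem isPrimitivePath : IsPrimitivePath (C.boundaryPath x).steps := by
  have hN := h.length_pos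
  refine ⟨2 * b * d - 1, ⟨?_, ?_⟩, ?_⟩
  · refine h.steps_eq_D_iff.2 ⟨by omega, (h.boundary_cases (h.face_walk _)).resolve_left
      fun hb => ?_⟩
    have := h.label_walk_succ_of_black hb
    rw [Nat.sub_add_cancel hN, h.walk_length, h.root_label] at this
    omega
  · rw [h.height_eq (by omega)]
    rcases h.boundary_cases (h.face_walk (x := x) (2 * b * d - 1)) with hb | hw
    · have := h.label_walk_succ_of_black hb
      rw [Nat.sub_add_cancel hN, h.walk_length, h.root_label] at this
      omega
    · rw [h.label_walk_of_white hw, Nat.sub_add_cancel hN, h.walk_length, h.root_label]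
      rfl
  · rintro k ⟨hk1, hk2⟩
    obtain ⟨hk, hw⟩ := h.steps_eq_D_iff.1 hk1
    rw [h.height_eq hk.le, h.label_walk_of_white hw] at hk2
    by_contra hne
    have := h.eq_zero_of_label_eq_zero (t := k + 1) (by omega) (by omega)
    omega

theorem isBDyckPath : IsBDyckPath b (C.boundaryPath x).steps := by
  have hnn : ∀ t, 0 ≤ pathHeight (C.boundaryPath x).steps t := by
    intro t
    rcases le_total t (2 * b * d) with ht | ht
    · rw [h.height_eq ht]; positivity
    · have : pathHeight (C.boundaryPath x).steps t =
          pathHeight (C.boundaryPath x).steps (2 * b * d) := by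
        simp only [pathHeight]
        rw [List.take_of_length_le (by rw [h.steps_length]; exact ht),
          List.take_of_length_le (by rw [h.steps_length])]
      rw [this, h.height_eq le_rfl]; positivity
  have h0 := h.height_eq le_rfl
  rw [h.walk_length, h.root_label, pathHeight,
    List.take_of_length_le (by rw [h.steps_length])] at h0
  refine ⟨⟨⟨(C.boundaryPath x).steps, by push_cast at h0; omega, fun t => ?_⟩, rfl⟩,
    fun k r hkr => h.hasBlocks.dvd_of_maximalIncrease h.b_pos hkr⟩
  have := hnn t
  rw [pathHeight] at this
  omega

theorem visits_ne {i : Fin ℓ} (hi : h.visits i ≠ (0, 2 * b * d)) : i ≠ h.cur 0 := by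
  rintro rfl
  exact hi h.visits_root

end

variable {ℓ d : ℕ} {μ : Fin ℓ → ℕ} {C : ColouredMap ℓ d (ℓ + d - 2)} {δ : C.Dart → ℕ} {x : C.Dart}

theorem isSingleHurwitz (h : C.IsRootedCactus μ δ x) :
    (C.boundaryPath x).IsSingleHurwitz μ where
  bDyck := h.isBDyckPath
  length_eq := h.steps_length
  primitive := h.isPrimitivePath
  dist_injective i j e := by
    rw [h.boundaryPath_dist, h.boundaryPath_dist] at e
    exact h.hasBlocks.injective h.b_pos e
  dist_range := by
    ext k
    simp only [Set.mem_range, h.boundaryPath_dist]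
    exact (h.hasBlocks.isDistinguishedVertex_iff h.b_pos k).symm
  pair_le i := by
    rw [h.boundaryPath_pair]
    exact (h.isTour.v_lt_w i).le
  pair_le_length i := by
    rw [h.boundaryPath_pair, h.steps_length]
    exact h.isTour.w_le i
  pair_height i := by
    rw [h.boundaryPath_pair]
    have h1 := h.isTour.v_lt_w i
    have h2 := h.isTour.w_le i
    rw [h.height_eq (by omega), h.height_eq (by omega)]
    by_cases hi : i = h.cur 0
    · rw [hi, h.visits_root, h.walk_length]
      rfl
    · rw [h.coherent _ _ (h.face_walk _) (h.face_walk _) (h.visits_spec i hi).2.2.2.1]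
  pair_down i hi := by
    rw [h.boundaryPath_pair] at hi ⊢
    obtain ⟨a1, a2, a3, a4, -⟩ := h.visits_spec i (h.visits_ne hi)
    obtain ⟨w1, w2⟩ := h.white_of_vertex_eq (a2.trans a3) a3 a2.ne a4
    exact ⟨Or.inl (h.steps_eq_D_iff.2 ⟨a2.trans a3, w1⟩), Or.inl (h.steps_eq_D_iff.2 ⟨a3, w2⟩)⟩
  ends_marked := ⟨h.cur 0, by rw [h.boundaryPath_pair, h.visits_root]⟩
  pair_residues := by
    rw [← Set.image_univ, Set.ncard_image_of_injective, Set.ncard_univ, Nat.card_fin]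
    intro i k e
    simp only [h.boundaryPath_pair] at e
    rw [h.height_colour ((h.isTour.v_lt_w i).le.trans (h.isTour.w_le i)),
      h.height_colour ((h.isTour.v_lt_w k).le.trans (h.isTour.w_le k))] at e
    -- The root pair has the colour of the distinguished vertex at time 0, which no other pair
    -- shares.
    obtain ⟨j, hj⟩ := h.exists_blockTime_eq_zero
    by_cases hi : i = h.cur 0 <;> by_cases hk : k = h.cur 0
    · rw [hi, hk]
    · rw [hi, h.visits_root, ← hj] at e
      exact absurd e.symm (h.colour_visits_ne k hk j)
    · rw [hk, h.visits_root, ← hj] at e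
      exact absurd e (h.colour_visits_ne i hi j)
    · exact h.visits_eq_of_colour hi hk e
  dist_residues := by
    rw [← Set.image_univ, Set.ncard_image_of_injective, Set.ncard_univ, Nat.card_fin]
    intro i k e
    simp only [h.boundaryPath_dist, h.height_colour (h.blockTime_lt _).le] at e
    exact h.colour_blockTime_injective e
  residues_disjoint i j hi _ := by
    rw [h.boundaryPath_pair] at hi ⊢
    rw [h.boundaryPath_dist, h.height_colour (h.blockTime_lt j).le,
      h.height_colour ((h.isTour.v_lt_w i).le.trans (h.isTour.w_le i))]
    refine h.colour_visits_ne i ?_ j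
    rintro rfl
    rw [h.visits_root, pathHeight_zero] at hi
    exact hi rfl
  noncrossing i k h1 h2 := by
    rw [h.boundaryPath_pair] at h1 h2 ⊢
    rw [h.boundaryPath_pair] at *
    exact h.isTour.w_le_w h1 h2
  degree_up := h.ncard_up
  degree_down := h.ncard_down

end IsRootedCactus

end ColouredMap

/-! ### Single Hurwitz paths and the cyclic order of their white times -/

namespace MarkedPath

variable {ℓ d : ℕ}

/-- A restatement of the properties of single Hurwitz Dyck paths: the pair labelled `root` is formed
by the ends of the path, and the up-steps form blocks. -/
structure IsHurwitzPath (b : ℕ) (μ : Fin ℓ → ℕ) (root : Fin ℓ) (P : MarkedPath ℓ d) : Prop where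
  b_add_two : b + 2 = ℓ + d
  b_pos : 0 < b
  two_le : 2 ≤ d
  pos : ∀ i, 0 < μ i
  sum_eq : ∑ i, μ i = d
  length_eq : P.steps.length = 2 * b * d
  blocks : HasBlocks b P.steps P.dist
  height_nonneg : ∀ t, 0 ≤ pathHeight P.steps t
  height_end : pathHeight P.steps (2 * b * d) = 0
  pair_root : P.pair root = (0, 2 * b * d)
  v_pos : ∀ i, i ≠ root → 0 < (P.pair i).1
  v_lt_w : ∀ i, (P.pair i).1 < (P.pair i).2
  w_lt : ∀ i, i ≠ root → (P.pair i).2 < 2 * b * d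
  down_v : ∀ i, i ≠ root → P.steps[(P.pair i).1]? = some DyckStep.D
  down_w : ∀ i, i ≠ root → P.steps[(P.pair i).2]? = some DyckStep.D
  height_pair : ∀ i, pathHeight P.steps (P.pair i).1 = pathHeight P.steps (P.pair i).2
  pair_residues : ∀ i k, (pathHeight P.steps (P.pair i).1 : ZMod (b + 1)) =
    pathHeight P.steps (P.pair k).1 → i = k
  pair_ne_dist : ∀ i j, i ≠ root → (pathHeight P.steps (P.pair i).1 : ZMod (b + 1)) ≠
    pathHeight P.steps (P.dist j)
  dist_residues : ∀ i j, (pathHeight P.steps (P.dist i) : ZMod (b + 1)) =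
    pathHeight P.steps (P.dist j) → i = j
  noncrossing : ∀ i i', (P.pair i).1 ≤ (P.pair i').1 → (P.pair i').1 ≤ (P.pair i).2 →
    (P.pair i').2 ≤ (P.pair i).2
  degree_up : ∀ i, {k | P.InEssential i k ∧ P.steps[k]? = some DyckStep.U}.ncard = b * μ i
  degree_down : ∀ i, {k | P.InEssential i k ∧ P.steps[k]? = some DyckStep.D}.ncard = b * μ i

theorem injective_of_ncard_range {α : Type*} {n : ℕ} {f : Fin n → α}
    (h : (Set.range f).ncard = n) : Function.Injective f := by
  rw [← Set.image_univ] at h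
  have := (Set.ncard_image_iff (s := Set.univ) (f := f) Set.finite_univ).1
    (by rw [h, Set.ncard_univ, Nat.card_fin])
  exact Set.injOn_univ.1 this

/-- The main gain is that both vertices of a pair other than the root are starts of down-steps, not
just endpoints: the disjointness of residues rules out an up-step after them. -/
theorem IsSingleHurwitz.exists_isHurwitzPath {μ : Fin ℓ → ℕ} {P : MarkedPath ℓ d}
    (h : P.IsSingleHurwitz μ) (hd : 2 ≤ d) (hμ : ∀ i, 0 < μ i) (hsum : ∑ i, μ i = d) :
    ∃ root, P.IsHurwitzPath (ℓ + d - 2) μ root := by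
  obtain ⟨root, hroot⟩ := h.ends_marked
  have hb : 0 < ℓ + d - 2 := by have := root.pos; omega
  have hb2 : ℓ + d - 2 + 2 = ℓ + d := by omega
  have hlen := h.length_eq
  have hdown := h.pair_down
  have hres := injective_of_ncard_range h.pair_residues
  have hdres := injective_of_ncard_range h.dist_residues
  have hdisj := h.residues_disjoint
  have hup := h.degree_up
  have hdn := h.degree_down
  have hbd := h.bDyck
  have hdr := h.dist_range
  generalize hbb : ℓ + d - 2 = b at *
  obtain ⟨⟨p, hp⟩, hinc⟩ := hbd
  have hblocks : HasBlocks b P.steps P.dist :=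
    hasBlocks_of_dvd_maximalIncrease hinc hb h.dist_injective hdr
  have hnn : ∀ t, 0 ≤ pathHeight P.steps t := by
    intro t
    have := p.count_D_le_count_U t
    rw [hp] at this
    simp only [pathHeight]; omega
  have hend : pathHeight P.steps (2 * b * d) = 0 := by
    have := p.count_U_eq_count_D
    rw [hp] at this
    rw [pathHeight, List.take_of_length_le hlen.le, this, sub_self]
  -- A degenerate pair would contain no up-steps, contrary to its positive degree.
  have hv : ∀ i, (P.pair i).1 < (P.pair i).2 := by
    intro i
    refine lt_of_le_of_ne (h.pair_le i) fun e => ?_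
    have h1 := hup i
    have h2 : {k | P.InEssential i k ∧ P.steps[k]? = some DyckStep.U} = ∅ := by
      ext k
      simp only [Set.mem_ofPred_eq, Set.mem_empty_iff_false, iff_false]
      rintro ⟨⟨⟨h3, h4⟩, -⟩, -⟩
      omega
    rw [h2, Set.ncard_empty] at h1
    have := Nat.mul_pos hb (hμ i)
    omega
  -- Height 0 is the residue already taken by the root pair.
  have hne0 : ∀ i, i ≠ root → pathHeight P.steps (P.pair i).1 ≠ 0 := by
    intro i hi e
    refine hi (hres ?_)
    simp only [e, hroot, pathHeight_zero]
  have hnd : ∀ i j, i ≠ root → (pathHeight P.steps (P.pair i).1 : ZMod (b + 1)) ≠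
      pathHeight P.steps (P.dist j) := by
    intro i j hi e
    by_cases h0 : pathHeight P.steps (P.dist j) = 0
    · refine hi (hres ?_)
      simp only [e, h0, hroot, pathHeight_zero]
    · exact hdisj i j (hne0 i hi) h0 e
  have hroot' : ∀ i, i ≠ root → P.pair i ≠ (0, 2 * b * d) := by
    intro i hi e
    refine hi (hres ?_)
    simp only [e, hroot]
  -- An up-step directly after a down-step begins a block, so the vertex between them is
  -- distinguished and cannot have the height of such a pair.
  have hdownk : ∀ i k, i ≠ root → k < 2 * b * d → IsDownStepVertex P.steps k →
      pathHeight P.steps (P.pair i).1 = pathHeight P.steps k →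
      P.steps[k]? = some DyckStep.D := by
    rintro i k hi hk (h1 | ⟨t, rfl, h1⟩) e
    · exact h1
    · rw [getElem?_eq_D_iff]
      refine ⟨by omega, fun h2 => ?_⟩
      obtain ⟨j, h3, h4⟩ := (hblocks.up_iff _).1 h2
      rcases h3.eq_or_lt with h3 | h3
      · exact hnd i j hi (by rw [e, h3])
      · have := hblocks.up (j := j) (t := t) (by omega) (by omega)
        rw [h1] at this
        cases this
  have hw : ∀ i, i ≠ root → (P.pair i).2 < 2 * b * d := by
    intro i hi
    refine lt_of_le_of_ne (hlen ▸ h.pair_le_length i) fun e => hne0 i hi ?_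
    rw [h.pair_height, e, hend]
  refine ⟨root, hb2, hb, hd, hμ, hsum, hlen, hblocks, hnn, hend, hroot, fun i hi => ?_, hv, hw,
    fun i hi => ?_, fun i hi => ?_, h.pair_height, fun i k e => hres e, hnd, fun i j e => hdres e,
    h.noncrossing, hup, hdn⟩
  · rw [Nat.pos_iff_ne_zero]
    intro e
    exact hne0 i hi (by rw [e, pathHeight_zero])
  · exact hdownk i _ hi ((hv i).trans (hw i hi)) (hdown i (hroot' i hi)).1 rfl
  · exact hdownk i _ hi (hw i hi) (hdown i (hroot' i hi)).2 (h.pair_height i)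

/-- The time at which the edge of a white polygon that is met at time `k` is left. -/
noncomputable def endTime (P : MarkedPath ℓ d) (b k : ℕ) : ℕ :=
  open Classical in if k ∈ Set.range P.dist then k + b else k + 1

/-- The edge of a white polygon traversed at time `t` follows the one traversed at time `k`. -/
def Follows (P : MarkedPath ℓ d) (b : ℕ) (root : Fin ℓ) (k t : ℕ) : Prop :=
  (t = 0 ∧ P.endTime b k = 2 * b * d) ∨
    (∃ i, i ≠ root ∧ ((t = (P.pair i).1 ∧ P.endTime b k = (P.pair i).2) ∨
      (t = (P.pair i).2 ∧ P.endTime b k = (P.pair i).1))) ∨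
    (0 < t ∧ P.endTime b k = t ∧ ∀ i, i ≠ root → t ≠ (P.pair i).1 ∧ t ≠ (P.pair i).2)

theorem inEssential_congr {P : MarkedPath ℓ d} {s t : ℕ}
    (h : ∀ i, P.InInterval i s ↔ P.InInterval i t) (i : Fin ℓ) :
    P.InEssential i s ↔ P.InEssential i t := by
  simp only [InEssential, h]

namespace IsHurwitzPath

variable {b : ℕ} {μ : Fin ℓ → ℕ} {root : Fin ℓ} {P : MarkedPath ℓ d}
  (h : P.IsHurwitzPath b μ root)
include h

theorem length_pos : 0 < 2 * b * d := by
  have := h.b_pos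
  have := h.two_le
  positivity

theorem w_le (i : Fin ℓ) : (P.pair i).2 ≤ 2 * b * d := by
  by_cases hi : i = root
  · rw [hi, h.pair_root]
  · exact (h.w_lt i hi).le

theorem eq_of_v_eq_v {i k : Fin ℓ} (e : (P.pair i).1 = (P.pair k).1) : i = k :=
  h.pair_residues i k (by rw [e])

theorem eq_of_w_eq_w {i k : Fin ℓ} (e : (P.pair i).2 = (P.pair k).2) : i = k :=
  h.pair_residues i k (by rw [h.height_pair, h.height_pair, e])

theorem v_ne_w (i k : Fin ℓ) : (P.pair i).1 ≠ (P.pair k).2 := by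
  intro e
  have : i = k := h.pair_residues i k (by rw [h.height_pair k, e])
  subst this
  exact (h.v_lt_w i).ne e

theorem inInterval_root {t : ℕ} (ht : t < 2 * b * d) : P.InInterval root t := by
  rw [InInterval, h.pair_root]
  exact ⟨Nat.zero_le _, ht⟩

theorem inEssential_lt {i : Fin ℓ} {t : ℕ} (ht : P.InEssential i t) : t < 2 * b * d :=
  ht.1.2.trans_le (h.w_le i)

/-- A shortest interval containing `t` contains no other interval around `t`, because pairs with the
same first vertex coincide. -/
theorem exists_inEssential {t : ℕ} (ht : t < 2 * b * d) : ∃ i, P.InEssential i t := by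
  classical
  obtain ⟨i, hi, hmin⟩ := Finset.exists_min_image
    (Finset.univ.filter fun i => P.InInterval i t) (fun i => (P.pair i).2 - (P.pair i).1)
    ⟨root, by simp [h.inInterval_root ht]⟩
  simp only [Finset.mem_filter, Finset.mem_univ, true_and] at hi hmin
  refine ⟨i, hi, fun k hki h1 h2 hk => hki (h.eq_of_v_eq_v ?_)⟩
  have := hmin k hk
  have := h.v_lt_w k
  have := h.v_lt_w i
  omega

/-- Two intervals around `t` are nested by noncrossing, and the outer one is then not essential at
`t`. -/
theorem inEssential_unique {i k : Fin ℓ} {t : ℕ} (hi : P.InEssential i t)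
    (hk : P.InEssential k t) : i = k := by
  have key : ∀ i k, P.InEssential i t → P.InEssential k t → (P.pair i).1 ≤ (P.pair k).1 →
      i = k := by
    intro i k hi hk hik
    by_contra hne
    exact hi.2 k (Ne.symm hne) hik
      (h.noncrossing i k hik (hk.1.1.trans hi.1.2.le)) hk.1
  rcases le_total (P.pair i).1 (P.pair k).1 with hik | hik
  · exact key i k hi hk hik
  · exact (key k i hk hi hik).symm

theorem not_down_of_block {j : Fin d} {t : ℕ} (h1 : P.dist j ≤ t) (h2 : t < P.dist j + b) :
    P.steps[t]? ≠ some DyckStep.D := by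
  rw [h.blocks.up h1 h2]
  simp

theorem v_not_interior {i : Fin ℓ} {j : Fin d} (h1 : P.dist j < (P.pair i).1) :
    P.dist j + b ≤ (P.pair i).1 := by
  by_contra hcon
  by_cases hi : i = root
  · rw [hi, h.pair_root] at h1
    omega
  · exact h.not_down_of_block h1.le (by omega) (h.down_v i hi)

theorem dist_add_le (j : Fin d) : P.dist j + b ≤ 2 * b * d := by
  have := h.b_pos
  have := h.blocks.lt_length (j := j) (t := P.dist j + b - 1) (by omega) (by omega)
  rw [h.length_eq] at this
  omega

theorem w_not_interior {i : Fin ℓ} {j : Fin d} (h1 : P.dist j < (P.pair i).2) :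
    P.dist j + b ≤ (P.pair i).2 := by
  by_contra hcon
  by_cases hi : i = root
  · rw [hi, h.pair_root] at hcon
    exact hcon (h.dist_add_le j)
  · exact h.not_down_of_block h1.le (by omega) (h.down_w i hi)

/-- Inner pairs begin and end at down-steps, so no interval begins or ends strictly inside a block.
-/
theorem inEssential_block {j : Fin d} {t : ℕ} (h1 : P.dist j ≤ t) (h2 : t < P.dist j + b)
    (i : Fin ℓ) : P.InEssential i t ↔ P.InEssential i (P.dist j) := by
  refine inEssential_congr (fun k => ?_) i
  have hv := fun hlt => h.v_not_interior (i := k) (j := j) hlt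
  have hw := fun hlt => h.w_not_interior (i := k) (j := j) hlt
  simp only [InInterval]
  omega

omit h in
theorem endTime_dist (j : Fin d) : P.endTime b (P.dist j) = P.dist j + b :=
  if_pos ⟨j, rfl⟩

theorem endTime_of_down {t : ℕ} (ht : P.steps[t]? = some DyckStep.D) :
    P.endTime b t = t + 1 := by
  refine if_neg ?_
  rintro ⟨j, rfl⟩
  have := h.b_pos
  exact h.not_down_of_block le_rfl (by omega) ht

theorem lt_endTime (t : ℕ) : t < P.endTime b t := by
  have := h.b_pos
  unfold endTime
  split_ifs <;> omega

theorem whiteTime_lt {t : ℕ} (ht : P.IsWhiteTime t) : t < 2 * b * d := by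
  rcases ht with ht | ⟨j, rfl⟩
  · have := (getElem?_eq_D_iff.1 ht).1
    rwa [h.length_eq] at this
  · have := h.dist_add_le j
    have := h.b_pos
    omega

theorem endTime_le {t : ℕ} (ht : P.IsWhiteTime t) : P.endTime b t ≤ 2 * b * d := by
  have := h.whiteTime_lt ht
  rcases ht with ht | ⟨j, rfl⟩
  · rw [h.endTime_of_down ht]; omega
  · rw [endTime_dist]; exact h.dist_add_le j

/-- Nothing happens while an edge is traversed. -/
theorem not_whiteTime_between {k u : ℕ} (hk : P.IsWhiteTime k) (h1 : k < u)
    (h2 : u < P.endTime b k) : ¬ P.IsWhiteTime u := by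
  rcases hk with hk | ⟨j, rfl⟩
  · rw [h.endTime_of_down hk] at h2
    omega
  · rw [endTime_dist] at h2
    rintro (hu | ⟨i, rfl⟩)
    · exact h.not_down_of_block h1.le h2 hu
    · have := h.b_pos
      have := h.blocks.disjoint j i (P.dist i) h1.le h2 le_rfl (by omega)
      subst this
      omega

theorem v_not_between {k : ℕ} (hk : P.IsWhiteTime k) {i : Fin ℓ} (h1 : k < (P.pair i).1) :
    P.endTime b k ≤ (P.pair i).1 := by
  by_contra hcon
  by_cases hi : i = root
  · rw [hi, h.pair_root] at h1
    omega
  · exact h.not_whiteTime_between hk h1 (by omega) (Or.inl (h.down_v i hi))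

theorem w_not_between {k : ℕ} (hk : P.IsWhiteTime k) {i : Fin ℓ} (h1 : k < (P.pair i).2) :
    P.endTime b k ≤ (P.pair i).2 := by
  by_contra hcon
  by_cases hi : i = root
  · rw [hi, h.pair_root] at hcon
    exact hcon (h.endTime_le hk)
  · exact h.not_whiteTime_between hk h1 (by omega) (Or.inl (h.down_w i hi))

theorem whiteTime_or_interior {t : ℕ} (ht : t < 2 * b * d) :
    P.IsWhiteTime t ∨ ∃ j, P.dist j < t ∧ t < P.dist j + b := by
  by_cases hup : P.steps[t]? = some DyckStep.U
  · obtain ⟨j, h1, h2⟩ := (h.blocks.up_iff t).1 hup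
    rcases h1.eq_or_lt with h1 | h1
    · exact Or.inl (Or.inr ⟨j, h1⟩)
    · exact Or.inr ⟨j, h1, h2⟩
  · exact Or.inl (Or.inl (getElem?_eq_D_iff.2 ⟨by rw [h.length_eq]; exact ht, hup⟩))

theorem whiteTime_endTime {k : ℕ} (hk : P.IsWhiteTime k) (hlt : P.endTime b k < 2 * b * d) :
    P.IsWhiteTime (P.endTime b k) := by
  refine (h.whiteTime_or_interior hlt).resolve_right ?_
  rintro ⟨j, h1, h2⟩
  rcases hk with hk | ⟨i, rfl⟩
  · rw [h.endTime_of_down hk] at h1 h2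
    exact h.not_down_of_block (j := j) (by omega) (by omega) hk
  · have := h.b_pos
    rw [endTime_dist] at h1 h2
    have := h.blocks.disjoint i j (P.dist i + b - 1) (by omega) (by omega) (by omega) (by omega)
    subst this
    omega

/-- The edges of white polygons, traversed in time, tile the whole path without gaps: single
down-steps and blocks of up-steps. -/
theorem exists_endTime_eq {t : ℕ} (h0 : 0 < t) (ht : t = 2 * b * d ∨ P.IsWhiteTime t) :
    ∃ k, P.IsWhiteTime k ∧ P.endTime b k = t := by
  have hle : t ≤ 2 * b * d := ht.elim (·.le) fun ht => (h.whiteTime_lt ht).le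
  have hb := h.b_pos
  have hblock : ∀ j, P.dist j ≤ t - 1 → t - 1 < P.dist j + b → P.dist j + b = t := by
    intro j h1 h2
    by_contra hne
    have := h.dist_add_le j
    rcases ht with rfl | ht
    · omega
    · refine h.not_whiteTime_between (k := P.dist j) (Or.inr ⟨j, rfl⟩) (u := t) (by omega) ?_ ht
      rw [endTime_dist]; omega
  rcases h.whiteTime_or_interior (t := t - 1) (by omega) with (h1 | ⟨j, h1⟩) | ⟨j, h1, h2⟩
  · exact ⟨t - 1, Or.inl h1, by rw [h.endTime_of_down h1]; omega⟩
  · exact ⟨P.dist j, Or.inr ⟨j, rfl⟩, by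
      rw [endTime_dist]; exact hblock j (by omega) (by omega)⟩
  · exact ⟨P.dist j, Or.inr ⟨j, rfl⟩, by
      rw [endTime_dist]; exact hblock j (by omega) (by omega)⟩

theorem exists_dist_eq_zero : ∃ j, P.dist j = 0 := by
  have hup : P.steps[0]? = some DyckStep.U := by
    by_contra hcon
    have hD : P.steps[0]? = some DyckStep.D :=
      getElem?_eq_D_iff.2 ⟨by rw [h.length_eq]; exact h.length_pos, hcon⟩
    have h1 := pathHeight_succ_of_down hD
    have h2 := h.height_nonneg (0 + 1)
    rw [h1, pathHeight_zero] at h2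
    omega
  obtain ⟨j, h1, -⟩ := (h.blocks.up_iff 0).1 hup
  exact ⟨j, by omega⟩

theorem whiteTime_zero : P.IsWhiteTime 0 := by
  obtain ⟨j, hj⟩ := h.exists_dist_eq_zero
  exact Or.inr ⟨j, hj⟩

/-- At a marked pair the two edges that end there are interchanged: the edge met at one vertex of
the pair follows the edge that ends at the other vertex. Elsewhere an edge follows the one that has
just ended. -/
theorem exists_follows_left {t : ℕ} (ht : P.IsWhiteTime t) :
    ∃ k, P.IsWhiteTime k ∧ P.Follows b root k t := by
  by_cases h0 : t = 0
  · obtain ⟨k, hk, e⟩ := h.exists_endTime_eq h.length_pos (Or.inl rfl)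
    exact ⟨k, hk, Or.inl ⟨h0, e⟩⟩
  by_cases hv : ∃ i, i ≠ root ∧ t = (P.pair i).1
  · obtain ⟨i, hi, rfl⟩ := hv
    have := h.v_lt_w i
    obtain ⟨k, hk, e⟩ := h.exists_endTime_eq (t := (P.pair i).2) (by omega)
      (Or.inr (Or.inl (h.down_w i hi)))
    exact ⟨k, hk, Or.inr (Or.inl ⟨i, hi, Or.inl ⟨rfl, e⟩⟩)⟩
  by_cases hw : ∃ i, i ≠ root ∧ t = (P.pair i).2
  · obtain ⟨i, hi, rfl⟩ := hw
    obtain ⟨k, hk, e⟩ := h.exists_endTime_eq (h.v_pos i hi) (Or.inr (Or.inl (h.down_v i hi)))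
    exact ⟨k, hk, Or.inr (Or.inl ⟨i, hi, Or.inr ⟨rfl, e⟩⟩)⟩
  · obtain ⟨k, hk, e⟩ := h.exists_endTime_eq (Nat.pos_of_ne_zero h0) (Or.inr ht)
    exact ⟨k, hk, Or.inr (Or.inr ⟨Nat.pos_of_ne_zero h0, e, fun i hi =>
      ⟨fun e => hv ⟨i, hi, e⟩, fun e => hw ⟨i, hi, e⟩⟩⟩)⟩

theorem exists_follows_right {k : ℕ} (hk : P.IsWhiteTime k) :
    ∃ t, P.IsWhiteTime t ∧ P.Follows b root k t := by
  have hpos := h.lt_endTime k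
  by_cases hN : P.endTime b k = 2 * b * d
  · exact ⟨0, h.whiteTime_zero, Or.inl ⟨rfl, hN⟩⟩
  by_cases hv : ∃ i, i ≠ root ∧ P.endTime b k = (P.pair i).1
  · obtain ⟨i, hi, e⟩ := hv
    exact ⟨_, Or.inl (h.down_w i hi), Or.inr (Or.inl ⟨i, hi, Or.inr ⟨rfl, e⟩⟩)⟩
  by_cases hw : ∃ i, i ≠ root ∧ P.endTime b k = (P.pair i).2
  · obtain ⟨i, hi, e⟩ := hw
    exact ⟨_, Or.inl (h.down_v i hi), Or.inr (Or.inl ⟨i, hi, Or.inl ⟨rfl, e⟩⟩)⟩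
  · exact ⟨_, h.whiteTime_endTime hk (lt_of_le_of_ne (h.endTime_le hk) hN),
      Or.inr (Or.inr ⟨by omega, rfl, fun i hi =>
        ⟨fun e => hv ⟨i, hi, e⟩, fun e => hw ⟨i, hi, e⟩⟩⟩)⟩

/-- If `t` opens the interval of `m`, then `k` is the last edge before its end, and `m` is innermost
at both times. If `t` closes the interval of `m`, then `k` ends where it opens, and by noncrossing
no other interval separates `k` from `t`. In the remaining cases no interval other than that of the
root begins or ends between them. -/
theorem follows_inEssential {k t : ℕ} (hk : P.IsWhiteTime k) (ht : P.IsWhiteTime t)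
    (hkt : P.Follows b root k t)
    (i : Fin ℓ) : P.InEssential i k ↔ P.InEssential i t := by
  have hvb := fun i hi => h.v_not_between hk (i := i) hi
  have hwb := fun i hi => h.w_not_between hk (i := i) hi
  have hlt := h.lt_endTime k
  have hkN := h.whiteTime_lt hk
  rcases hkt with ⟨rfl, e⟩ | ⟨m, hm, ⟨rfl, e⟩ | ⟨rfl, e⟩⟩ | ⟨h0, e, hno⟩
  · refine inEssential_congr (fun n => ?_) i
    by_cases hn : n = root
    · rw [hn]
      exact iff_of_true (h.inInterval_root hkN) (h.inInterval_root h.length_pos)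
    · have h1 := h.w_lt n hn
      have h2 := h.v_pos n hn
      have h3 := hwb n
      simp only [InInterval]
      omega
  · have hmk : P.InEssential m k := by
      have h1 := h.v_lt_w m
      have h2 := hvb m
      refine ⟨⟨by omega, by omega⟩, fun n hn h3 h4 ⟨h5, h6⟩ => hn (h.eq_of_w_eq_w ?_)⟩
      have := hwb n h6
      omega
    have hmv : P.InEssential m (P.pair m).1 :=
      ⟨⟨le_rfl, h.v_lt_w m⟩, fun n hn h3 h4 ⟨h5, h6⟩ => hn (h.eq_of_v_eq_v (by omega))⟩
    exact ⟨fun hi => h.inEssential_unique hmk hi ▸ hmv,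
      fun hi => h.inEssential_unique hmv hi ▸ hmk⟩
  · refine inEssential_congr (fun n => ?_) i
    by_cases hnm : n = m
    · subst hnm
      simp only [InInterval]
      omega
    have h1 := h.v_lt_w m
    have h3 := hvb n
    have h4 := hwb n
    have h5 := h.v_ne_w m n
    have h6 := h.v_ne_w n m
    have h7 : (P.pair n).1 ≠ (P.pair m).1 := fun e => hnm (h.eq_of_v_eq_v e)
    have h8 : (P.pair n).2 ≠ (P.pair m).2 := fun e => hnm (h.eq_of_w_eq_w e)
    have h9 := h.noncrossing n m
    have h10 := h.noncrossing m n
    simp only [InInterval]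
    omega
  · refine inEssential_congr (fun n => ?_) i
    by_cases hn : n = root
    · rw [hn]
      exact iff_of_true (h.inInterval_root hkN) (h.inInterval_root (h.whiteTime_lt ht))
    · have h1 := hno n hn
      have h3 := hvb n
      have h4 := hwb n
      simp only [InInterval]
      omega

theorem mem_whiteTimes_iff {i : Fin ℓ} {k t : ℕ} (hi : P.InEssential i k) :
    t ∈ P.whiteTimes k ↔ P.IsWhiteTime t ∧ P.InEssential i t := by
  refine and_congr_right fun _ => ⟨?_, fun ht => ⟨i, ht, hi⟩⟩
  rintro ⟨i', h1, h2⟩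
  rwa [h.inEssential_unique hi h2]

/-- The cyclic predecessor among the times of a white polygon. -/
theorem prevWhiteTime_eq {k t : ℕ} (hk : P.IsWhiteTime k) (ht : P.IsWhiteTime t)
    (hkt : P.Follows b root k t) : P.prevWhiteTime t = k := by
  obtain ⟨i, hit⟩ := h.exists_inEssential (h.whiteTime_lt ht)
  have hik := (h.follows_inEssential hk ht hkt i).2 hit
  have hlt := h.lt_endTime k
  have hmem : ∀ u, u ∈ P.whiteTimes t ↔ P.IsWhiteTime u ∧ P.InEssential i u :=
    fun u => h.mem_whiteTimes_iff hit
  have hbetween : ∀ u, P.IsWhiteTime u → k < u → P.endTime b k ≤ u := fun u hu hku => by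
    by_contra hcon
    exact h.not_whiteTime_between hk hku (by omega) hu
  -- `prevWhiteTime` wraps around when `t` is the first time of its polygon; then `k` has to be the
  -- last one. Otherwise `k` has to be the last one before `t`, as in `hprev`.
  have hlast : (∀ u ∈ P.whiteTimes t, ¬ u < t) → (∀ u ∈ P.whiteTimes t, u ≤ k) →
      P.prevWhiteTime t = k := by
    intro h1 h2
    rw [prevWhiteTime, if_neg (by push Not; exact fun u hu => not_lt.1 (h1 u hu))]
    exact IsGreatest.csSup_eq ⟨(hmem k).2 ⟨hk, hik⟩, h2⟩
  have hprev : k < t → (∀ u ∈ P.whiteTimes t, u < t → u ≤ k) → P.prevWhiteTime t = k := by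
    intro h1 h2
    have hkm := (hmem k).2 ⟨hk, hik⟩
    rw [prevWhiteTime, if_pos ⟨k, hkm, h1⟩]
    exact IsGreatest.csSup_eq ⟨⟨hkm, h1⟩, fun u hu => h2 u hu.1 hu.2⟩
  rcases hkt with ⟨rfl, e⟩ | ⟨m, hm, ⟨rfl, e⟩ | ⟨rfl, e⟩⟩ | ⟨h0, e, hno⟩
  · refine hlast (fun u _ => Nat.not_lt_zero u) fun u hu => ?_
    by_contra hcon
    have h1 := hbetween u ((hmem u).1 hu).1 (by omega)
    have h2 := h.whiteTime_lt ((hmem u).1 hu).1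
    omega
  · have hmv : P.InEssential m (P.pair m).1 :=
      ⟨⟨le_rfl, h.v_lt_w m⟩, fun n hn h3 h4 ⟨h5, h6⟩ => hn (h.eq_of_v_eq_v (by omega))⟩
    have him : i = m := h.inEssential_unique hit hmv
    subst him
    refine hlast (fun u hu => ?_) fun u hu => ?_
    · exact not_lt.2 ((hmem u).1 hu).2.1.1
    · by_contra hcon
      have h1 := hbetween u ((hmem u).1 hu).1 (by omega)
      have h2 := ((hmem u).1 hu).2.1.2
      omega
  · have h1 := h.v_lt_w m
    refine hprev (by omega) fun u hu hlt => ?_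
    by_contra hcon
    have h2 := hbetween u ((hmem u).1 hu).1 (by omega)
    -- A time `u` between `k` and the return from `m` lies in the interval of `m`, which is nested
    -- in that of `i`; so it is not an essential time of `i`.
    have him : m ≠ i := by
      rintro rfl
      have := hik.1.1
      omega
    have h3 := hik.1.1
    have h4 := hit.1.2
    exact ((hmem u).1 hu).2.2 m him (by omega) (by omega) ⟨by omega, hlt⟩
  · refine hprev (by omega) fun u hu hlt => ?_
    by_contra hcon
    have h2 := hbetween u ((hmem u).1 hu).1 (by omega)
    omega

end IsHurwitzPath

end MarkedPath

/-! ### Sides, faces and vertices of the glued map -/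

namespace GlueDart

theorem finite_card (N d : ℕ) : Finite (GlueDart N d) ∧ Nat.card (GlueDart N d) = 2 * N + 2 * d := by
  have e : (Fin N ⊕ Fin N) ⊕ (Fin d ⊕ Fin d) ≃ GlueDart N d :=
    { toFun := Sum.elim (Sum.elim outer inner) (Sum.elim onBlack onWhite)
      invFun := fun x => match x with
        | outer t => .inl (.inl t)
        | inner t => .inl (.inr t)
        | onBlack j => .inr (.inl j)
        | onWhite j => .inr (.inr j)
      left_inv := by rintro ((_ | _) | (_ | _)) <;> rfl
      right_inv := by rintro (_ | _ | _ | _) <;> rfl }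
  refine ⟨Finite.of_equiv _ e, ?_⟩
  rw [← Nat.card_congr e]
  simp only [Nat.card_sum, Nat.card_fin]
  ring

end GlueDart

namespace MarkedPath

variable {ℓ d : ℕ}

/-- The time, i.e. the vertex of the path, at which a side starts. -/
def startTime (P : MarkedPath ℓ d) (b : ℕ) : GlueDart P.steps.length d → ℕ
  | GlueDart.outer t => t
  | GlueDart.inner t => ((t : ℕ) + 1) % P.steps.length
  | GlueDart.onBlack j => P.dist j
  | GlueDart.onWhite j => (P.dist j + b) % P.steps.length

open Classical in
/-- Of two times that form a marked pair other than the one labelled `root`, the first one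
represents both. -/
noncomputable def representative (P : MarkedPath ℓ d) (root : Fin ℓ) (t : ℕ) : ℕ :=
  if h : ∃ i, i ≠ root ∧ t = (P.pair i).2 then (P.pair h.choose).1 else t

namespace IsHurwitzPath

variable {b : ℕ} {μ : Fin ℓ → ℕ} {root : Fin ℓ} {P : MarkedPath ℓ d}
  (h : P.IsHurwitzPath b μ root)
include h

theorem steps_length_pos : 0 < P.steps.length := by
  rw [h.length_eq]
  exact h.length_pos

omit h in
/-- The side of the edge of a white polygon that is traversed at time `t`. -/
noncomputable def side (h : P.IsHurwitzPath b μ root) (t : ℕ) : GlueDart P.steps.length d :=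
  P.whiteSide (GlueDart.outer ⟨0, h.steps_length_pos⟩) t

theorem dist_injective : Function.Injective P.dist := h.blocks.injective h.b_pos

theorem dist_lt (j : Fin d) : P.dist j < P.steps.length := by
  have := h.dist_add_le j
  have := h.b_pos
  rw [h.length_eq]
  omega

theorem whiteSide_dist (x : GlueDart P.steps.length d) (j : Fin d) :
    P.whiteSide x (P.dist j) = GlueDart.onWhite j := by
  have hex : ∃ i, P.dist i = P.dist j := ⟨j, rfl⟩
  rw [whiteSide, dif_pos hex, h.dist_injective hex.choose_spec]

theorem whiteSide_down (x : GlueDart P.steps.length d) {t : ℕ}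
    (ht : P.steps[t]? = some DyckStep.D) (hlt : t < P.steps.length) :
    P.whiteSide x t = GlueDart.inner ⟨t, hlt⟩ := by
  have hno : ¬ ∃ j, P.dist j = t := by
    rintro ⟨j, rfl⟩
    have := h.b_pos
    exact h.not_down_of_block le_rfl (by omega) ht
  rw [whiteSide, dif_neg hno, dif_pos hlt]

theorem side_dist (j : Fin d) : h.side (P.dist j) = GlueDart.onWhite j :=
  h.whiteSide_dist _ j

theorem side_down {t : ℕ} (ht : P.steps[t]? = some DyckStep.D) (hlt : t < P.steps.length) :
    h.side t = GlueDart.inner ⟨t, hlt⟩ :=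
  h.whiteSide_down _ ht hlt

/-- At a white time the default value of `whiteSide` is not used, so all white sides can be written
as values of the single function `side`. -/
theorem whiteSide_eq_side (x : GlueDart P.steps.length d) {t : ℕ} (ht : P.IsWhiteTime t) :
    P.whiteSide x t = h.side t := by
  rcases ht with ht | ⟨j, rfl⟩
  · have hlt := (getElem?_eq_D_iff.1 ht).1
    rw [h.whiteSide_down x ht hlt, h.side_down ht hlt]
  · rw [h.whiteSide_dist, h.side_dist]

/-- Replaces the suprema in the definition of `glueNext` by the combinatorial relation `Follows`;
later arguments about white sides use mainly this form. -/
theorem glueNext_side {k t : ℕ} (hk : P.IsWhiteTime k) (ht : P.IsWhiteTime t)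
    (hkt : P.Follows b root k t) : P.glueNext b (h.side t) = h.side k := by
  have hprev := h.prevWhiteTime_eq hk ht hkt
  rcases ht with ht | ⟨j, rfl⟩
  · have hlt := (getElem?_eq_D_iff.1 ht).1
    rw [h.side_down ht hlt, glueNext, if_neg]
    · exact (congrArg _ hprev).trans (h.whiteSide_eq_side _ hk)
    · rw [List.getElem?_eq_some_iff] at ht
      obtain ⟨_, ht⟩ := ht
      simp [ht]
  · rw [h.side_dist, glueNext]
    exact (congrArg _ hprev).trans (h.whiteSide_eq_side _ hk)

theorem getElem_eq_U_of_block {j : Fin d} {t : ℕ} (h1 : P.dist j ≤ t) (h2 : t < P.dist j + b)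
    (hlt : t < P.steps.length) :
    P.steps[(⟨t, hlt⟩ : Fin P.steps.length)] = DyckStep.U :=
  (List.getElem?_eq_some_iff.1 (h.blocks.up h1 h2)).2

theorem glueNext_inner_dist (j : Fin d) :
    P.glueNext b (GlueDart.inner ⟨P.dist j, h.dist_lt j⟩) = GlueDart.onBlack j := by
  have hb := h.b_pos
  have hex : ∃ i, P.dist i = P.dist j := ⟨j, rfl⟩
  rw [glueNext, if_pos (h.getElem_eq_U_of_block (j := j) le_rfl (by omega) _), dif_pos hex]
  rw [h.dist_injective hex.choose_spec]

theorem glueNext_inner_interior {j : Fin d} {t : ℕ} (h1 : P.dist j < t) (h2 : t < P.dist j + b)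
    (hlt : t < P.steps.length) :
    P.glueNext b (GlueDart.inner ⟨t, hlt⟩) = GlueDart.inner ⟨t - 1, by omega⟩ := by
  have hb := h.b_pos
  have hex : ¬ ∃ i, P.dist i = t := by
    rintro ⟨i, rfl⟩
    have := h.blocks.disjoint i j (P.dist i) le_rfl (by omega) h1.le h2
    subst this
    omega
  rw [glueNext, if_pos (h.getElem_eq_U_of_block h1.le h2 hlt), dif_neg hex]

theorem glueNext_onBlack (j : Fin d) :
    P.glueNext b (GlueDart.onBlack j) =
      GlueDart.inner ⟨P.dist j + b - 1, h.blocks.lt_length (j := j)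
        (by have := h.b_pos; omega) (by have := h.b_pos; omega)⟩ := by
  rw [glueNext, dif_pos]

/-- The four kinds of sides on which `glueNext` and `glueFace` have simple formulas: the boundary,
the internal and the outer sides of black polygons, and all sides of white polygons at once. -/
theorem dart_cases (x : GlueDart P.steps.length d) :
    (∃ t, x = GlueDart.outer t) ∨ (∃ j, x = GlueDart.onBlack j) ∨
      (∃ j t, ∃ hlt : t < P.steps.length, P.dist j ≤ t ∧ t < P.dist j + b ∧
        x = GlueDart.inner ⟨t, hlt⟩) ∨ ∃ t, P.IsWhiteTime t ∧ x = h.side t := by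
  cases x with
  | outer t => exact Or.inl ⟨t, rfl⟩
  | onBlack j => exact Or.inr (Or.inl ⟨j, rfl⟩)
  | onWhite j => exact Or.inr (Or.inr (Or.inr ⟨P.dist j, Or.inr ⟨j, rfl⟩, (h.side_dist j).symm⟩))
  | inner t =>
    by_cases hup : P.steps[(t : ℕ)]? = some DyckStep.U
    · obtain ⟨j, h1, h2⟩ := (h.blocks.up_iff _).1 hup
      exact Or.inr (Or.inr (Or.inl ⟨j, t, t.2, h1, h2, rfl⟩))
    · have hD := getElem?_eq_D_iff.2 ⟨t.2, hup⟩
      exact Or.inr (Or.inr (Or.inr ⟨t, Or.inl hD, (h.side_down hD t.2).symm⟩))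

/-! #### Faces -/

theorem whiteName_eq {i : Fin ℓ} {t : ℕ} (ht : P.InEssential i t) :
    P.whiteName t = FaceName.white i := by
  have hex : ∃ i, P.InEssential i t := ⟨i, ht⟩
  rw [whiteName, dif_pos hex, h.inEssential_unique hex.choose_spec ht]

theorem blackName_dist (j : Fin d) : P.blackName (P.dist j) = FaceName.black j := by
  have hex : ∃ i, P.dist i = P.dist j := ⟨j, rfl⟩
  rw [blackName, dif_pos hex, h.dist_injective hex.choose_spec]

theorem glueFace_side {i : Fin ℓ} {t : ℕ} (ht : P.IsWhiteTime t) (hi : P.InEssential i t) :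
    P.glueFace b (h.side t) = FaceName.white i := by
  rcases ht with ht | ⟨j, rfl⟩
  · have hlt := (getElem?_eq_D_iff.1 ht).1
    rw [h.side_down ht hlt, glueFace, if_neg, h.whiteName_eq hi]
    rw [List.getElem?_eq_some_iff] at ht
    obtain ⟨_, ht⟩ := ht
    simp [ht]
  · rw [h.side_dist, glueFace, h.whiteName_eq hi]

theorem exists_glueFace_side {t : ℕ} (ht : P.IsWhiteTime t) :
    ∃ i, P.InEssential i t ∧ P.glueFace b (h.side t) = FaceName.white i := by
  obtain ⟨i, hi⟩ := h.exists_inEssential (h.whiteTime_lt ht)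
  exact ⟨i, hi, h.glueFace_side ht hi⟩

theorem glueFace_inner_block {j : Fin d} {t : ℕ} (h1 : P.dist j ≤ t) (h2 : t < P.dist j + b)
    (hlt : t < P.steps.length) :
    P.glueFace b (GlueDart.inner ⟨t, hlt⟩) = FaceName.black j := by
  rw [glueFace, if_pos (h.getElem_eq_U_of_block h1 h2 hlt), blockStart,
    h.blocks.blockStart_eq h.b_pos h1 h2, h.blackName_dist]

theorem glueFace_side_iff {i : Fin ℓ} {t : ℕ} (ht : P.IsWhiteTime t) :
    P.glueFace b (h.side t) = FaceName.white i ↔ P.InEssential i t := by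
  obtain ⟨k, hk, e⟩ := h.exists_glueFace_side ht
  rw [e]
  constructor
  · intro e
    rwa [← FaceName.white.inj e]
  · intro hi
    rw [h.inEssential_unique hi hk]

theorem glueFace_next (x : GlueDart P.steps.length d) :
    P.glueFace b (P.glueNext b x) = P.glueFace b x := by
  have hb := h.b_pos
  rcases h.dart_cases x with ⟨t, rfl⟩ | ⟨j, rfl⟩ | ⟨j, t, hlt, h1, h2, rfl⟩ | ⟨t, ht, rfl⟩
  · rfl
  · rw [h.glueNext_onBlack, h.glueFace_inner_block (j := j) (by omega) (by omega)]
    rfl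
  · rw [h.glueFace_inner_block h1 h2]
    rcases h1.eq_or_lt with rfl | h1
    · rw [h.glueNext_inner_dist]
      rfl
    · rw [h.glueNext_inner_interior h1 h2,
        h.glueFace_inner_block (j := j) (by omega) (by omega)]
  · obtain ⟨k, hk, hkt⟩ := h.exists_follows_left ht
    obtain ⟨i, hi, e⟩ := h.exists_glueFace_side ht
    rw [h.glueNext_side hk ht hkt, e, h.glueFace_side_iff hk,
      h.follows_inEssential hk ht hkt]
    exact hi

theorem glueNext_surjective : Function.Surjective (P.glueNext b) := by
  have hb := h.b_pos
  intro x
  rcases h.dart_cases x with ⟨t, rfl⟩ | ⟨j, rfl⟩ | ⟨j, t, hlt, h1, h2, rfl⟩ | ⟨t, ht, rfl⟩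
  · obtain ⟨t, ht⟩ := t
    cases t with
    | zero =>
      refine ⟨GlueDart.outer ⟨P.steps.length - 1, by omega⟩, ?_⟩
      simp only [glueNext, Nat.sub_add_cancel (show 1 ≤ P.steps.length from ht), Nat.mod_self]
    | succ t =>
      refine ⟨GlueDart.outer ⟨t, by omega⟩, ?_⟩
      simp only [glueNext, Nat.mod_eq_of_lt ht]
  · exact ⟨_, h.glueNext_inner_dist j⟩
  · by_cases hl : t + 1 < P.dist j + b
    · have hlt' := h.blocks.lt_length (j := j) (t := t + 1) (by omega) hl
      exact ⟨GlueDart.inner ⟨t + 1, hlt'⟩, h.glueNext_inner_interior (by omega) hl hlt'⟩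
    · refine ⟨GlueDart.onBlack j, ?_⟩
      rw [h.glueNext_onBlack]
      congr 2
      omega
  · obtain ⟨u, hu, hut⟩ := h.exists_follows_right ht
    exact ⟨h.side u, h.glueNext_side ht hu hut⟩

theorem glueNext_bijective : Function.Bijective (P.glueNext b) :=
  have := (GlueDart.finite_card P.steps.length d).1
  (Finite.injective_iff_bijective).1 (Finite.injective_iff_surjective.2 h.glueNext_surjective)

omit h in
theorem glueOpp_glueOpp (x : GlueDart P.steps.length d) : P.glueOpp (P.glueOpp x) = x := by
  cases x <;> rfl

/-! #### Vertices -/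

theorem height_mod {t : ℕ} (ht : t ≤ P.steps.length) :
    pathHeight P.steps (t % P.steps.length) = pathHeight P.steps t := by
  rcases ht.eq_or_lt with rfl | ht
  · rw [Nat.mod_self, pathHeight_zero, h.length_eq, h.height_end]
  · rw [Nat.mod_eq_of_lt ht]

theorem representative_w {i : Fin ℓ} (hi : i ≠ root) :
    P.representative root (P.pair i).2 = (P.pair i).1 := by
  have hex : ∃ k, k ≠ root ∧ (P.pair i).2 = (P.pair k).2 := ⟨i, hi, rfl⟩
  rw [representative, dif_pos hex, h.eq_of_w_eq_w hex.choose_spec.2.symm]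

omit h in
theorem representative_of_ne {t : ℕ} (ht : ∀ i, i ≠ root → t ≠ (P.pair i).2) :
    P.representative root t = t := by
  rw [representative, dif_neg]
  rintro ⟨i, hi, e⟩
  exact ht i hi e

theorem representative_v (i : Fin ℓ) : P.representative root (P.pair i).1 = (P.pair i).1 :=
  representative_of_ne fun k _ => h.v_ne_w i k

theorem representative_ne {t : ℕ} (i : Fin ℓ) (hi : i ≠ root) :
    P.representative root t ≠ (P.pair i).2 := by
  by_cases hex : ∃ k, k ≠ root ∧ t = (P.pair k).2
  · obtain ⟨k, hk, rfl⟩ := hex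
    rw [h.representative_w hk]
    exact h.v_ne_w k i
  · push Not at hex
    rw [representative_of_ne hex]
    exact hex i hi

theorem representative_cases (t : ℕ) : P.representative root t = t ∨
    ∃ i, i ≠ root ∧ t = (P.pair i).2 ∧ P.representative root t = (P.pair i).1 := by
  by_cases hex : ∃ k, k ≠ root ∧ t = (P.pair k).2
  · obtain ⟨k, hk, rfl⟩ := hex
    exact Or.inr ⟨k, hk, rfl, h.representative_w hk⟩
  · push Not at hex
    exact Or.inl (representative_of_ne hex)

theorem representative_le (t : ℕ) : P.representative root t ≤ t := by
  rcases h.representative_cases t with e | ⟨i, hi, e, e'⟩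
  · exact e.le
  · have := h.v_lt_w i
    omega

theorem height_representative (t : ℕ) :
    pathHeight P.steps (P.representative root t) = pathHeight P.steps t := by
  rcases h.representative_cases t with e | ⟨i, hi, e, e'⟩
  · rw [e]
  · rw [e', e, h.height_pair]

/-- An edge ends at the time at which its follower is met, except at a marked pair, where it ends at
the other member, and at the end of the path, which is time 0. The representative and the remainder
remove these differences. -/
theorem representative_follows {k t : ℕ} (ht : P.IsWhiteTime t)
    (hkt : P.Follows b root k t) :
    P.representative root (P.endTime b k % P.steps.length) = P.representative root t := by
  rw [h.length_eq]
  rcases hkt with ⟨rfl, e⟩ | ⟨m, hm, ⟨rfl, e⟩ | ⟨rfl, e⟩⟩ | ⟨h0, e, hno⟩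
  · rw [e, Nat.mod_self]
  · rw [e, Nat.mod_eq_of_lt (h.w_lt m hm), h.representative_w hm, h.representative_v]
  · rw [e, Nat.mod_eq_of_lt ((h.v_lt_w m).trans (h.w_lt m hm)), h.representative_w hm,
      h.representative_v]
  · rw [e, Nat.mod_eq_of_lt (h.whiteTime_lt ht)]

theorem startTime_side {t : ℕ} (ht : P.IsWhiteTime t) :
    P.startTime b (h.side t) = P.endTime b t % P.steps.length := by
  rcases ht with ht | ⟨j, rfl⟩
  · rw [h.side_down ht (getElem?_eq_D_iff.1 ht).1, h.endTime_of_down ht]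
    rfl
  · rw [h.side_dist, endTime_dist]
    rfl

theorem startTime_lt (x : GlueDart P.steps.length d) : P.startTime b x < P.steps.length := by
  cases x with
  | outer t => exact t.2
  | inner t => exact Nat.mod_lt _ h.steps_length_pos
  | onBlack j => exact h.dist_lt j
  | onWhite j => exact Nat.mod_lt _ h.steps_length_pos

/-- The time at which the next side starts is the time at which the given side ends, up to the
identification of the times of marked pairs. -/
theorem representative_glueNext (x : GlueDart P.steps.length d) :
    P.representative root (P.startTime b (P.glueNext b x)) =
      P.representative root (P.startTime b (P.glueOpp x)) := by
  have hb := h.b_pos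
  rcases h.dart_cases x with ⟨t, rfl⟩ | ⟨j, rfl⟩ | ⟨j, t, hlt, h1, h2, rfl⟩ | ⟨t, ht, rfl⟩
  · rfl
  · rw [h.glueNext_onBlack]
    simp only [startTime, glueOpp]
    congr 2
    omega
  · rcases h1.eq_or_lt with rfl | h1
    · rw [h.glueNext_inner_dist]
      rfl
    · rw [h.glueNext_inner_interior h1 h2]
      simp only [startTime, glueOpp]
      congr 1
      rw [Nat.sub_add_cancel (by omega), Nat.mod_eq_of_lt hlt]
  · obtain ⟨k, hk, hkt⟩ := h.exists_follows_left ht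
    rw [h.glueNext_side hk ht hkt, h.startTime_side hk, h.representative_follows ht hkt]
    rcases ht with ht | ⟨j, rfl⟩
    · rw [h.side_down ht (getElem?_eq_D_iff.1 ht).1]
      rfl
    · rw [h.side_dist]
      rfl

theorem glueColour_eq (x : GlueDart P.steps.length d) :
    P.glueColour b x = (pathHeight P.steps (P.startTime b x) : ZMod (b + 1)) := by
  cases x with
  | outer t => rfl
  | inner t => rw [startTime, h.height_mod (Nat.succ_le_of_lt t.2)]; rfl
  | onBlack j => rfl
  | onWhite j =>
    rw [startTime, h.height_mod (by rw [h.length_eq]; exact h.dist_add_le j),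
      pathHeight_add fun t h1 h2 => h.blocks.up h1 h2, glueColour]
    push_cast; rfl

end IsHurwitzPath

end MarkedPath

/-! ### The vertices of the glued map are times modulo marked pairs -/

namespace MarkedPath

namespace IsHurwitzPath

variable {ℓ d b : ℕ} {μ : Fin ℓ → ℕ} {root : Fin ℓ} {P : MarkedPath ℓ d}
  (h : P.IsHurwitzPath b μ root)
include h

theorem representative_rot (x : GlueDart P.steps.length d) :
    P.representative root (P.startTime b ((P.gluing b).rot x)) =
      P.representative root (P.startTime b x) := by
  have := h.representative_glueNext (P.glueOpp x)
  rwa [glueOpp_glueOpp] at this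

omit h in
theorem vertex_inner (t : Fin P.steps.length) :
    (P.gluing b).vertex (GlueDart.inner t) = (P.gluing b).vertex (GlueDart.outer
      ⟨((t : ℕ) + 1) % P.steps.length, Nat.mod_lt _ t.pos⟩) :=
  (ColouredMap.vertex_rot (C := P.gluing b) (GlueDart.inner t)).symm

/-- One or two rotations lead to a boundary corner at the start time. So every vertex of the glued
map lies on the boundary. -/
theorem vertex_startTime (x : GlueDart P.steps.length d) : (P.gluing b).vertex x =
    (P.gluing b).vertex (GlueDart.outer ⟨P.startTime b x, h.startTime_lt x⟩) := by
  have hb := h.b_pos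
  cases x with
  | outer t => rfl
  | inner t => exact vertex_inner t
  | onBlack j =>
    rw [← ColouredMap.vertex_rot (C := P.gluing b) (GlueDart.outer ⟨_, _⟩)]
    exact congrArg _ (h.glueNext_inner_dist j).symm
  | onWhite j =>
    rw [← ColouredMap.vertex_rot (C := P.gluing b) (GlueDart.onWhite j)]
    have e : (P.gluing b).rot (GlueDart.onWhite j) = _ := h.glueNext_onBlack j
    rw [e, vertex_inner]
    congr 3
    simp only [startTime]
    congr 1
    omega

/-- The first edge of polygon `i` is met at one vertex of the pair, and it follows the last edge,
which ends at the other. Rotating the corner at the first vertex gives the side of this last edge.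
-/
theorem vertex_pair {i : Fin ℓ} (hi : i ≠ root) (hv : (P.pair i).1 < P.steps.length)
    (hw : (P.pair i).2 < P.steps.length) :
    (P.gluing b).vertex (GlueDart.outer ⟨_, hv⟩) = (P.gluing b).vertex (GlueDart.outer ⟨_, hw⟩) := by
  have hvd := h.down_v i hi
  obtain ⟨k, hk, e⟩ := h.exists_endTime_eq (t := (P.pair i).2)
    ((Nat.zero_le _).trans_lt (h.v_lt_w i)) (Or.inr (Or.inl (h.down_w i hi)))
  have hn := h.glueNext_side hk (Or.inl hvd) (Or.inr (Or.inl ⟨i, hi, Or.inl ⟨rfl, e⟩⟩))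
  rw [h.side_down hvd hv] at hn
  rw [← ColouredMap.vertex_rot (C := P.gluing b) (GlueDart.outer ⟨_, hv⟩)]
  have e2 : (P.gluing b).rot (GlueDart.outer ⟨_, hv⟩) = h.side k := hn
  rw [e2, h.vertex_startTime]
  congr 3
  rw [h.startTime_side hk, e, Nat.mod_eq_of_lt hw]

theorem vertex_representative {t : ℕ} (ht : t < P.steps.length) :
    (P.gluing b).vertex (GlueDart.outer ⟨t, ht⟩) = (P.gluing b).vertex
      (GlueDart.outer ⟨P.representative root t, (h.representative_le t).trans_lt ht⟩) := by
  rcases h.representative_cases t with e | ⟨i, hi, rfl, e⟩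
  · simp only [e]
  · rw [← h.vertex_pair hi ((h.v_lt_w i).trans ht) ht]
    simp only [e]

/-- The representative of the start time is invariant under rotation; conversely every side shares
its vertex with the boundary corner at this representative. -/
theorem vertex_eq_iff {x y : GlueDart P.steps.length d} :
    (P.gluing b).vertex x = (P.gluing b).vertex y ↔
      P.representative root (P.startTime b x) = P.representative root (P.startTime b y) := by
  constructor
  · intro e
    exact congrArg (Quot.lift (fun x => P.representative root (P.startTime b x))
      fun x y (e : (P.gluing b).rot x = y) => by rw [← e]; exact (h.representative_rot x).symm) e
  · intro e
    rw [h.vertex_startTime x, h.vertex_startTime y, h.vertex_representative,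
      h.vertex_representative (h.startTime_lt y)]
    simp only [e]

omit h in
/-- The first time at which a vertex is met. -/
noncomputable def vertexTime (h : P.IsHurwitzPath b μ root) (v : (P.gluing b).Vertex) :
    Fin P.steps.length :=
  Quot.lift (fun x : GlueDart P.steps.length d =>
    (⟨P.representative root (P.startTime b x),
      (h.representative_le _).trans_lt (h.startTime_lt x)⟩ : Fin P.steps.length))
    (fun x y (e : (P.gluing b).rot x = y) =>
      Fin.ext (by rw [← e]; exact (h.representative_rot x).symm)) v

theorem vertexTime_injective : Function.Injective h.vertexTime := by
  rintro ⟨x⟩ ⟨y⟩ e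
  exact h.vertex_eq_iff.2 (congrArg Fin.val e)

theorem vertexTime_outer (t : Fin P.steps.length) :
    (h.vertexTime ((P.gluing b).vertex (GlueDart.outer t)) : ℕ) = P.representative root t := rfl

theorem vertexTime_ne (v : (P.gluing b).Vertex) {i : Fin ℓ} (hi : i ≠ root) :
    (h.vertexTime v : ℕ) ≠ (P.pair i).2 := by
  obtain ⟨x, rfl⟩ := Quot.exists_rep v
  exact h.representative_ne i hi

/-- Each of the 2bd times is either the representative of a unique vertex or the second member of
one of the ℓ - 1 pairs other than the root. -/
theorem card_vertex : Nat.card (P.gluing b).Vertex + ℓ = 2 * b * d + 1 := by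
  have hfin : Finite (P.gluing b).Vertex := Finite.of_injective _ h.vertexTime_injective
  have hl : Nat.card {i // i ≠ root} + 1 = ℓ := by
    have := root.pos
    rw [Nat.card_eq_fintype_card, Fintype.card_subtype_compl, Fintype.card_fin,
      Fintype.card_unique]
    omega
  have hc : Nat.card ((P.gluing b).Vertex ⊕ {i // i ≠ root}) = 2 * b * d := by
    rw [← h.length_eq, ← Nat.card_fin P.steps.length]
    refine Nat.card_congr (Equiv.ofBijective (Sum.elim h.vertexTime
      fun i => ⟨(P.pair i.1).2, by rw [h.length_eq]; exact h.w_lt i.1 i.2⟩) ⟨?_, ?_⟩)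
    · rintro (v | ⟨i, hi⟩) (v' | ⟨k, hk⟩) e
      · rw [h.vertexTime_injective e]
      · exact absurd (congrArg Fin.val e) (h.vertexTime_ne v hk)
      · exact absurd (congrArg Fin.val e).symm (h.vertexTime_ne v' hi)
      · have := h.eq_of_w_eq_w (congrArg Fin.val e)
        subst this; rfl
    · intro t
      by_cases hex : ∃ i, i ≠ root ∧ (t : ℕ) = (P.pair i).2
      · obtain ⟨i, hi, e⟩ := hex
        exact ⟨Sum.inr ⟨i, hi⟩, Fin.ext e.symm⟩
      · push Not at hex
        refine ⟨Sum.inl ((P.gluing b).vertex (GlueDart.outer t)), Fin.ext ?_⟩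
        exact (h.vertexTime_outer t).trans (representative_of_ne hex)
  rw [Nat.card_sum] at hc
  omega

/-! #### The glued map is a graph on the sphere -/

theorem region_outer {t : ℕ} (ht : t < P.steps.length) :
    (P.gluing b).region (GlueDart.outer ⟨t, ht⟩) =
      (P.gluing b).region (GlueDart.outer ⟨0, h.steps_length_pos⟩) := by
  induction t with
  | zero => rfl
  | succ t ih =>
    rw [← ih (by omega)]
    refine (Quot.sound ?_).symm
    simp only [gluing, glueNext, Nat.mod_eq_of_lt ht]

omit h in
theorem region_next (x : GlueDart P.steps.length d) :
    (P.gluing b).region (P.glueNext b x) = (P.gluing b).region x :=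
  (Quot.sound (r := fun x y : (P.gluing b).Dart => (P.gluing b).next x = y) rfl).symm

theorem region_inner_block {j : Fin d} {k : ℕ} (hk : k < b)
    (hlt : P.dist j + k < P.steps.length) :
    (P.gluing b).region (GlueDart.inner ⟨P.dist j + k, hlt⟩) =
      (P.gluing b).region (GlueDart.onBlack j) := by
  induction k with
  | zero =>
    rw [← h.glueNext_inner_dist j, region_next]
    rfl
  | succ k ih =>
    rw [← ih (by omega) (by omega), ← region_next (GlueDart.inner ⟨P.dist j + (k + 1), hlt⟩),
      h.glueNext_inner_interior (j := j) (by omega) (by omega)]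
    rfl

/-- Step from `t` to its predecessor in the polygon; being a supremum of the smaller times, it is
still at least `s`. -/
theorem region_side_le {i : Fin ℓ} {s t : ℕ} (hs : P.IsWhiteTime s) (ht : P.IsWhiteTime t)
    (hst : s ≤ t) (his : P.InEssential i s) (hit : P.InEssential i t) :
    (P.gluing b).region (h.side s) = (P.gluing b).region (h.side t) := by
  induction t using Nat.strong_induction_on with
  | _ t ih =>
    rcases hst.eq_or_lt with rfl | hst
    · rfl
    obtain ⟨k, hk, hkt⟩ := h.exists_follows_left ht
    have hik := (h.follows_inEssential hk ht hkt i).2 hit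
    have hprev := h.prevWhiteTime_eq hk ht hkt
    have hmem : s ∈ P.whiteTimes t := (h.mem_whiteTimes_iff hit).2 ⟨hs, his⟩
    rw [prevWhiteTime, if_pos ⟨s, hmem, hst⟩] at hprev
    have hbdd : BddAbove {u | u ∈ P.whiteTimes t ∧ u < t} := ⟨t, fun u hu => hu.2.le⟩
    have hsk : s ≤ k := hprev ▸ le_csSup hbdd ⟨hmem, hst⟩
    have hkt' : k < t := (hprev ▸ Nat.sSup_mem ⟨s, hmem, hst⟩ hbdd :
      k ∈ {u | u ∈ P.whiteTimes t ∧ u < t}).2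
    rw [ih k hkt' hk hsk hik, ← h.glueNext_side hk ht hkt, region_next]

theorem region_eq_of_face_eq {x y : GlueDart P.steps.length d}
    (e : P.glueFace b x = P.glueFace b y) : (P.gluing b).region x = (P.gluing b).region y := by
  have hb := h.b_pos
  have key : ∀ x : GlueDart P.steps.length d,
      (P.glueFace b x = FaceName.boundary ∧ (P.gluing b).region x =
        (P.gluing b).region (GlueDart.outer ⟨0, h.steps_length_pos⟩)) ∨
      (∃ j, P.glueFace b x = FaceName.black j ∧ (P.gluing b).region x =
        (P.gluing b).region (GlueDart.onBlack j)) ∨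
      ∃ i t, P.glueFace b x = FaceName.white i ∧ P.IsWhiteTime t ∧ P.InEssential i t ∧
        x = h.side t := by
    intro x
    rcases h.dart_cases x with ⟨t, rfl⟩ | ⟨j, rfl⟩ | ⟨j, t, hlt, h1, h2, rfl⟩ | ⟨t, ht, rfl⟩
    · exact Or.inl ⟨rfl, h.region_outer t.2⟩
    · exact Or.inr (Or.inl ⟨j, rfl, rfl⟩)
    · obtain ⟨k, rfl⟩ := Nat.exists_eq_add_of_le h1
      exact Or.inr (Or.inl ⟨j, h.glueFace_inner_block h1 h2 hlt,
        h.region_inner_block (by omega) hlt⟩)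
    · obtain ⟨i, hi, e⟩ := h.exists_glueFace_side ht
      exact Or.inr (Or.inr ⟨i, t, e, ht, hi, rfl⟩)
  rcases key x with ⟨h1, h2⟩ | ⟨j, h1, h2⟩ | ⟨i, t, h1, h2, h3, rfl⟩ <;>
    rcases key y with ⟨h4, h5⟩ | ⟨k, h4, h5⟩ | ⟨k, s, h4, h5, h6, rfl⟩ <;>
    rw [h1, h4] at e <;> try cases e
  · rw [h2, h5]
  · rw [h2, h5]
  · rcases le_total t s with hts | hts
    · exact h.region_side_le h2 h5 hts h3 h6
    · exact (h.region_side_le h5 h2 hts h6 h3).symm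

theorem exists_down_inEssential (i : Fin ℓ) :
    ∃ t, P.InEssential i t ∧ P.steps[t]? = some DyckStep.D := by
  have h1 := h.degree_down i
  have h2 := Nat.mul_pos h.b_pos (h.pos i)
  rw [← h1] at h2
  exact Set.nonempty_of_ncard_ne_zero h2.ne'

theorem eqvGen_outer (x : GlueDart P.steps.length d) :
    Relation.EqvGen (fun u v => (P.gluing b).opp u = v ∨ (P.gluing b).next u = v) x
      (GlueDart.outer ⟨0, h.steps_length_pos⟩ : (P.gluing b).Dart) := by
  have hout : ∀ t : ℕ, ∀ ht : t < P.steps.length,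
      Relation.EqvGen (fun u v => (P.gluing b).opp u = v ∨ (P.gluing b).next u = v)
        (GlueDart.outer ⟨t, ht⟩ : (P.gluing b).Dart)
        (GlueDart.outer ⟨0, h.steps_length_pos⟩ : (P.gluing b).Dart) := by
    intro t
    induction t with
    | zero => exact fun _ => .refl _
    | succ t ih =>
      intro ht
      refine .trans _ _ _ (.symm _ _ (.rel _ _ (Or.inr ?_))) (ih (by omega))
      simp only [gluing, glueNext, Nat.mod_eq_of_lt ht]
  have hin : ∀ t : Fin P.steps.length,
      Relation.EqvGen (fun u v => (P.gluing b).opp u = v ∨ (P.gluing b).next u = v)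
        (GlueDart.inner t : (P.gluing b).Dart)
        (GlueDart.outer ⟨0, h.steps_length_pos⟩ : (P.gluing b).Dart) := fun t =>
    .trans _ _ _ (.rel _ _ (Or.inl rfl)) (hout t t.2)
  have hbl : ∀ j : Fin d,
      Relation.EqvGen (fun u v => (P.gluing b).opp u = v ∨ (P.gluing b).next u = v)
        (GlueDart.onBlack j : (P.gluing b).Dart)
        (GlueDart.outer ⟨0, h.steps_length_pos⟩ : (P.gluing b).Dart) := fun j =>
    .trans _ _ _ (.rel _ _ (Or.inr (h.glueNext_onBlack j))) (hin _)
  cases x with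
  | outer t => exact hout t t.2
  | inner t => exact hin t
  | onBlack j => exact hbl j
  | onWhite j => exact .trans _ _ _ (.rel _ _ (Or.inl rfl)) (hbl j)

/-- There are 2bd + 1 - ℓ vertices, 2bd + d edges and ℓ + d + 1 regions, so the Euler characteristic
is 2. -/
theorem isSurfaceGraph : (P.gluing b).IsSurfaceGraph 0 := by
  have hfin := (GlueDart.finite_card P.steps.length d).1
  have hface : ∀ x y, (P.gluing b).face x = (P.gluing b).face y ↔
      (P.gluing b).region x = (P.gluing b).region y := fun x y =>
    ⟨h.region_eq_of_face_eq, fun e => congrArg (Quot.lift (P.glueFace b)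
      fun x y (e : P.glueNext b x = y) => by rw [← e, h.glueFace_next]) e⟩
  have hsurj : Function.Surjective (P.gluing b).face := by
    rintro (_ | i | j)
    · exact ⟨GlueDart.outer ⟨0, h.steps_length_pos⟩, rfl⟩
    · obtain ⟨t, hi, hD⟩ := h.exists_down_inEssential i
      exact ⟨h.side t, h.glueFace_side (Or.inl hD) hi⟩
    · exact ⟨GlueDart.onBlack j, rfl⟩
  have hopp : ∀ x, (P.gluing b).opp ((P.gluing b).opp x) = x := glueOpp_glueOpp
  have hne : ∀ x, (P.gluing b).opp x ≠ x := by
    rintro (_ | _ | _ | _) e <;> cases e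
  refine ⟨hfin, hopp, hne, h.glueNext_bijective, fun x y => ?_, hface, hsurj, ?_⟩
  · exact .trans _ _ _ (h.eqvGen_outer x) (.symm _ _ (h.eqvGen_outer y))
  · have hE : 2 * Nat.card (P.gluing b).Edge = 2 * P.steps.length + 2 * d :=
      (two_mul_card_quot_involution (α := GlueDart P.steps.length d) hopp hne).trans
        (GlueDart.finite_card P.steps.length d).2
    rw [h.length_eq] at hE
    rw [ColouredMap.card_region_of_face hface hsurj]
    have hV := h.card_vertex
    push_cast
    omega

end IsHurwitzPath

end MarkedPath

/-! ### The glued map is a cactus labelled by heights -/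

namespace MarkedPath

namespace IsHurwitzPath

variable {ℓ d b : ℕ} {μ : Fin ℓ → ℕ} {root : Fin ℓ} {P : MarkedPath ℓ d}
  (h : P.IsHurwitzPath b μ root)
include h

theorem card_dist_inEssential (i : Fin ℓ) : Nat.card {j // P.InEssential i (P.dist j)} = μ i := by
  have h1 := h.blocks.ncard_up (S := fun t => P.InEssential i t)
    fun j t h1 h2 => h.inEssential_block h1 h2 i
  rw [h.degree_up i] at h1
  exact (Nat.eq_of_mul_eq_mul_left h.b_pos h1).symm

theorem glueFace_onWhite_iff {i : Fin ℓ} {j : Fin d} :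
    P.glueFace b (GlueDart.onWhite j) = FaceName.white i ↔ P.InEssential i (P.dist j) := by
  rw [← h.side_dist, h.glueFace_side_iff (Or.inr ⟨j, rfl⟩)]

theorem glueFace_inner_down_iff {i : Fin ℓ} {t : ℕ} (ht : P.steps[t]? = some DyckStep.D)
    (hlt : t < P.steps.length) :
    P.glueFace b (GlueDart.inner ⟨t, hlt⟩) = FaceName.white i ↔ P.InEssential i t := by
  rw [← h.side_down ht hlt, h.glueFace_side_iff (Or.inl ht)]

theorem down_of_white {i : Fin ℓ} {t : Fin P.steps.length}
    (ht : P.glueFace b (GlueDart.inner t) = FaceName.white i) :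
    P.steps[(t : ℕ)]? = some DyckStep.D := by
  refine getElem?_eq_D_iff.2 ⟨t.2, fun hup => ?_⟩
  obtain ⟨j, h1, h2⟩ := (h.blocks.up_iff _).1 hup
  rw [h.glueFace_inner_block h1 h2 t.2] at ht
  cases ht

/-- The b μ i down-steps in the essential interval give the boundary sides, and the μ i
distinguished vertices in it give the internal ones. -/
theorem white_degree (i : Fin ℓ) :
    Nat.card {x // (P.gluing b).face x = FaceName.white i} = (b + 1) * μ i := by
  have h1 := h.degree_down i
  rw [← Nat.card_coe_set_eq] at h1
  have hfin : Finite {k | P.InEssential i k ∧ P.steps[k]? = some DyckStep.D} :=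
    Set.Finite.subset (Set.finite_Iio (2 * b * d)) fun k hk => h.inEssential_lt hk.1
  rw [add_one_mul, ← h1, ← h.card_dist_inEssential i, ← Nat.card_sum]
  symm
  refine Nat.card_congr (Equiv.ofBijective (Sum.elim
    (fun k => ⟨GlueDart.inner ⟨k.1, (getElem?_eq_D_iff.1 k.2.2).1⟩,
      (h.glueFace_inner_down_iff k.2.2 _).2 k.2.1⟩)
    (fun j => ⟨GlueDart.onWhite j.1, h.glueFace_onWhite_iff.2 j.2⟩)) ⟨?_, ?_⟩)
  · rintro (⟨k, hk⟩ | ⟨j, hj⟩) (⟨l, hl⟩ | ⟨m, hm⟩) e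
    · injection e with e
      injection e with e
      injection e with e
      subst e; rfl
    · injection e with e; cases e
    · injection e with e; cases e
    · injection e with e
      injection e with e
      subst e; rfl
  · rintro ⟨x, hx⟩
    cases x with
    | outer t => cases hx
    | onBlack j => cases hx
    | onWhite j => exact ⟨Sum.inr ⟨j, h.glueFace_onWhite_iff.1 hx⟩, rfl⟩
    | inner t =>
      have hD := h.down_of_white hx
      exact ⟨Sum.inl ⟨t, (h.glueFace_inner_down_iff hD t.2).1 hx, hD⟩, rfl⟩

theorem block_of_black {j : Fin d} {t : Fin P.steps.length}
    (ht : P.glueFace b (GlueDart.inner t) = FaceName.black j) :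
    P.dist j ≤ t ∧ (t : ℕ) < P.dist j + b := by
  by_cases hup : P.steps[(t : ℕ)]? = some DyckStep.U
  · obtain ⟨k, h1, h2⟩ := (h.blocks.up_iff _).1 hup
    rw [h.glueFace_inner_block h1 h2 t.2] at ht
    cases ht
    exact ⟨h1, h2⟩
  · have hD := getElem?_eq_D_iff.2 ⟨t.2, hup⟩
    obtain ⟨i, -, e⟩ := h.exists_glueFace_side (Or.inl hD)
    rw [h.side_down hD t.2, ht] at e
    cases e

theorem black_degree (j : Fin d) :
    Nat.card {x // (P.gluing b).face x = FaceName.black j} = (b + 1) * 1 := by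
  have hlt : ∀ m : Fin b, P.dist j + m < P.steps.length := fun m =>
    h.blocks.lt_length (j := j) (by omega) (by omega)
  have hc : Nat.card (Fin b ⊕ Unit) = (b + 1) * 1 := by simp
  rw [← hc]
  symm
  refine Nat.card_congr (Equiv.ofBijective (Sum.elim
    (fun m => ⟨GlueDart.inner ⟨P.dist j + m, hlt m⟩,
      h.glueFace_inner_block (by omega) (by omega) _⟩)
    (fun _ => ⟨GlueDart.onBlack j, rfl⟩)) ⟨?_, ?_⟩)
  · rintro (k | _) (l | _) e
    · injection e with e
      injection e with e
      injection e with e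
      have : k = l := Fin.ext (by omega)
      subst this; rfl
    · injection e with e; cases e
    · injection e with e; cases e
    · rfl
  · rintro ⟨x, hx⟩
    cases x with
    | outer t => cases hx
    | onBlack k => cases hx; exact ⟨Sum.inr (), rfl⟩
    | onWhite k =>
      obtain ⟨i, -, e⟩ := h.exists_glueFace_side (Or.inr ⟨k, rfl⟩)
      rw [h.side_dist] at e
      have hx : P.glueFace b (GlueDart.onWhite k) = FaceName.black j := hx
      rw [hx] at e
      cases e
    | inner t =>
      obtain ⟨h1, h2⟩ := h.block_of_black hx
      refine ⟨Sum.inl ⟨t - P.dist j, by omega⟩, ?_⟩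
      refine Subtype.ext (congrArg GlueDart.inner (Fin.ext ?_))
      simp only
      omega

theorem isInternal_onWhite (j : Fin d) : (P.gluing b).IsInternal (GlueDart.onWhite j) := by
  obtain ⟨i, -, e⟩ := h.exists_glueFace_side (Or.inr ⟨j, rfl⟩)
  rw [h.side_dist] at e
  exact ⟨⟨i, e⟩, j, rfl⟩

theorem isWhiteBoundary_outer {t : ℕ} (ht : P.steps[t]? = some DyckStep.D)
    (hlt : t < P.steps.length) : (P.gluing b).IsWhiteBoundary (GlueDart.outer ⟨t, hlt⟩) := by
  obtain ⟨i, -, e⟩ := h.exists_glueFace_side (Or.inl ht)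
  rw [h.side_down ht hlt] at e
  exact ⟨rfl, i, e⟩

theorem isBlackBoundary_outer {t : ℕ} (ht : P.steps[t]? = some DyckStep.U)
    (hlt : t < P.steps.length) : (P.gluing b).IsBlackBoundary (GlueDart.outer ⟨t, hlt⟩) := by
  obtain ⟨j, h1, h2⟩ := (h.blocks.up_iff t).1 ht
  exact ⟨rfl, j, h.glueFace_inner_block h1 h2 hlt⟩

theorem isWhiteBoundary_iff {x : GlueDart P.steps.length d} :
    (P.gluing b).IsWhiteBoundary x ↔
      ∃ t : Fin P.steps.length, P.steps[(t : ℕ)]? = some DyckStep.D ∧ x = GlueDart.outer t := by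
  constructor
  · rintro ⟨h1, i, h2⟩
    cases x with
    | outer t => exact ⟨t, h.down_of_white h2, rfl⟩
    | onBlack j => cases h1
    | onWhite j =>
      obtain ⟨⟨i, hi⟩, -⟩ := h.isInternal_onWhite j
      rw [hi] at h1; cases h1
    | inner t => cases h2
  · rintro ⟨t, ht, rfl⟩
    exact h.isWhiteBoundary_outer ht t.2

theorem isBlackBoundary_iff {x : GlueDart P.steps.length d} :
    (P.gluing b).IsBlackBoundary x ↔
      ∃ t : Fin P.steps.length, P.steps[(t : ℕ)]? = some DyckStep.U ∧ x = GlueDart.outer t := by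
  constructor
  · rintro ⟨h1, i, h2⟩
    cases x with
    | outer t =>
      obtain ⟨h3, h4⟩ := h.block_of_black h2
      exact ⟨t, h.blocks.up h3 h4, rfl⟩
    | onBlack j => cases h1
    | onWhite j =>
      obtain ⟨⟨i, hi⟩, -⟩ := h.isInternal_onWhite j
      rw [hi] at h1; cases h1
    | inner t => cases h2
  · rintro ⟨t, ht, rfl⟩
    exact h.isBlackBoundary_outer ht t.2

theorem isInternal_iff {x : GlueDart P.steps.length d} :
    (P.gluing b).IsInternal x ↔ ∃ j, x = GlueDart.onWhite j := by
  constructor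
  · rintro ⟨⟨i, h1⟩, j, h2⟩
    cases x with
    | outer t => cases h1
    | onBlack j => cases h1
    | onWhite j => exact ⟨j, rfl⟩
    | inner t => cases h2
  · rintro ⟨j, rfl⟩
    exact h.isInternal_onWhite j

theorem edge_types (x : GlueDart P.steps.length d) :
    ∃ y : GlueDart P.steps.length d, (y = x ∨ y = P.glueOpp x) ∧ ((P.gluing b).IsInternal y ∨
      (P.gluing b).IsWhiteBoundary y ∨ (P.gluing b).IsBlackBoundary y) := by
  have hout : ∀ t : Fin P.steps.length, (P.gluing b).IsWhiteBoundary (GlueDart.outer t) ∨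
      (P.gluing b).IsBlackBoundary (GlueDart.outer t) := by
    intro t
    by_cases hup : P.steps[(t : ℕ)]? = some DyckStep.U
    · exact Or.inr (h.isBlackBoundary_outer hup t.2)
    · exact Or.inl (h.isWhiteBoundary_outer (getElem?_eq_D_iff.2 ⟨t.2, hup⟩) t.2)
  cases x with
  | outer t => exact ⟨GlueDart.outer t, Or.inl rfl, Or.inr (hout t)⟩
  | inner t => exact ⟨GlueDart.outer t, Or.inr rfl, Or.inr (hout t)⟩
  | onBlack j => exact ⟨GlueDart.onWhite j, Or.inr rfl, Or.inl (h.isInternal_onWhite j)⟩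
  | onWhite j => exact ⟨GlueDart.onWhite j, Or.inl rfl, Or.inl (h.isInternal_onWhite j)⟩

theorem colour_vertex (x : GlueDart P.steps.length d) :
    P.glueColour b ((P.gluing b).rot x) = P.glueColour b x := by
  rw [h.glueColour_eq x, ← h.height_representative, ← h.representative_rot,
    h.height_representative]
  exact h.glueColour_eq _

omit h in
theorem glueColour_inner_down {t : ℕ} (ht : P.steps[t]? = some DyckStep.D)
    (hlt : t < P.steps.length) :
    P.glueColour b (GlueDart.inner ⟨t, hlt⟩) = pathHeight P.steps t - 1 := by
  simp only [glueColour]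
  rw [pathHeight_succ_of_down ht]
  push_cast; rfl

omit h in
theorem glueColour_onWhite (j : Fin d) :
    P.glueColour b (GlueDart.onWhite j) = pathHeight P.steps (P.dist j) - 1 := by
  have hb : (b : ZMod (b + 1)) = -1 := by
    rw [eq_neg_iff_add_eq_zero]
    exact_mod_cast ZMod.natCast_self (b + 1)
  rw [glueColour, hb]
  ring

theorem colour_succ (x : GlueDart P.steps.length d) (hx : (P.gluing b).IsForward x) :
    P.glueColour b (P.glueOpp x) = P.glueColour b x + 1 := by
  rcases hx with ⟨i, hi⟩ | hx
  · cases x with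
    | outer t => cases hi
    | onBlack j => cases hi
    | onWhite j =>
      rw [glueColour_onWhite, sub_add_cancel]
      rfl
    | inner t =>
      rw [glueColour_inner_down (h.down_of_white hi) t.2, sub_add_cancel]
      rfl
  · obtain ⟨t, ht, rfl⟩ := h.isBlackBoundary_iff.1 hx
    simp only [glueOpp, glueColour]
    rw [pathHeight_succ_of_up ht]
    push_cast; rfl

theorem card_down_colour (c : ZMod (b + 1)) :
    Nat.card {t : Fin P.steps.length // P.steps[(t : ℕ)]? = some DyckStep.D ∧
      (pathHeight P.steps t : ZMod (b + 1)) = c} +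
      Nat.card {j // (pathHeight P.steps (P.dist j) : ZMod (b + 1)) = c} = d := by
  have hfin := (GlueDart.finite_card P.steps.length d).1
  refine Eq.trans ?_ (ColouredMap.card_white_colour (C := P.gluing b) (μ := μ) hfin
    h.glueNext_bijective h.glueFace_next ?_ h.white_degree h.sum_eq (c - 1))
  · rw [← Nat.card_sum]
    refine Nat.card_congr (Equiv.ofBijective (Sum.elim
      (fun t => ⟨GlueDart.inner t.1, ?_, ?_⟩)
      (fun j => ⟨GlueDart.onWhite j.1, (h.isInternal_onWhite j.1).1, ?_⟩)) ⟨?_, ?_⟩)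
    · exact (h.isWhiteBoundary_outer t.2.1 t.1.2).2
    · exact (glueColour_inner_down t.2.1 t.1.2).trans (by rw [t.2.2])
    · exact (glueColour_onWhite j.1).trans (by rw [j.2])
    · rintro (⟨k, hk⟩ | ⟨j, hj⟩) (⟨l, hl⟩ | ⟨m, hm⟩) e
      · injection e with e
        injection e with e
        subst e; rfl
      · injection e with e; cases e
      · injection e with e; cases e
      · injection e with e
        injection e with e
        subst e; rfl
    · rintro ⟨x, ⟨i, hi⟩, hc⟩
      cases x with
      | outer t => cases hi
      | onBlack j => cases hi
      | onWhite j =>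
        have hc := (glueColour_onWhite (P := P) (b := b) j).symm.trans hc
        exact ⟨Sum.inr ⟨j, sub_left_injective hc⟩, rfl⟩
      | inner t =>
        have hD := h.down_of_white hi
        have hc := (glueColour_inner_down (b := b) hD t.2).symm.trans hc
        exact ⟨Sum.inl ⟨t, hD, sub_left_injective hc⟩, rfl⟩
  · intro x i hi
    have h1 := h.colour_vertex (P.glueOpp x)
    have h2 := h.colour_succ x (Or.inl ⟨i, hi⟩)
    rw [h2] at h1
    refine Eq.trans ?_ h1
    change P.glueColour b (P.glueNext b x) =
      P.glueColour b (P.glueNext b (P.glueOpp (P.glueOpp x)))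
    exact congrArg _ (congrArg _ (glueOpp_glueOpp (P := P) x).symm)

/-- The ℓ - 1 pairs other than the root and the d distinguished vertices have distinct residues, and
there are exactly b + 1 = (ℓ - 1) + d residues. -/
theorem card_pair_colour (c : ZMod (b + 1)) :
    Nat.card {i // i ≠ root ∧ (pathHeight P.steps (P.pair i).1 : ZMod (b + 1)) = c} +
      Nat.card {j // (pathHeight P.steps (P.dist j) : ZMod (b + 1)) = c} = 1 := by
  classical
  let g : {i // i ≠ root} ⊕ Fin d → ZMod (b + 1) :=
    Sum.elim (fun i => pathHeight P.steps (P.pair i.1).1) fun j => pathHeight P.steps (P.dist j)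
  have hg : Function.Injective g := by
    rintro (⟨i, hi⟩ | i) (⟨k, hk⟩ | k) e
    · have := h.pair_residues i k e
      subst this; rfl
    · exact absurd e (h.pair_ne_dist i k hi)
    · exact absurd e.symm (h.pair_ne_dist k i hk)
    · rw [h.dist_residues i k e]
  have hcard : Fintype.card ({i // i ≠ root} ⊕ Fin d) = Fintype.card (ZMod (b + 1)) := by
    have := h.b_add_two
    have := root.pos
    rw [Fintype.card_sum, ZMod.card, Fintype.card_fin, Fintype.card_subtype_compl,
      Fintype.card_fin, Fintype.card_unique]
    omega
  have hbij := (Fintype.bijective_iff_injective_and_card g).2 ⟨hg, hcard⟩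
  obtain ⟨y, hy⟩ := hbij.2 c
  rw [← Nat.card_sum, Nat.card_eq_one_iff_exists]
  obtain ⟨i, hi⟩ | j := y
  · refine ⟨Sum.inl ⟨i, hi, hy⟩, ?_⟩
    rintro (⟨k, hk, hk'⟩ | ⟨k, hk⟩)
    · have := h.pair_residues k i (hk'.trans hy.symm)
      subst this; rfl
    · exact absurd (hy.trans hk.symm) (h.pair_ne_dist i k hi)
  · refine ⟨Sum.inr ⟨j, hy⟩, ?_⟩
    rintro (⟨k, hk, hk'⟩ | ⟨k, hk⟩)
    · exact absurd (hk'.trans hy.symm) (h.pair_ne_dist k j hk)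
    · have := h.dist_residues k j (hk.trans hy.symm)
      subst this; rfl

theorem down_representative {t : ℕ} (ht : P.steps[t]? = some DyckStep.D) :
    P.steps[P.representative root t]? = some DyckStep.D := by
  rcases h.representative_cases t with e | ⟨i, hi, e, e'⟩
  · rwa [e]
  · rw [e']
    exact h.down_v i hi

/-- The active vertices of colour c are the down-steps that start in this colour, with the two
members of each pair counted once. If B of the distinguished vertices have colour c, this gives (d -
B) - (1 - B) = d - 1. -/
theorem hurwitz (c : ZMod (b + 1)) :
    {v : (P.gluing b).Vertex | ∃ x, (P.gluing b).vertex x = v ∧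
      (P.gluing b).IsWhiteBoundary x ∧ (P.gluing b).colour x = c}.ncard = d - 1 := by
  have h1 := h.card_down_colour c
  have h2 := h.card_pair_colour c
  have hfin : Finite (P.gluing b).Vertex := Finite.of_injective _ h.vertexTime_injective
  set A := {v : (P.gluing b).Vertex | ∃ x, (P.gluing b).vertex x = v ∧
      (P.gluing b).IsWhiteBoundary x ∧ (P.gluing b).colour x = c} with hA
  have hmem : ∀ v ∈ A, P.steps[(h.vertexTime v : ℕ)]? = some DyckStep.D ∧
      (pathHeight P.steps (h.vertexTime v) : ZMod (b + 1)) = c := by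
    rintro v ⟨x, rfl, hw, hc⟩
    obtain ⟨t, ht, rfl⟩ := h.isWhiteBoundary_iff.1 hw
    rw [h.vertexTime_outer, h.height_representative]
    exact ⟨h.down_representative ht, hc⟩
  have h3 : Nat.card A + Nat.card {i // i ≠ root ∧
      (pathHeight P.steps (P.pair i).1 : ZMod (b + 1)) = c} =
      Nat.card {t : Fin P.steps.length // P.steps[(t : ℕ)]? = some DyckStep.D ∧
        (pathHeight P.steps t : ZMod (b + 1)) = c} := by
    rw [← Nat.card_sum]
    refine Nat.card_congr (Equiv.ofBijective (Sum.elim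
      (fun v => ⟨h.vertexTime v.1, hmem v.1 v.2⟩)
      fun i => ⟨⟨(P.pair i.1).2, by rw [h.length_eq]; exact h.w_lt i.1 i.2.1⟩,
        h.down_w i.1 i.2.1, by rw [← h.height_pair]; exact i.2.2⟩) ⟨?_, ?_⟩)
    · rintro (⟨v, hv⟩ | ⟨i, hi, hi'⟩) (⟨v', hv'⟩ | ⟨k, hk, hk'⟩) e
      · injection e with e
        have := h.vertexTime_injective e
        subst this; rfl
      · injection e with e
        exact absurd (congrArg Fin.val e) (h.vertexTime_ne v hk)
      · injection e with e
        exact absurd (congrArg Fin.val e).symm (h.vertexTime_ne v' hi)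
      · injection e with e
        have := h.eq_of_w_eq_w (congrArg Fin.val e)
        subst this; rfl
    · rintro ⟨t, ht, hc⟩
      by_cases hex : ∃ i, i ≠ root ∧ (t : ℕ) = (P.pair i).2
      · obtain ⟨i, hi, e⟩ := hex
        refine ⟨Sum.inr ⟨i, hi, ?_⟩, Subtype.ext (Fin.ext e.symm)⟩
        rw [h.height_pair, ← e, hc]
      · push Not at hex
        refine ⟨Sum.inl ⟨(P.gluing b).vertex (GlueDart.outer t), GlueDart.outer t, rfl,
          h.isWhiteBoundary_outer ht t.2, hc⟩, Subtype.ext (Fin.ext ?_)⟩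
        exact (h.vertexTime_outer t).trans (representative_of_ne hex)
  rw [← Nat.card_coe_set_eq]
  omega

theorem isCactus : (P.gluing b).IsCactus 0 d μ fun _ : Fin d => 1 where
  surface := h.isSurfaceGraph
  white_degree := h.white_degree
  black_degree := h.black_degree
  edge_types := h.edge_types
  colour_vertex := h.colour_vertex
  colour_succ := h.colour_succ
  vertex_boundary x :=
    ⟨GlueDart.outer ⟨P.startTime b x, h.startTime_lt x⟩, (h.vertex_startTime x).symm, rfl⟩
  hurwitz := h.hurwitz

omit h in
/-- The label of a boundary corner is the height of the corresponding vertex of the path. -/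
def glueLabel (P : MarkedPath ℓ d) : GlueDart P.steps.length d → ℕ
  | GlueDart.outer t => (pathHeight P.steps t).toNat
  | _ => 0

theorem exists_outer {x : GlueDart P.steps.length d}
    (hx : P.glueFace b x = FaceName.boundary) : ∃ t, x = GlueDart.outer t := by
  rcases h.dart_cases x with hx' | ⟨j, rfl⟩ | ⟨j, t, hlt, h1, h2, rfl⟩ | ⟨t, ht, rfl⟩
  · exact hx'
  · cases hx
  · rw [h.glueFace_inner_block h1 h2] at hx; cases hx
  · obtain ⟨i, -, e⟩ := h.exists_glueFace_side ht
    rw [hx] at e; cases e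

theorem glueLabel_next (t : Fin P.steps.length) :
    (glueLabel P (P.glueNext b (GlueDart.outer t)) : ℤ) = pathHeight P.steps (t + 1) := by
  simp only [glueNext, glueLabel]
  rw [h.height_mod (Nat.succ_le_of_lt t.2), Int.toNat_of_nonneg (h.height_nonneg _)]

theorem glueLabel_outer (t : Fin P.steps.length) :
    (glueLabel P (GlueDart.outer t) : ℤ) = pathHeight P.steps t :=
  Int.toNat_of_nonneg (h.height_nonneg _)

theorem isLabelledCactus : (P.gluing b).IsLabelledCactus μ (glueLabel P) where
  cactus := h.isCactus
  canonical :=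
    { exists_zero := ⟨GlueDart.outer ⟨0, h.steps_length_pos⟩, rfl, by
        simp [glueLabel, pathHeight_zero]⟩
      black_step := by
        intro x hx
        obtain ⟨t, ht, rfl⟩ := h.isBlackBoundary_iff.1 hx
        have h1 := h.glueLabel_next t
        have h2 := h.glueLabel_outer t
        rw [pathHeight_succ_of_up ht, ← h2] at h1
        exact_mod_cast h1
      white_step := by
        intro x hx
        obtain ⟨t, ht, rfl⟩ := h.isWhiteBoundary_iff.1 hx
        have h1 := h.glueLabel_next t
        have h2 := h.glueLabel_outer t
        rw [pathHeight_succ_of_down ht, ← h2] at h1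
        have h3 : glueLabel P (GlueDart.outer t) =
          glueLabel P (P.glueNext b (GlueDart.outer t)) + 1 := by omega
        exact h3 }
  coherent := by
    intro x y hx hy e
    obtain ⟨s, rfl⟩ := h.exists_outer hx
    obtain ⟨t, rfl⟩ := h.exists_outer hy
    have h1 := h.vertex_eq_iff.1 e
    have h2 : pathHeight P.steps s = pathHeight P.steps t := by
      rw [← h.height_representative, ← h.height_representative t]
      exact congrArg _ h1
    simp only [glueLabel, h2]
  proper := by
    intro x hx h0
    obtain ⟨t, rfl⟩ := h.exists_outer hx
    have h1 := h.glueLabel_outer t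
    rw [h0] at h1
    change ((pathHeight P.steps t : ℤ) : ZMod (b + 1)) = 0
    rw [← h1]
    simp
  positive := by
    intro e he x y hx hy ex ey
    obtain ⟨j, rfl⟩ := h.isInternal_iff.1 he
    obtain ⟨s, rfl⟩ := h.exists_outer hx
    obtain ⟨t, rfl⟩ := h.exists_outer hy
    have h1 := congrArg (pathHeight P.steps) (h.vertex_eq_iff.1 ex)
    have h2 := congrArg (pathHeight P.steps) (h.vertex_eq_iff.1 ey)
    rw [h.height_representative, h.height_representative] at h1 h2
    -- The internal edge leads from the top of the block back to its bottom, so the numerator of its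
    -- weight is b + 1.
    have h3 : pathHeight P.steps s = pathHeight P.steps (P.dist j) + b := by
      refine h1.trans ?_
      rw [startTime, h.height_mod (by rw [h.length_eq]; exact h.dist_add_le j),
        pathHeight_add fun t h1 h2 => h.blocks.up h1 h2]
    have h4 : pathHeight P.steps t = pathHeight P.steps (P.dist j) := h2
    have h5 := h.glueLabel_outer s
    have h6 := h.glueLabel_outer t
    have h7 : glueLabel P (GlueDart.outer s) = glueLabel P (GlueDart.outer t) + b := by omega
    rw [h7]
    push_cast
    have : ((glueLabel P (GlueDart.outer t) : ℚ) + b + 1 - glueLabel P (GlueDart.outer t)) =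
      b + 1 := by ring
    rw [this]
    positivity
  b_add_two := h.b_add_two
  two_le := h.two_le
  pos := h.pos
  sum_eq := h.sum_eq

theorem isRootedCactus : (P.gluing b).IsRootedCactus μ (glueLabel P)
    (GlueDart.outer ⟨0, h.steps_length_pos⟩ : GlueDart P.steps.length d) where
  toIsLabelledCactus := h.isLabelledCactus
  root_face := rfl
  root_label := by simp [glueLabel, pathHeight_zero]

end IsHurwitzPath

end MarkedPath

/-! ### The lattice path of the glued map is the original path -/

namespace MarkedPath

namespace IsHurwitzPath

variable {ℓ d b : ℕ} {μ : Fin ℓ → ℕ} {root : Fin ℓ} {P : MarkedPath ℓ d}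
  (h : P.IsHurwitzPath b μ root)
include h

theorem walk_gluing {t : ℕ} (ht : t < P.steps.length) :
    (P.gluing b).walk (GlueDart.outer ⟨0, h.steps_length_pos⟩ : GlueDart P.steps.length d) t =
      (GlueDart.outer ⟨t, ht⟩ : GlueDart P.steps.length d) := by
  induction t with
  | zero => rfl
  | succ t ih =>
    refine (ColouredMap.IsRootedCactus.walk_succ _ _).trans ((congrArg _ (ih (by omega))).trans ?_)
    simp only [gluing, glueNext, Nat.mod_eq_of_lt ht]

theorem cur_zero : h.isRootedCactus.cur 0 = root := by
  obtain ⟨j, hj⟩ := h.exists_dist_eq_zero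
  have hC := h.isRootedCactus
  have hb := h.b_pos
  rw [hC.cur_eq_iff_face]
  have hbl : (P.gluing b).face ((P.gluing b).opp ((P.gluing b).walk
      (GlueDart.outer ⟨0, h.steps_length_pos⟩ : GlueDart P.steps.length d) 0)) =
      FaceName.black j :=
    h.glueFace_inner_block (j := j) (t := 0) (by omega) (by omega) h.steps_length_pos
  have e : (GlueDart.onBlack j : GlueDart P.steps.length d) = hC.blackSide j := by
    refine hC.eq_blackSide (y := (GlueDart.onBlack j : GlueDart P.steps.length d)) rfl ?_
    obtain ⟨⟨i, hi⟩, -⟩ := h.isInternal_onWhite j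
    intro e
    have := hi.symm.trans e
    cases this
  rw [hC.whiteDart_of_black hbl, ← e]
  refine h.glueFace_onWhite_iff.2 ?_
  rw [hj]
  refine ⟨h.inInterval_root h.length_pos, fun i hi _ _ hin => ?_⟩
  have := h.v_pos i hi
  have := hin.1
  omega

theorem isMarkedPairAt_gluing {i : Fin ℓ} (hi : i ≠ root) : (P.gluing b).IsMarkedPairAt
    (GlueDart.outer ⟨0, h.steps_length_pos⟩ : GlueDart P.steps.length d) i (P.pair i) := by
  have hvw := h.v_lt_w i
  have hw : (P.pair i).2 < P.steps.length := by rw [h.length_eq]; exact h.w_lt i hi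
  have hv := hvw.trans hw
  have hdv := h.down_v i hi
  have hdw := h.down_w i hi
  have hS := h.isSurfaceGraph
  have hess : P.InEssential i (P.pair i).1 :=
    ⟨⟨le_rfl, hvw⟩, fun n hn h3 h4 h5 => hn (h.eq_of_v_eq_v (le_antisymm h5.1 h3))⟩
  have hfv := (h.glueFace_inner_down_iff hdv hv).2 hess
  obtain ⟨k, hk, hfw⟩ := h.exists_glueFace_side (Or.inl hdw)
  rw [h.side_down hdw hw] at hfw
  have hvert : ∀ t (ht : t < P.steps.length), (P.gluing b).vertex
      (P.glueNext b (GlueDart.inner ⟨t, ht⟩)) = (P.gluing b).vertex (GlueDart.outer ⟨t, ht⟩) :=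
    fun t ht => hS.vertex_next (GlueDart.inner ⟨t, ht⟩)
  refine ⟨hvw, ?_, ?_, ?_, ?_⟩
  · rw [h.isRootedCactus.boundaryLength_eq]
    exact h.w_lt i hi
  · rw [h.walk_gluing hv, h.walk_gluing hw]
    exact h.vertex_pair hi hv hw
  · rw [h.walk_gluing hv]
    refine ⟨P.glueNext b (GlueDart.inner ⟨_, hv⟩), P.glueNext b (GlueDart.inner ⟨_, hw⟩), i, k,
      hvert _ _, (hvert _ _).trans (h.vertex_pair hi hv hw).symm, ?_,
      (h.glueFace_next _).trans hfv, (h.glueFace_next _).trans hfw⟩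
    -- The polygon met at the second vertex is not `i`, because intervals are half-open.
    rintro rfl
    exact lt_irrefl _ hk.1.2
  · rw [h.walk_gluing hv]
    exact hfv

theorem latticePath_gluing : (P.gluing b).latticePath = P := by
  have hC := h.isRootedCactus
  have hlen := h.length_eq
  rw [hC.latticePath_eq]
  refine MarkedPath.ext (List.ext_getElem? fun t => ?_) (funext fun i => ?_) (funext fun j => ?_)
  · by_cases ht : t < P.steps.length
    · by_cases hup : P.steps[t]? = some DyckStep.U
      · rw [hup, hC.steps_eq_U_iff, h.walk_gluing ht]
        exact ⟨by omega, h.isBlackBoundary_outer hup ht⟩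
      · have hD := getElem?_eq_D_iff.2 ⟨ht, hup⟩
        rw [hD, hC.steps_eq_D_iff, h.walk_gluing ht]
        exact ⟨by omega, h.isWhiteBoundary_outer hD ht⟩
    · rw [List.getElem?_eq_none (by rw [hC.steps_length]; omega), List.getElem?_eq_none (by omega)]
  · rw [hC.boundaryPath_pair]
    by_cases hi : i = root
    · rw [hi, h.pair_root]
      have := hC.visits_root
      rwa [h.cur_zero] at this
    · exact (hC.isMarkedPairAt_iff.1 (h.isMarkedPairAt_gluing hi)).2
  · have hb := h.b_pos
    have hblock : ∀ t, t < P.steps.length → (hC.blockTime j ≤ t ∧ t < hC.blockTime j + b ↔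
        P.dist j ≤ t ∧ t < P.dist j + b) := by
      intro t ht
      rw [← hC.face_opp_walk_eq_black_iff (hlen ▸ ht), h.walk_gluing ht]
      exact ⟨fun e => h.block_of_black e, fun e => h.glueFace_inner_block e.1 e.2 ht⟩
    rw [hC.boundaryPath_dist]
    have h1 := (hblock (P.dist j) (h.dist_lt j)).2 ⟨le_rfl, by omega⟩
    have h2 := (hblock (hC.blockTime j) ((hC.blockTime_lt j).trans_eq hlen.symm)).1 ⟨le_rfl, by omega⟩
    exact le_antisymm h1.1 h2.1

end IsHurwitzPath

end MarkedPath

namespace ColouredMap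

/-! ### A cactus is glued along its lattice path -/

namespace IsRootedCactus

variable {ℓ d b : ℕ} {μ : Fin ℓ → ℕ} {C : ColouredMap ℓ d b} {δ : C.Dart → ℕ} {x : C.Dart}

/-- The side of the map glued along the lattice path of a cactus, as a dart of the cactus. -/
noncomputable def ofGlueDart (h : C.IsRootedCactus μ δ x) :
    GlueDart (C.boundaryPath x).steps.length d → C.Dart
  | GlueDart.outer t => C.walk x t
  | GlueDart.inner t => C.opp (C.walk x t)
  | GlueDart.onBlack j => h.blackSide j
  | GlueDart.onWhite j => C.opp (h.blackSide j)

variable (h : C.IsRootedCactus μ δ x)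
include h

/-- Every dart of the cactus is a boundary dart, the opposite of one, or a side of an internal edge.
Both sets have 4bd + 2d elements, so surjectivity suffices. -/
theorem ofGlueDart_bijective : Function.Bijective h.ofGlueDart := by
  have hlen := h.steps_length
  obtain ⟨hfin, hcard⟩ := GlueDart.finite_card (C.boundaryPath x).steps.length d
  have hsurj : Function.Surjective h.ofGlueDart := by
    intro y
    by_cases hy : C.face y = FaceName.boundary
    · obtain ⟨t, ht, rfl⟩ := h.exists_walk hy
      exact ⟨GlueDart.outer ⟨t, by omega⟩, rfl⟩
    by_cases hy' : C.face (C.opp y) = FaceName.boundary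
    · obtain ⟨t, ht, e⟩ := h.exists_walk hy'
      refine ⟨GlueDart.inner ⟨t, by omega⟩, ?_⟩
      simp only [ofGlueDart, e, h.opp_opp]
    · cases hf : C.face y with
      | boundary => exact absurd hf hy
      | black j => exact ⟨GlueDart.onBlack j, (h.eq_blackSide hf hy').symm⟩
      | white i =>
        obtain ⟨j, hj⟩ := (h.white_cases hf).resolve_left hy'
        refine ⟨GlueDart.onWhite j, ?_⟩
        have e := h.eq_blackSide hj (by rwa [h.opp_opp])
        simp only [ofGlueDart, ← e, h.opp_opp]
  refine hsurj.bijective_of_nat_card_le ?_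
  rw [hcard, h.card_dart, hlen]
  apply le_of_eq
  ring

theorem isWhiteTime_iff {t : ℕ} : (C.boundaryPath x).IsWhiteTime t ↔ h.WhiteTime t := by
  simp only [MarkedPath.IsWhiteTime, WhiteTime, h.steps_eq_D_iff, Set.mem_range,
    h.boundaryPath_dist]
  constructor
  · rintro (⟨h1, h2⟩ | ⟨j, rfl⟩)
    exacts [⟨h1, Or.inl h2⟩, ⟨h.blockTime_lt j, Or.inr ⟨j, rfl⟩⟩]
  · rintro ⟨h1, h2 | h2⟩
    exacts [Or.inl ⟨h1, h2⟩, Or.inr h2]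

theorem boundaryPath_endTime (t : ℕ) : (C.boundaryPath x).endTime b t = h.endTime t := by
  simp only [MarkedPath.endTime, endTime, Set.mem_range, h.boundaryPath_dist]

theorem next_whiteDart_of_follows {k t : ℕ} (hk : h.WhiteTime k) (ht : h.WhiteTime t)
    (hkt : (C.boundaryPath x).Follows b (h.cur 0) k t) :
    C.next (h.whiteDart t) = h.whiteDart k := by
  refine h.next_whiteDart hk ht ?_
  simpa only [MarkedPath.Follows, h.boundaryPath_endTime, h.boundaryPath_pair] using hkt

variable (hP : (C.boundaryPath x).IsHurwitzPath b μ (h.cur 0))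
include hP

theorem ofGlueDart_side {t : ℕ} (ht : h.WhiteTime t) :
    h.ofGlueDart (hP.side t) = h.whiteDart t := by
  obtain ⟨hlt, hw | ⟨j, rfl⟩⟩ := ht
  · rw [h.whiteDart_of_white hw, hP.side_down (h.steps_eq_D_iff.2 ⟨hlt, hw⟩)
      (by rw [h.steps_length]; exact hlt)]
    rfl
  · rw [h.whiteDart_blockTime, ← h.boundaryPath_dist, hP.side_dist]
    rfl

/-- On white sides both maps obey the relation `Follows`. On black sides this is the fact that the
boundary edges of a black face form a block of consecutive times. -/
theorem ofGlueDart_next (y : GlueDart (C.boundaryPath x).steps.length d) :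
    h.ofGlueDart ((C.boundaryPath x).glueNext b y) = C.next (h.ofGlueDart y) := by
  have hlen := h.steps_length
  have hd := h.boundaryPath_dist
  rcases hP.dart_cases y with ⟨t, rfl⟩ | ⟨j, rfl⟩ | ⟨j, t, hlt, h1, h2, rfl⟩ | ⟨t, ht, rfl⟩
  · simp only [ofGlueDart, MarkedPath.glueNext]
    rw [← walk_succ, h.walk_eq_iff]
    have key : ∀ N, N = 2 * b * d → ((t : ℕ) + 1) % N ≡ (t : ℕ) + 1 [MOD 2 * b * d] := by
      rintro _ rfl
      exact Nat.mod_modEq _ _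
    exact key _ hlen
  · rw [hP.glueNext_onBlack]
    simp only [ofGlueDart, hd]
    exact (h.opp_walk_blockTime_last j).symm
  · rcases h1.eq_or_lt with rfl | h1
    · rw [hP.glueNext_inner_dist]
      simp only [ofGlueDart, hd]
      exact (h.next_opp_walk_blockTime j).symm
    · rw [hP.glueNext_inner_interior h1 h2]
      rw [hd] at h1 h2
      obtain ⟨k, rfl⟩ := Nat.exists_eq_add_of_lt h1
      simp only [ofGlueDart]
      exact (h.next_opp_walk_blockTime_add (j := j) (k := k) (by omega)).symm
  · obtain ⟨k, hk, hkt⟩ := hP.exists_follows_left ht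
    rw [hP.glueNext_side hk ht hkt, h.ofGlueDart_side hP (h.isWhiteTime_iff.1 hk),
      h.ofGlueDart_side hP (h.isWhiteTime_iff.1 ht)]
    exact (h.next_whiteDart_of_follows (h.isWhiteTime_iff.1 hk) (h.isWhiteTime_iff.1 ht) hkt).symm

theorem face_ofGlueDart (y : GlueDart (C.boundaryPath x).steps.length d) :
    C.face (h.ofGlueDart y) = (C.boundaryPath x).glueFace b y := by
  have hd := h.boundaryPath_dist
  rcases hP.dart_cases y with ⟨t, rfl⟩ | ⟨j, rfl⟩ | ⟨j, t, hlt, h1, h2, rfl⟩ | ⟨t, ht, rfl⟩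
  · exact h.face_walk t
  · exact h.face_blackSide j
  · rw [hP.glueFace_inner_block h1 h2]
    rw [hd] at h1 h2
    have := h.steps_length
    exact (h.face_opp_walk_eq_black_iff (by omega)).2 ⟨h1, h2⟩
  · obtain ⟨i, hi, e⟩ := hP.exists_glueFace_side ht
    have ht' := h.isWhiteTime_iff.1 ht
    rw [e, h.ofGlueDart_side hP ht', h.face_whiteDart, (h.inEssential_iff ht'.1).1 hi]

omit hP in
theorem colour_ofGlueDart (y : GlueDart (C.boundaryPath x).steps.length d) :
    C.colour (h.ofGlueDart y) = (C.boundaryPath x).glueColour b y := by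
  have hlen := h.steps_length
  have hd := h.boundaryPath_dist
  cases y with
  | outer t => exact (h.height_colour (hlen ▸ t.2.le)).symm
  | inner t =>
    simp only [ofGlueDart, MarkedPath.glueColour]
    rw [h.colour_congr (h.vertex_opp_walk t), h.height_colour (hlen ▸ t.2)]
  | onBlack j =>
    simp only [ofGlueDart, MarkedPath.glueColour]
    rw [h.colour_congr (h.vertex_blackSide j), hd, h.height_colour (h.blockTime_lt j).le]
  | onWhite j =>
    simp only [ofGlueDart, MarkedPath.glueColour]
    rw [h.colour_congr (h.vertex_opp_blackSide j), ← h.height_colour (h.blockTime_add_le j), hd,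
      pathHeight_add fun t h1 h2 => h.hasBlocks.up h1 h2]
    push_cast; rfl

theorem gluing_iso : ((C.boundaryPath x).gluing b).Iso C := by
  refine ⟨Equiv.ofBijective _ h.ofGlueDart_bijective, fun y => ⟨?_, h.ofGlueDart_next hP y,
    h.face_ofGlueDart hP y, h.colour_ofGlueDart y⟩⟩
  cases y with
  | outer t => rfl
  | inner t => exact (h.opp_opp _).symm
  | onBlack j => rfl
  | onWhite j => exact (h.opp_opp _).symm

end IsRootedCactus

/-! ### Isomorphic cacti have the same lattice path -/

section Iso

variable {m n b : ℕ} {C C' : ColouredMap m n b}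

theorem vertex_eq_of_iso {e : C.Dart ≃ C'.Dart}
    (he : ∀ x, e (C.opp x) = C'.opp (e x) ∧ e (C.next x) = C'.next (e x) ∧
      C'.face (e x) = C.face x ∧ C'.colour (e x) = C.colour x)
    {x y : C.Dart} (hxy : C.vertex x = C.vertex y) : C'.vertex (e x) = C'.vertex (e y) :=
  congrArg (Quot.lift (fun x => C'.vertex (e x)) fun x y (hxy : C.rot x = y) => by
    rw [← hxy, rot, (he _).2.1, (he _).1]
    exact (vertex_rot (e x)).symm) hxy

theorem walk_iso {e : C.Dart ≃ C'.Dart}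
    (he : ∀ x, e (C.opp x) = C'.opp (e x) ∧ e (C.next x) = C'.next (e x) ∧
      C'.face (e x) = C.face x ∧ C'.colour (e x) = C.colour x) (x : C.Dart) (t : ℕ) :
    C'.walk (e x) t = e (C.walk x t) := by
  induction t with
  | zero => rfl
  | succ t ih =>
    rw [IsRootedCactus.walk_succ, IsRootedCactus.walk_succ, ih, (he _).2.1]

theorem boundaryLength_iso (h : C.Iso C') : C.boundaryLength = C'.boundaryLength := by
  obtain ⟨e, he⟩ := h
  exact Nat.card_congr (Equiv.subtypeEquiv e fun x => by rw [(he x).2.2.1])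

theorem isMarkedPairAt_of_iso {e : C.Dart ≃ C'.Dart}
    (he : ∀ x, e (C.opp x) = C'.opp (e x) ∧ e (C.next x) = C'.next (e x) ∧
      C'.face (e x) = C.face x ∧ C'.colour (e x) = C.colour x) {x : C.Dart} {i : Fin m}
    {p : ℕ × ℕ} (h : C.IsMarkedPairAt x i p) : C'.IsMarkedPairAt (e x) i p := by
  obtain ⟨h1, h2, h3, ⟨y, z, k, k', h4, h5, h6, h7, h8⟩, h9⟩ := h
  refine ⟨h1, by rwa [← boundaryLength_iso ⟨e, he⟩], ?_, ?_, ?_⟩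
  · rw [walk_iso he, walk_iso he]
    exact vertex_eq_of_iso he h3
  · rw [walk_iso he]
    exact ⟨e y, e z, k, k', vertex_eq_of_iso he h4, vertex_eq_of_iso he h5, h6,
      by rw [(he y).2.2.1, h7], by rw [(he z).2.2.1, h8]⟩
  · rw [walk_iso he, ← (he _).1, (he _).2.2.1, h9]

theorem isBlackBoundary_iso {e : C.Dart ≃ C'.Dart}
    (he : ∀ x, e (C.opp x) = C'.opp (e x) ∧ e (C.next x) = C'.next (e x) ∧
      C'.face (e x) = C.face x ∧ C'.colour (e x) = C.colour x) {x : C.Dart} :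
    C'.IsBlackBoundary (e x) ↔ C.IsBlackBoundary x := by
  simp only [IsBlackBoundary, (he _).2.2.1, ← (he _).1]

theorem isWhiteBoundary_iso {e : C.Dart ≃ C'.Dart}
    (he : ∀ x, e (C.opp x) = C'.opp (e x) ∧ e (C.next x) = C'.next (e x) ∧
      C'.face (e x) = C.face x ∧ C'.colour (e x) = C.colour x) {x : C.Dart} :
    C'.IsWhiteBoundary (e x) ↔ C.IsWhiteBoundary x := by
  simp only [IsWhiteBoundary, (he _).2.2.1, ← (he _).1]

theorem isMarked_of_iso {e : C.Dart ≃ C'.Dart}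
    (he : ∀ x, e (C.opp x) = C'.opp (e x) ∧ e (C.next x) = C'.next (e x) ∧
      C'.face (e x) = C.face x ∧ C'.colour (e x) = C.colour x) {x : C.Dart}
    (h : C'.IsMarked (e x)) : C.IsMarked x := by
  obtain ⟨h1, δ, hδ, h0⟩ := h
  refine ⟨by rwa [(he x).2.2.1] at h1, fun y => δ (e y), ⟨?_, fun y hy => ?_, fun y hy => ?_⟩, h0⟩
  · obtain ⟨y, hy, hy0⟩ := hδ.exists_zero
    obtain ⟨y, rfl⟩ := e.surjective y
    exact ⟨y, by rwa [(he y).2.2.1] at hy, hy0⟩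
  · rw [(he y).2.1]
    exact hδ.black_step _ ((isBlackBoundary_iso he).2 hy)
  · rw [(he y).2.1]
    exact hδ.white_step _ ((isWhiteBoundary_iso he).2 hy)

open Classical in
theorem boundaryPath_iso {e : C.Dart ≃ C'.Dart}
    (he : ∀ x, e (C.opp x) = C'.opp (e x) ∧ e (C.next x) = C'.next (e x) ∧
      C'.face (e x) = C.face x ∧ C'.colour (e x) = C.colour x) (x : C.Dart) :
    C'.boundaryPath (e x) = C.boundaryPath x := by
  have he' : ∀ y, e.symm (C'.opp y) = C.opp (e.symm y) ∧ e.symm (C'.next y) = C.next (e.symm y) ∧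
      C.face (e.symm y) = C'.face y ∧ C.colour (e.symm y) = C'.colour y := by
    intro y
    obtain ⟨x, rfl⟩ := e.surjective y
    simp [← (he x).1, ← (he x).2.1, (he x).2.2.1, (he x).2.2.2]
  have hpair : ∀ i, C'.IsMarkedPairAt (e x) i = C.IsMarkedPairAt x i := fun i =>
    funext fun p => propext ⟨fun hp => by simpa using isMarkedPairAt_of_iso he' hp,
      isMarkedPairAt_of_iso he⟩
  have hlen := boundaryLength_iso ⟨e, he⟩
  -- The chosen pair depends only on the predicate, and an isomorphism makes the two predicates
  -- equal.
  have hchoose : ∀ {Q Q' : ℕ × ℕ → Prop} {z z' : ℕ × ℕ}, Q = Q' → z = z' →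
      (if h : ∃ p, Q p then h.choose else z) = if h : ∃ p, Q' p then h.choose else z' := by
    rintro _ _ _ _ rfl rfl
    rfl
  refine MarkedPath.ext ?_ (funext fun i => hchoose (hpair i) (by rw [hlen])) (funext fun j => ?_)
  · simp only [boundaryPath, ← hlen]
    refine List.map_congr_left fun t _ => if_congr ?_ rfl rfl
    rw [walk_iso he, isBlackBoundary_iso he]
  · simp only [boundaryPath, walk_iso he, ← (he _).1, (he _).2.2.1]

end Iso

theorem IsRootedCactus.latticePath_iso {ℓ d b : ℕ} {μ : Fin ℓ → ℕ} {C C' : ColouredMap ℓ d b}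
    {δ : C.Dart → ℕ} {x : C.Dart} {δ' : C'.Dart → ℕ} {x' : C'.Dart}
    (h : C.IsRootedCactus μ δ x) (h' : C'.IsRootedCactus μ δ' x') (hiso : C.Iso C') :
    C.latticePath = C'.latticePath := by
  obtain ⟨e, he⟩ := hiso
  obtain ⟨y, rfl⟩ := e.surjective x'
  have hy := h.isMarked_iff.1 (isMarked_of_iso he (h'.isMarked_iff.2 rfl))
  subst hy
  rw [h.latticePath_eq, h'.latticePath_eq, boundaryPath_iso he]

theorem IsProperCactus.exists_isRootedCactus {ℓ d b : ℕ} {μ : Fin ℓ → ℕ} {C : ColouredMap ℓ d b}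
    (hC : C.IsProperCactus 0 d μ fun _ : Fin d => 1) (hb : b + 2 = ℓ + d) (hd : 2 ≤ d)
    (hμ : ∀ i, 0 < μ i) (hsum : ∑ i, μ i = d) : ∃ δ x, C.IsRootedCactus μ δ x := by
  obtain ⟨h1, δ, h2, h3, h4, h5⟩ := hC
  obtain ⟨x, hx, h0⟩ := h2.exists_zero
  exact ⟨δ, x, ⟨h1, h2, h3, h4, h5, hb, hd, hμ, hsum⟩, hx, h0⟩

end ColouredMap

/-! ### The bijection -/

theorem mainTheorem5 {ℓ d : ℕ} (hd : 2 ≤ d) (μ : Fin ℓ → ℕ) (hμ : ∀ i, 0 < μ i)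
    (hsum : ∑ i, μ i = d) :
    (∀ C : GenusZeroCactus d μ, C.1.latticePath.IsSingleHurwitz μ) ∧
    (∀ P : SingleHurwitzDyckPath d μ,
      (P.1.gluing (ℓ + d - 2)).IsProperCactus 0 d μ fun _ : Fin d => 1) ∧
    ∃ D : CactusClass d μ → SingleHurwitzDyckPath d μ,
      (∀ C : GenusZeroCactus d μ, (D (Quotient.mk _ C)).1 = C.1.latticePath) ∧
      Function.Bijective D ∧
      ∀ (P : SingleHurwitzDyckPath d μ)
        (h : (P.1.gluing (ℓ + d - 2)).IsProperCactus 0 d μ fun _ : Fin d => 1),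
        D (Quotient.mk _ ⟨P.1.gluing (ℓ + d - 2), h⟩) = P := by
  have hrooted : ∀ C : GenusZeroCactus d μ, ∃ δ x, C.1.IsRootedCactus μ δ x := fun C =>
    C.2.exists_isRootedCactus (by omega) hd hμ hsum
  have hpath : ∀ C : GenusZeroCactus d μ, C.1.latticePath.IsSingleHurwitz μ := by
    intro C
    obtain ⟨δ, x, h⟩ := hrooted C
    rw [h.latticePath_eq]
    exact h.isSingleHurwitz
  have hglue : ∀ P : SingleHurwitzDyckPath d μ,
      (P.1.gluing (ℓ + d - 2)).IsProperCactus 0 d μ fun _ : Fin d => 1 := by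
    intro P
    obtain ⟨root, h⟩ := P.2.exists_isHurwitzPath hd hμ hsum
    have hC := h.isLabelledCactus
    exact ⟨hC.cactus, _, hC.canonical, hC.coherent, hC.proper, hC.positive⟩
  have hback : ∀ P : SingleHurwitzDyckPath d μ, (P.1.gluing (ℓ + d - 2)).latticePath = P.1 := by
    intro P
    obtain ⟨root, h⟩ := P.2.exists_isHurwitzPath hd hμ hsum
    exact h.latticePath_gluing
  have hiso : ∀ C : GenusZeroCactus d μ, (C.1.latticePath.gluing (ℓ + d - 2)).Iso C.1 := by
    intro C
    obtain ⟨δ, x, h⟩ := hrooted C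
    rw [h.latticePath_eq]
    obtain ⟨root, hP⟩ := h.isSingleHurwitz.exists_isHurwitzPath hd hμ hsum
    -- Only the white face at the root has a pair that reaches the end of the path.
    have hroot : root = h.cur 0 := by
      by_contra hne
      have h1 := (h.visits_spec root hne).2.2.1
      have h2 := hP.pair_root
      rw [h.boundaryPath_pair] at h2
      rw [h2] at h1
      exact lt_irrefl _ h1
    subst hroot
    exact h.gluing_iso hP
  refine ⟨hpath, hglue, Quotient.lift (fun C => ⟨C.1.latticePath, hpath C⟩) ?_, fun C => rfl,
    ⟨?_, ?_⟩, fun P h => Subtype.ext (hback P)⟩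
  · intro C C' hCC
    obtain ⟨δ, x, h⟩ := hrooted C
    obtain ⟨δ', x', h'⟩ := hrooted C'
    exact Subtype.ext (h.latticePath_iso h' hCC)
  -- Both cacti are isomorphic to the map glued along their common path.
  · rintro ⟨C⟩ ⟨C'⟩ e
    have e' : C.1.latticePath = C'.1.latticePath := congrArg Subtype.val e
    refine Quotient.sound (s := genusZeroCactusSetoid d μ) ?_
    exact ((hiso C).symm).trans (e' ▸ hiso C')
  · intro P
    exact ⟨Quotient.mk _ ⟨P.1.gluing (ℓ + d - 2), hglue P⟩, Subtype.ext (hback P)⟩
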